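/- Let $n\ge 1$ be an integer and let $G=\mathbb R\ltimes\mathbb R^n$ be the group with underlying manifold $\mathbb R\times\mathbb R^n$ and group law $(x,y)(x',y')=(x+x',\,y+e^x y')$, equipped with the right Haar measure $dg=dx\,dy_1\cdots dy_n$. Consider the left-invariant vector fields $X=\partial_x$, $Y_j=e^x\partial_{y_j}$ $(1\le j\le n)$, and let $L$ be the closure in $L^2(G)=L^2(G,dg)$ of the operator $-X^2-\sum_{j=1}^n Y_j^2$ with domain $C_c^\infty(G)$. Let $$R(x,y)=\operatorname{arcch}\bigl(\operatorname{ch}x+\tfrac12\|y\|^2e^{-x}\bigr)\in[0,\infty)$$ be the left-invariant Riemannian distance of $(x,y)$ to the identity, and put $B_R=\{g\in G: R(g)<R\}$. For a function $u$ on $(0,\infty)$ let $D_{\rm sh}u=\frac{d}{dv}\bigl(\frac{u(v)}{\operatorname{sh}v}\bigr)$, and let $D^l_{\rm sh}$ be the $l$-th power of $D_{\rm sh}$. Then $L$ is self-adjoint, and there is a constant $C_n$ depending only on $n$ such that the following holds. Let $\lambda\in\mathbb C\setminus[0,\infty)$, let $\nu=i\sqrt\lambda$, where the square root is chosen such that $\operatorname{Re}\nu<0$,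 and let $l$ be any integer with $-\frac n2+l>-1$. For $(x,y)\ne(0,0)$ and $R=R(x,y)$ put $$k(x,y)=(-1)^l\,\frac{2^{-1-n/2}\pi^{-n/2}}{\Gamma(1-\frac n2+l)}\,e^{-nx/2}\int_R^\infty D^l_{\rm sh}[e^{\nu v}]\,(\operatorname{ch}v-\operatorname{ch}R)^{-\frac n2+l}\,dv .$$ This integral converges absolutely, $k\in L^1(G)$, and for every $R>0$ $$\int_{B_R}|k|\,dx\,dy\le C_n(1+|\nu|)^{n/2}\Bigl[1+\int_0^R e^{\operatorname{Re}(\nu)r}\,r\,dr\Bigr].$$ Moreover $\lambda$ belongs to the resolvent set of $L$, and $(L-\lambda)^{-1}$ is right convolution with $k$: for every $f\in L^2(G)$ and almost every $g'\in G$, $$\bigl((L-\lambda)^{-1}f\bigr)(g')=\int_G f(g^{-1})\,k(gg')\,dg,$$ with absolutely convergent integral. -/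

import Mathlib

open MeasureTheory Set
open scoped ContDiff

noncomputable section

/-- The underlying manifold `ℝ × ℝⁿ` of the `ax + b` group `G = ℝ ⋉ ℝⁿ`. It carries Lebesgue measure
`dg = dx dy₁ … dyₙ` (the instance `volume`), which is a right Haar measure for the group law below. -/
abbrev AxB (n : ℕ) : Type := ℝ × EuclideanSpace ℝ (Fin n)

namespace AxB

/-- The group law `(x, y) (x', y') = (x + x', y + eˣ y')`; the identity is the origin `(0, 0)` and
`(x, y)⁻¹ = (-x, -e⁻ˣ y)`. -/
instance instGroup (n : ℕ) : Group (AxB n) where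
  mul g h := (g.1 + h.1, g.2 + Real.exp g.1 • h.2)
  one := (0, 0)
  inv g := (-g.1, -(Real.exp (-g.1) • g.2))
  mul_assoc a b c := by
    refine Prod.ext (add_assoc a.1 b.1 c.1) ?_
    change (a.2 + Real.exp a.1 • b.2) + Real.exp (a.1 + b.1) • c.2
      = a.2 + Real.exp a.1 • (b.2 + Real.exp b.1 • c.2)
    rw [Real.exp_add, smul_add, smul_smul, add_assoc]
  one_mul a := by
    refine Prod.ext (zero_add a.1) ?_
    change (0 : EuclideanSpace ℝ (Fin n)) + Real.exp 0 • a.2 = a.2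
    simp
  mul_one a := by
    refine Prod.ext (add_zero a.1) ?_
    change a.2 + Real.exp a.1 • (0 : EuclideanSpace ℝ (Fin n)) = a.2
    simp
  inv_mul_cancel a := by
    refine Prod.ext (neg_add_cancel a.1) ?_
    change -(Real.exp (-a.1) • a.2) + Real.exp (-a.1) • a.2 = 0
    simp

variable {n : ℕ}

/-- The left-invariant vector field `X = ∂ₓ`. -/
def X (φ : AxB n → ℂ) : AxB n → ℂ := fun g => fderiv ℝ φ g (1, 0)

/-- The left-invariant vector field `Y_j = eˣ ∂_{y_j}`. -/
def Y (j : Fin n) (φ : AxB n → ℂ) : AxB n → ℂ :=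
  fun g => (Real.exp g.1 : ℂ) * fderiv ℝ φ g (0, EuclideanSpace.single j 1)

/-- The distinguished Laplacian `-X² - ∑ⱼ Yⱼ²` as a differential operator. -/
def lap (φ : AxB n → ℂ) : AxB n → ℂ := fun g => -X (X φ) g - ∑ j, Y j (Y j φ) g

theorem contDiff_X {φ : AxB n → ℂ} (h : ContDiff ℝ ∞ φ) : ContDiff ℝ ∞ (X φ) :=
  (h.fderiv_right (m := ∞) le_rfl).clm_apply contDiff_const

theorem contDiff_Y (j : Fin n) {φ : AxB n → ℂ} (h : ContDiff ℝ ∞ φ) : ContDiff ℝ ∞ (Y j φ) := by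
  have h1 : ContDiff ℝ ∞ fun g : AxB n => (Real.exp g.1 : ℂ) :=
    Complex.ofRealCLM.contDiff.comp (Real.contDiff_exp.comp contDiff_fst)
  exact h1.mul ((h.fderiv_right (m := ∞) le_rfl).clm_apply contDiff_const)

theorem X_add {φ ψ : AxB n → ℂ} (h : ContDiff ℝ ∞ φ) (h' : ContDiff ℝ ∞ ψ) :
    X (φ + ψ) = X φ + X ψ := by
  funext g
  simp [X, fderiv_add (h.differentiable (by simp) g) (h'.differentiable (by simp) g)]

theorem Y_add (j : Fin n) {φ ψ : AxB n → ℂ} (h : ContDiff ℝ ∞ φ) (h' : ContDiff ℝ ∞ ψ) :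
    Y j (φ + ψ) = Y j φ + Y j ψ := by
  funext g
  simp [Y, fderiv_add (h.differentiable (by simp) g) (h'.differentiable (by simp) g), mul_add]

theorem X_smul (c : ℂ) {φ : AxB n → ℂ} (h : ContDiff ℝ ∞ φ) : X (c • φ) = c • X φ := by
  funext g
  simp [X, fderiv_const_smul (h.differentiable (by simp) g)]

theorem Y_smul (j : Fin n) (c : ℂ) {φ : AxB n → ℂ} (h : ContDiff ℝ ∞ φ) :
    Y j (c • φ) = c • Y j φ := by
  funext g
  simp [Y, fderiv_const_smul (h.differentiable (by simp) g), mul_left_comm]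

theorem lap_add {φ ψ : AxB n → ℂ} (h : ContDiff ℝ ∞ φ) (h' : ContDiff ℝ ∞ ψ) :
    lap (φ + ψ) = lap φ + lap ψ := by
  funext g
  simp only [lap, X_add h h', X_add (contDiff_X h) (contDiff_X h'), Y_add _ h h',
    Y_add _ (contDiff_Y _ h) (contDiff_Y _ h'), Pi.add_apply, Finset.sum_add_distrib]
  ring

theorem lap_smul (c : ℂ) {φ : AxB n → ℂ} (h : ContDiff ℝ ∞ φ) : lap (c • φ) = c • lap φ := by
  funext g
  simp only [lap, X_smul c h, X_smul c (contDiff_X h), Y_smul _ c h,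
    Y_smul _ c (contDiff_Y _ h), Pi.smul_apply, smul_eq_mul, ← Finset.mul_sum]
  ring

variable (n) in
/-- The Hilbert space `L²(G)` with respect to the right Haar measure `dg`. -/
abbrev L2 : Type := Lp ℂ 2 (volume : Measure (AxB n))

variable (n) in
/-- The graph in `L²(G) × L²(G)` of the differential operator `lap` on `C_c^∞(G)`. -/
def lapGraph : Submodule ℂ (L2 n × L2 n) where
  carrier := {p | ∃ φ : AxB n → ℂ, ContDiff ℝ ∞ φ ∧ HasCompactSupport φ ∧
    p.1 =ᵐ[volume] φ ∧ p.2 =ᵐ[volume] lap φ}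
  add_mem' := by
    rintro p q ⟨φ, h1, h2, h3, h4⟩ ⟨ψ, k1, k2, k3, k4⟩
    refine ⟨φ + ψ, h1.add k1, h2.add k2, ?_, ?_⟩
    · exact (Lp.coeFn_add p.1 q.1).trans (h3.add k3)
    · rw [lap_add h1 k1]
      exact (Lp.coeFn_add p.2 q.2).trans (h4.add k4)
  zero_mem' := by
    refine ⟨0, contDiff_const, HasCompactSupport.zero, Lp.coeFn_zero _ _ _, ?_⟩
    have h : lap (0 : AxB n → ℂ) = 0 := by
      have := lap_smul (n := n) 0 (φ := 0) contDiff_const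
      simpa using this
    rw [h]
    exact Lp.coeFn_zero _ _ _
  smul_mem' := by
    rintro c p ⟨φ, h1, h2, h3, h4⟩
    refine ⟨c • φ, contDiff_const.smul h1, h2.smul_left (f := fun _ => c), ?_, ?_⟩
    · exact (Lp.coeFn_smul c p.1).trans (h3.const_smul c)
    · rw [lap_smul c h1]
      exact (Lp.coeFn_smul c p.2).trans (h4.const_smul c)

/-- `lapGraph` is the graph of an operator: a smooth function is determined by its class. -/
theorem lapGraph_functional (p : L2 n × L2 n) (hp : p ∈ lapGraph n) (h0 : p.1 = 0) : p.2 = 0 := by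
  obtain ⟨φ, h1, -, h3, h4⟩ := hp
  have h5 : φ = 0 := by
    refine (Continuous.ae_eq_iff_eq volume h1.continuous continuous_const).1 ?_
    rw [h0] at h3
    exact h3.symm.trans (Lp.coeFn_zero _ _ _)
  subst h5
  have h : lap (0 : AxB n → ℂ) = 0 := by
    have := lap_smul (n := n) 0 (φ := 0) contDiff_const
    simpa using this
  rw [h] at h4
  exact (Lp.eq_zero_iff_ae_eq_zero).2 h4

variable (n) in
/-- The distinguished Laplacian `L` as an unbounded operator on `L²(G)`: the closure of `lap` with
domain `C_c^∞(G)`. -/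
def L : L2 n →ₗ.[ℂ] L2 n := (lapGraph n).toLinearPMap.closure

/-- `T` is the resolvent `(A - lam)⁻¹` of the unbounded operator `A`: a bounded operator which is a
two-sided inverse of `A - lam : dom A → H`. -/
def IsResolvent {H : Type*} [NormedAddCommGroup H] [NormedSpace ℂ H] (A : H →ₗ.[ℂ] H) (lam : ℂ)
    (T : H →L[ℂ] H) : Prop :=
  (∀ f : H, ∃ h : T f ∈ A.domain, A ⟨T f, h⟩ - lam • T f = f) ∧
    ∀ u : A.domain, T (A u - lam • (u : H)) = u

/-- The distance `R(x, y) = arcch (ch x + ½ ‖y‖² e⁻ˣ)` of `(x, y)` to the identity. -/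
def radius (g : AxB n) : ℝ :=
  Real.arcosh (Real.cosh g.1 + 1 / 2 * ‖g.2‖ ^ 2 * Real.exp (-g.1))

variable (n) in
/-- The ball of radius `r` about the identity. -/
def ball (r : ℝ) : Set (AxB n) := {g | radius g < r}

/-- The operator `D_sh : u ↦ D (u / sh)`, with `D = d/dv`. -/
def Dsh (u : ℝ → ℂ) : ℝ → ℂ := deriv fun v => u v / (Real.sinh v : ℂ)

variable (n) in
/-- The integrand `D_sh^l [e^{ν v}] (ch v - ch R)^{-n/2 + l}`. -/
def integrand (ν : ℂ) (l : ℕ) (R v : ℝ) : ℂ :=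
  (Dsh^[l] fun w : ℝ => Complex.exp (ν * w)) v *
    (((Real.cosh v - Real.cosh R) ^ (-(n : ℝ) / 2 + l) : ℝ) : ℂ)

/-- The kernel `k`. -/
def kernel (ν : ℂ) (l : ℕ) (g : AxB n) : ℂ :=
  (((-1) ^ l * ((2 : ℝ) ^ (-1 - (n : ℝ) / 2) * Real.pi ^ (-(n : ℝ) / 2)
      / Real.Gamma (1 - (n : ℝ) / 2 + l)) * Real.exp (-(n : ℝ) * g.1 / 2) : ℝ) : ℂ) *
    ∫ v in Ioi (radius g), integrand n ν l (radius g) v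

end AxB

end

/-! The substitution `t = ch v` turns `D_sh^l e^{νv}` into `sh v` times the `l`-th derivative of
`h(t) = e^{ν arcosh t} / √(t² - 1)`. The kernel is therefore `e^{-nx/2} w(ch R)`, where `w` is a
constant multiple of the Weyl fractional integral `∫₀^∞ h^{(l)}(s + τ) τ^{l - n/2} dτ`. Integration
by parts in `τ` (`weyl_succ_succ`) shows that `k` does not depend on `l`, so the least admissible
value `⌊n/2⌋` may be used for every estimate.

The function `h` solves a second-order linear equation. Differentiating it and integrating against
`τ^a` gives `(s² - 1) w'' + (n + 1) s w' + (n²/4 - ν²) w = 0` (`weyl_ode`). Since `lap` acts on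
`e^{-nx/2} w(ch R)` by minus `(s² - 1) w'' + (n + 1) s w' + (n²/4) w` (`lap_exp_mul_comp_level`),
this says `lap k = -ν² k = λ k` off the identity. To find the mass at the identity, replace `ch R`
by `ch R + ε`. The kernel becomes smooth, and `(lap + ν²) k_ε` is `ε` times an explicit function.
Blowing up at scale `δ = √ε` makes it converge to a point mass, whose weight is a product of a Beta
and a Gaussian integral equal to `1` (`kernelConst_normalization`). Hence `k` is a fundamental
solution (`integral_lap_add_mul_kernel`).

Direct bounds for `h^{(l)}` give a radial majorant of `k`. In polar coordinates on the fibres `ℝⁿ`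
and after integration in `x`, its weight is at most a multiple of `e^{Re ν v} (1 + v)`. This yields
both `k ∈ L¹` and the estimate on balls (`lintegral_norm_kernel_le`). Averaging right translates
against an integrable `k` is bounded on `L²`. By left invariance of `lap` it is a left inverse of
`lap - λ` on test functions, and so of `L - λ` by closure (`exists_left_inverse`).

What remains is that the range is dense. At `λ = -1`, an `L²` function orthogonal to the range is,
up to conjugation, a weak solution of `lap W + W = 0`. Mollifying by left translations makes it
smooth, and Caccioppoli's inequality with cutoffs of small gradient makes it vanish. With symmetry,
this gives self-adjointness. For general `λ` the orthogonal complement of the range of `L - λ` is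
the kernel of `L - λ̄`, which vanishes because `λ̄` also has a left inverse. -/

noncomputable section

namespace AxB

open Filter Topology

/-! ### Derivatives of `e^{ν arcosh t} / √(t² - 1)` and the operator `D_sh` -/

/-- The successive derivatives on `(1, ∞)` of `t ↦ e^{ν arcosh t} / √(t² - 1)`, given by the
recursion which the differential equation of this function implies. -/
def weylSeq (ν : ℂ) : ℕ → ℝ → ℂ
  | 0, t => Complex.exp (ν * Real.arcosh t) / (√(t ^ 2 - 1) : ℝ)
  | 1, t => Complex.exp (ν * Real.arcosh t) * (ν * (√(t ^ 2 - 1) : ℝ) - t)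
      / ((√(t ^ 2 - 1) : ℝ) : ℂ) ^ 3
  | m + 2, t => (-(2 * m + 3) * t * weylSeq ν (m + 1) t + (ν ^ 2 - (m + 1) ^ 2) * weylSeq ν m t)
      / ((t : ℂ) ^ 2 - 1)

theorem sq_sub_one_pos {t : ℝ} (ht : 1 < t) : 0 < t ^ 2 - 1 := by nlinarith

theorem ofReal_sq_sub_one_ne {t : ℝ} (ht : 1 < t) : (t : ℂ) ^ 2 - 1 ≠ 0 := by
  have := (sq_sub_one_pos ht).ne'
  exact_mod_cast this

/-- For `m = 0` this is the differential equation `(t² - 1) f'' + 3 t f' + (1 - ν²) f = 0` of `f =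
e^{ν arcosh t} / √(t² - 1)`, and for general `m` its `m`-th derivative by Leibniz. Here it merely
unfolds the recursion; that the sequence really consists of derivatives is `hasDerivAt_weylSeq`. -/
theorem weylSeq_ode (ν : ℂ) (m : ℕ) {t : ℝ} (ht : 1 < t) :
    ((t : ℂ) ^ 2 - 1) * weylSeq ν (m + 2) t + (2 * m + 3) * t * weylSeq ν (m + 1) t
      + ((m + 1) ^ 2 - ν ^ 2) * weylSeq ν m t = 0 := by
  have h := ofReal_sq_sub_one_ne ht
  rw [weylSeq]
  field_simp
  ring

theorem hasDerivAt_ofReal (t : ℝ) : HasDerivAt (fun t : ℝ => (t : ℂ)) 1 t :=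
  (hasDerivAt_id (t : ℂ)).comp_ofReal

theorem hasDerivAt_sqrt_sq_sub_one {t : ℝ} (ht : 1 < t) :
    HasDerivAt (fun t : ℝ => ((√(t ^ 2 - 1) : ℝ) : ℂ)) ((t : ℂ) / (√(t ^ 2 - 1) : ℝ)) t := by
  have h1 : HasDerivAt (fun t : ℝ => t ^ 2 - 1) (2 * t) t := by
    simpa using (hasDerivAt_pow 2 t).sub_const 1
  have h2 := (h1.sqrt (sq_sub_one_pos ht).ne').ofReal_comp
  convert h2 using 1
  push_cast
  rw [mul_div_mul_left _ _ (by norm_num)]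

theorem hasDerivAt_cexp_arcosh (ν : ℂ) {t : ℝ} (ht : 1 < t) :
    HasDerivAt (fun t : ℝ => Complex.exp (ν * Real.arcosh t))
      (Complex.exp (ν * Real.arcosh t) * (ν / (√(t ^ 2 - 1) : ℝ))) t := by
  have h := ((Real.hasDerivAt_arcosh (x := t) ht).ofReal_comp.const_mul ν).cexp
  convert h using 1
  push_cast
  rw [div_eq_mul_inv]

theorem hasDerivAt_weylSeq (ν : ℂ) (m : ℕ) {t : ℝ} (ht : 1 < t) :
    HasDerivAt (weylSeq ν m) (weylSeq ν (m + 1) t) t := by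
  have hq0 : (√(t ^ 2 - 1) : ℝ) ≠ 0 := (Real.sqrt_pos.2 (sq_sub_one_pos ht)).ne'
  have hq : ((√(t ^ 2 - 1) : ℝ) : ℂ) ≠ 0 := by exact_mod_cast hq0
  have hqq : ((√(t ^ 2 - 1) : ℝ) : ℂ) ^ 2 = (t : ℂ) ^ 2 - 1 := by
    have := Real.sq_sqrt (sq_sub_one_pos ht).le
    exact_mod_cast this
  have htq := ofReal_sq_sub_one_ne ht
  have hE := hasDerivAt_cexp_arcosh ν ht
  have hS := hasDerivAt_sqrt_sq_sub_one ht
  have hI := hasDerivAt_ofReal t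
  -- The recursion reaches two orders back, so the induction carries two consecutive orders.
  have key : ∀ m, HasDerivAt (weylSeq ν m) (weylSeq ν (m + 1) t) t ∧
      HasDerivAt (weylSeq ν (m + 1)) (weylSeq ν (m + 2) t) t := by
    intro m
    induction m with
    | zero =>
      constructor
      · have h := hE.div hS hq
        refine h.congr_deriv ?_
        simp only [weylSeq]
        field_simp
      · have h := (hE.mul ((hS.const_mul ν).sub hI)).div (hS.pow 3) (pow_ne_zero 3 hq)
        have h' : HasDerivAt (weylSeq ν 1) _ t := h
        refine h'.congr_deriv ?_
        simp only [weylSeq, ← hqq, Pi.sub_apply, Pi.mul_apply, Pi.pow_apply]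
        have ht2 : (t : ℂ) ^ 2 = ((√(t ^ 2 - 1) : ℝ) : ℂ) ^ 2 + 1 := by rw [hqq]; ring
        generalize ((√(t ^ 2 - 1) : ℝ) : ℂ) = q at *
        field_simp
        push_cast
        generalize Complex.exp (ν * Real.arcosh t) = E
        linear_combination (0 : ℂ) * ht2
    | succ m ih =>
      refine ⟨ih.2, ?_⟩
      have hD : HasDerivAt (fun t : ℝ => (t : ℂ) ^ 2 - 1) (2 * (t : ℂ)) t := by
        simpa using (hI.pow 2).sub_const (1 : ℂ)
      have h := (((hI.const_mul (-(2 * m + 3) : ℂ)).mul ih.2).add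
        (ih.1.const_mul (ν ^ 2 - (m + 1) ^ 2))).div hD htq
      have h' : HasDerivAt (weylSeq ν (m + 2)) _ t := h
      refine h'.congr_deriv ?_
      have e1 := weylSeq_ode ν m ht
      have e2 := weylSeq_ode ν (m + 1) ht
      simp only [Pi.mul_apply, Pi.add_apply]
      rw [div_eq_iff (pow_ne_zero 2 htq)]
      push_cast at e2 ⊢
      -- The equation of order `m + 1` is the derivative of the one of order `m`; the latter, with
      -- factor `2 t`, accounts for differentiating the denominator `t² - 1`.
      linear_combination (-((t : ℂ) ^ 2 - 1)) * e2 + (2 * (t : ℂ)) * e1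
  exact (key m).1

/-- In the recursion one order costs `t / (t² - 1)`, and the `ν²` term costs `(1 + ‖ν‖)² / (t² - 1)`
for two orders; `√(t² - 1) ≤ t` puts the second cost into the shape of the first. The constant does
not depend on `ν`. -/
theorem norm_weylSeq_le_div (m : ℕ) : ∃ C : ℝ, 0 ≤ C ∧ ∀ (ν : ℂ) (t : ℝ), 1 < t →
    ‖weylSeq ν m t‖ ≤ C * (1 + ‖ν‖) ^ m * Real.exp (ν.re * Real.arcosh t) *
      (t ^ m / √(t ^ 2 - 1) ^ (2 * m + 1)) := by
  have hexp : ∀ (ν : ℂ) (t : ℝ), ‖Complex.exp (ν * Real.arcosh t)‖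
      = Real.exp (ν.re * Real.arcosh t) := by
    intro ν t
    simp [Complex.norm_exp]
  have key : ∀ m : ℕ, (∃ C : ℝ, 0 ≤ C ∧ ∀ (ν : ℂ) (t : ℝ), 1 < t →
      ‖weylSeq ν m t‖ ≤ C * (1 + ‖ν‖) ^ m * Real.exp (ν.re * Real.arcosh t) *
        (t ^ m / √(t ^ 2 - 1) ^ (2 * m + 1))) ∧
      (∃ C : ℝ, 0 ≤ C ∧ ∀ (ν : ℂ) (t : ℝ), 1 < t →
      ‖weylSeq ν (m + 1) t‖ ≤ C * (1 + ‖ν‖) ^ (m + 1) * Real.exp (ν.re * Real.arcosh t) *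
        (t ^ (m + 1) / √(t ^ 2 - 1) ^ (2 * (m + 1) + 1))) := by
    intro m
    induction m with
    | zero =>
      refine ⟨⟨1, zero_le_one, fun ν t ht => ?_⟩, ⟨1, zero_le_one, fun ν t ht => ?_⟩⟩
      · simp only [weylSeq, norm_div, hexp, Complex.norm_real, Real.norm_eq_abs,
          abs_of_nonneg (Real.sqrt_nonneg _)]
        apply le_of_eq
        simp [div_eq_mul_inv]
      · simp only [weylSeq, norm_div, norm_mul, norm_pow, hexp, Complex.norm_real,
          Real.norm_eq_abs, abs_of_nonneg (Real.sqrt_nonneg _)]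
        rw [mul_div_assoc, one_mul, mul_comm ((1 + ‖ν‖) ^ (0 + 1)), mul_assoc]
        gcongr
        rw [← mul_div_assoc]
        norm_num only
        gcongr
        have hq : √(t ^ 2 - 1) ≤ t := by
          rw [Real.sqrt_le_left (by linarith)]; linarith
        calc ‖ν * (√(t ^ 2 - 1) : ℝ) - t‖ ≤ ‖ν * (√(t ^ 2 - 1) : ℝ)‖ + ‖(t : ℂ)‖ := norm_sub_le _ _
          _ = ‖ν‖ * √(t ^ 2 - 1) + t := by
            rw [norm_mul, Complex.norm_real, Complex.norm_real, Real.norm_eq_abs,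
              Real.norm_eq_abs, abs_of_nonneg (Real.sqrt_nonneg _), abs_of_pos (by linarith)]
          _ ≤ ‖ν‖ * t + t := by gcongr
          _ = (1 + ‖ν‖) ^ 1 * t ^ 1 := by ring
    | succ m ih =>
      refine ⟨ih.2, ?_⟩
      obtain ⟨⟨A, hA, hA'⟩, ⟨B, hB, hB'⟩⟩ := ih
      refine ⟨(2 * m + 3) * B + (1 + (m + 1) ^ 2) * A, by positivity, fun ν t ht => ?_⟩
      have hq0 : 0 < √(t ^ 2 - 1) := Real.sqrt_pos.2 (sq_sub_one_pos ht)
      have hqq : √(t ^ 2 - 1) ^ 2 = t ^ 2 - 1 := Real.sq_sqrt (sq_sub_one_pos ht).le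
      have hq : √(t ^ 2 - 1) ≤ t := by
        rw [Real.sqrt_le_left (by linarith)]; linarith
      have hn : ‖(t : ℂ) ^ 2 - 1‖ = √(t ^ 2 - 1) ^ 2 := by
        rw [hqq, ← Real.norm_of_nonneg (sq_sub_one_pos ht).le, ← Complex.norm_real]
        push_cast; rfl
      have hν : ‖ν ^ 2 - ((m : ℂ) + 1) ^ 2‖ ≤ (1 + (m + 1) ^ 2) * (1 + ‖ν‖) ^ 2 := by
        refine (norm_sub_le _ _).trans ?_
        have : ‖((m : ℂ) + 1) ^ 2‖ = ((m : ℝ) + 1) ^ 2 := by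
          rw [norm_pow]
          have : ((m : ℂ) + 1) = ((m + 1 : ℕ) : ℂ) := by push_cast; rfl
          rw [this, Complex.norm_natCast]; push_cast; rfl
        rw [this, norm_pow]
        have h0 := norm_nonneg ν
        have h1 : 1 ≤ (1 + ‖ν‖) ^ 2 := by nlinarith
        nlinarith [sq_nonneg ((m : ℝ) + 1)]
      rw [weylSeq, norm_div, hn, div_le_iff₀ (by positivity)]
      have h3 : ‖(-(2 * (m : ℂ) + 3))‖ = 2 * m + 3 := by
        rw [norm_neg]
        have : (2 * (m : ℂ) + 3) = ((2 * m + 3 : ℕ) : ℂ) := by push_cast; rfl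
        rw [this, Complex.norm_natCast]; push_cast; rfl
      have hAt := hA' ν t ht
      have hBt := hB' ν t ht
      set q := √(t ^ 2 - 1)
      set E := Real.exp (ν.re * Real.arcosh t)
      have ht0 : 0 < t := by linarith
      calc _ ≤ ‖-(2 * (m : ℂ) + 3) * t * weylSeq ν (m + 1) t‖
            + ‖(ν ^ 2 - ((m : ℂ) + 1) ^ 2) * weylSeq ν m t‖ := norm_add_le _ _
        _ ≤ (2 * m + 3) * t * (B * (1 + ‖ν‖) ^ (m + 1) * E * (t ^ (m + 1) / q ^ (2 * (m + 1) + 1)))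
            + ((1 + (m + 1) ^ 2) * (1 + ‖ν‖) ^ 2) *
              (A * (1 + ‖ν‖) ^ m * E * (t ^ m / q ^ (2 * m + 1))) := by
            rw [norm_mul, norm_mul, norm_mul, h3, Complex.norm_real, Real.norm_of_nonneg ht0.le]
            gcongr
        _ ≤ (2 * m + 3) * t * (B * (1 + ‖ν‖) ^ (m + 2) * E * (t ^ (m + 1) / q ^ (2 * (m + 1) + 1)))
            + ((1 + (m + 1) ^ 2) * (1 + ‖ν‖) ^ 2) *
              (A * (1 + ‖ν‖) ^ m * E * (t ^ m * t ^ 2 / (q ^ (2 * m + 1) * q ^ 2))) := by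
            gcongr ?_ + ?_
            · gcongr
              · linarith [norm_nonneg ν]
              · omega
            · gcongr ?_ * (_ * ?_)
              rw [div_le_div_iff₀ (by positivity) (by positivity)]
              have : q ^ 2 ≤ t ^ 2 := by gcongr
              calc t ^ m * (q ^ (2 * m + 1) * q ^ 2) ≤ t ^ m * (q ^ (2 * m + 1) * t ^ 2) := by gcongr
                _ = _ := by ring
        _ = _ := by
            field_simp
            ring
  exact (key m).1

/-- Factoring `t² - 1 = (t - 1)(t + 1)` with `t + 1 ≥ t` separates the singularity at `1` from the
decay at infinity. -/
theorem norm_weylSeq_le (m : ℕ) : ∃ C : ℝ, 0 ≤ C ∧ ∀ (ν : ℂ) (t : ℝ), 1 < t →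
    ‖weylSeq ν m t‖ ≤ C * (1 + ‖ν‖) ^ m * Real.exp (ν.re * Real.arcosh t) *
      (t ^ (-(1 / 2) : ℝ) * (t - 1) ^ (-(m : ℝ) - 1 / 2)) := by
  obtain ⟨C, hC, h⟩ := norm_weylSeq_le_div m
  refine ⟨C, hC, fun ν t ht => (h ν t ht).trans ?_⟩
  gcongr
  have h1 : 0 < t - 1 := by linarith
  have ht0 : 0 < t := by linarith
  have h2 : √(t ^ 2 - 1) ^ (2 * m + 1) = (t - 1) ^ ((m : ℝ) + 1 / 2) * (t + 1) ^ ((m : ℝ) + 1 / 2) := by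
    rw [← Real.mul_rpow h1.le (by linarith), ← Real.rpow_natCast, Real.sqrt_eq_rpow,
      ← Real.rpow_mul (sq_sub_one_pos ht).le]
    congr 1
    · ring
    · push_cast; ring
  have h3 : t ^ m = t ^ ((m : ℝ) + 1 / 2) * t ^ (-(1 / 2) : ℝ) := by
    rw [← Real.rpow_add ht0, ← Real.rpow_natCast]; congr 1; ring
  have h4 : (t - 1) ^ (-(m : ℝ) - 1 / 2) = ((t - 1) ^ ((m : ℝ) + 1 / 2))⁻¹ := by
    rw [← Real.rpow_neg h1.le]; congr 1; ring
  rw [h2, h4, div_le_iff₀ (by positivity), h3]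
  have h5 : t ^ ((m : ℝ) + 1 / 2) ≤ (t + 1) ^ ((m : ℝ) + 1 / 2) :=
    Real.rpow_le_rpow ht0.le (by linarith) (by positivity)
  have h6 : (t - 1) ^ ((m : ℝ) + 1 / 2) ≠ 0 := by positivity
  calc _ ≤ (t + 1) ^ ((m : ℝ) + 1 / 2) * t ^ (-(1 / 2) : ℝ) := by gcongr
    _ = _ := by field_simp

theorem continuousOn_weylSeq (ν : ℂ) (m : ℕ) : ContinuousOn (weylSeq ν m) (Ioi 1) :=
  fun _ ht => (hasDerivAt_weylSeq ν m ht).continuousAt.continuousWithinAt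

/-- Near `1` the function behaves like `(2 (t - 1))^{-1/2}`, and differentiating this `m` times
produces the Pochhammer symbol of `1/2`, written as a quotient of Gamma values. The limit does not
see `ν`. -/
theorem tendsto_weylSeq (ν : ℂ) (m : ℕ) :
    Tendsto (fun t : ℝ => (((t - 1) ^ ((m : ℝ) + 1 / 2) : ℝ) : ℂ) * weylSeq ν m t) (𝓝[>] 1)
      (𝓝 (((-1) ^ m * (2 ^ (-(1 / 2) : ℝ) * (Real.Gamma (m + 1 / 2) / Real.Gamma (1 / 2))) : ℝ) : ℂ))
    := by
  have hE : Tendsto (fun t : ℝ => Complex.exp (ν * Real.arcosh t)) (𝓝[>] 1) (𝓝 1) := by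
    have h : ContinuousWithinAt (fun t : ℝ => Complex.exp (ν * Real.arcosh t)) (Ici 1) 1 := by
      have h1 : ContinuousWithinAt Real.arcosh (Ici 1) 1 := Real.continuousOn_arcosh 1 self_mem_Ici
      have h2 : ContinuousWithinAt (fun t => ((Real.arcosh t : ℝ) : ℂ)) (Ici 1) 1 :=
        Complex.continuous_ofReal.continuousAt.comp_continuousWithinAt h1
      exact (h2.const_mul ν).cexp
    have := h.tendsto.mono_left (nhdsWithin_mono _ Ioi_subset_Ici_self)
    simpa using this
  have hlim : ∀ f : ℝ → ℂ, Continuous f → Tendsto f (𝓝[>] 1) (𝓝 (f 1)) := fun f hf =>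
    hf.continuousAt.tendsto.mono_left nhdsWithin_le_nhds
  have hT : Tendsto (fun t : ℝ => ((((t + 1) ^ (-(1 / 2) : ℝ)) : ℝ) : ℂ)) (𝓝[>] 1)
      (𝓝 ((2 ^ (-(1 / 2) : ℝ) : ℝ) : ℂ)) := by
    have h : ContinuousAt (fun t : ℝ => (t + 1) ^ (-(1 / 2) : ℝ)) 1 :=
      (by fun_prop : ContinuousAt (fun t : ℝ => t + 1) 1).rpow_const (Or.inl (by norm_num))
    have h2 := (Complex.continuous_ofReal.continuousAt.tendsto.comp h.tendsto).mono_left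
      (nhdsWithin_le_nhds (s := Ioi 1))
    norm_num at h2
    norm_num
    exact h2
  have hG : (Real.Gamma (1 / 2)) ≠ 0 := (Real.Gamma_pos_of_pos (by norm_num)).ne'
  have hsqrt : ∀ t : ℝ, 1 < t → √(t ^ 2 - 1) = (t - 1) ^ (1 / 2 : ℝ) * (t + 1) ^ (1 / 2 : ℝ) := by
    intro t ht
    rw [← Real.mul_rpow (by linarith) (by linarith), Real.sqrt_eq_rpow]
    congr 1; ring
  have key : ∀ m : ℕ, Tendsto (fun t : ℝ => (((t - 1) ^ ((m : ℝ) + 1 / 2) : ℝ) : ℂ) * weylSeq ν m t)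
      (𝓝[>] 1) (𝓝 (((-1) ^ m * (2 ^ (-(1 / 2) : ℝ) *
        (Real.Gamma (m + 1 / 2) / Real.Gamma (1 / 2))) : ℝ) : ℂ)) ∧
      Tendsto (fun t : ℝ => (((t - 1) ^ (((m + 1 : ℕ) : ℝ) + 1 / 2) : ℝ) : ℂ) * weylSeq ν (m + 1) t)
      (𝓝[>] 1) (𝓝 (((-1) ^ (m + 1) * (2 ^ (-(1 / 2) : ℝ) *
        (Real.Gamma (((m + 1 : ℕ) : ℝ) + 1 / 2) / Real.Gamma (1 / 2))) : ℝ) : ℂ)) := by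
    intro m
    induction m with
    | zero =>
      constructor
      · have h := hE.mul hT
        have e : (((-1) ^ 0 * (2 ^ (-(1 / 2) : ℝ) *
            (Real.Gamma ((0 : ℕ) + 1 / 2) / Real.Gamma (1 / 2))) : ℝ) : ℂ)
            = 1 * ((2 ^ (-(1 / 2) : ℝ) : ℝ) : ℂ) := by
          rw [Nat.cast_zero, zero_add, div_self hG]; simp
        rw [e]
        refine h.congr' ?_
        filter_upwards [self_mem_nhdsWithin] with t ht
        have ht : 1 < t := ht
        have h1 : ((((t - 1) ^ (1 / 2 : ℝ) : ℝ)) : ℂ) ≠ 0 := by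
          have : (t - 1) ^ (1 / 2 : ℝ) ≠ 0 := (Real.rpow_pos_of_pos (by linarith) _).ne'
          exact_mod_cast this
        rw [weylSeq, hsqrt t ht, Real.rpow_neg (by linarith), Nat.cast_zero, zero_add]
        push_cast
        field_simp
      · have h := (hE.mul ((hlim (fun t : ℝ => ν * ((√(t ^ 2 - 1) : ℝ) : ℂ) - t) (by fun_prop)))).mul
          (hT.pow 3)
        have e : (((-1) ^ (0 + 1) * (2 ^ (-(1 / 2) : ℝ) *
            (Real.Gamma (((0 + 1 : ℕ) : ℝ) + 1 / 2) / Real.Gamma (1 / 2))) : ℝ) : ℂ)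
            = 1 * (ν * ((√((1 : ℝ) ^ 2 - 1) : ℝ) : ℂ) - (1 : ℝ)) *
              ((2 ^ (-(1 / 2) : ℝ) : ℝ) : ℂ) ^ 3 := by
          have e1 : ((0 + 1 : ℕ) : ℝ) + 1 / 2 = 1 / 2 + 1 := by norm_num
          have e2 : ((2 : ℝ) ^ (-(1 / 2) : ℝ)) ^ 3 = 2 ^ (-(1 / 2) : ℝ) * (1 / 2) := by
            rw [pow_succ, mul_comm, ← Real.rpow_natCast, ← Real.rpow_mul (by norm_num)]
            congr 1
            rw [show (-(1 / 2) : ℝ) * (2 : ℕ) = -1 by norm_num, Real.rpow_neg_one]; norm_num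
          rw [e1, Real.Gamma_add_one (by norm_num), mul_div_assoc, div_self hG]
          have e3 : (1 : ℝ) ^ 2 - 1 = 0 := by norm_num
          rw [e3, Real.sqrt_zero, ← Complex.ofReal_pow, e2]
          push_cast; ring
        rw [e]
        refine h.congr' ?_
        filter_upwards [self_mem_nhdsWithin] with t ht
        have ht : 1 < t := ht
        have h1 : ((((t - 1) ^ (1 / 2 : ℝ) : ℝ)) : ℂ) ≠ 0 := by
          have : (t - 1) ^ (1 / 2 : ℝ) ≠ 0 := (Real.rpow_pos_of_pos (by linarith) _).ne'
          exact_mod_cast this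
        have h2 : (t - 1) ^ (((0 + 1 : ℕ) : ℝ) + 1 / 2) = ((t - 1) ^ (1 / 2 : ℝ)) ^ 3 := by
          rw [← Real.rpow_natCast, ← Real.rpow_mul (by linarith)]; norm_num
        have h3 : ((√(t ^ 2 - 1) : ℝ) : ℂ) ^ 3
            = ((((t - 1) ^ (1 / 2 : ℝ) : ℝ)) : ℂ) ^ 3 * ((((t + 1) ^ (1 / 2 : ℝ) : ℝ)) : ℂ) ^ 3 := by
          rw [hsqrt t ht]; push_cast; ring
        rw [h2, zero_add, weylSeq, h3, Real.rpow_neg (by linarith)]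
        push_cast
        field_simp
    | succ m ih =>
      refine ⟨ih.2, ?_⟩
      -- After division by `t + 1` the first coefficient of the recursion tends to `-(m + 3/2)`,
      -- which is the Gamma functional equation; the coefficient containing `ν` keeps a factor `t -
      -- 1` and tends to zero.
      have h1 : Tendsto (fun t : ℝ => -(2 * (m : ℂ) + 3) * t / (t + 1)) (𝓝[>] 1)
          (𝓝 (-(2 * (m : ℂ) + 3) * (1 : ℝ) / ((1 : ℝ) + 1))) := by
        have hc : ContinuousAt (fun t : ℝ => -(2 * (m : ℂ) + 3) * t / (t + 1)) 1 := by
          refine ContinuousAt.div (by fun_prop) (by fun_prop) (by norm_num)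
        exact hc.tendsto.mono_left nhdsWithin_le_nhds
      have h2 : Tendsto (fun t : ℝ => (ν ^ 2 - ((m : ℂ) + 1) ^ 2) * (t - 1) / (t + 1)) (𝓝[>] 1)
          (𝓝 ((ν ^ 2 - ((m : ℂ) + 1) ^ 2) * ((1 : ℝ) - 1) / ((1 : ℝ) + 1))) := by
        have hc : ContinuousAt
            (fun t : ℝ => (ν ^ 2 - ((m : ℂ) + 1) ^ 2) * (t - 1) / (t + 1)) 1 := by
          refine ContinuousAt.div (by fun_prop) (by fun_prop) (by norm_num)
        exact hc.tendsto.mono_left nhdsWithin_le_nhds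
      have h := (h1.mul ih.2).add (h2.mul ih.1)
      have e : (((-1) ^ (m + 1 + 1) * (2 ^ (-(1 / 2) : ℝ) *
            (Real.Gamma (((m + 1 + 1 : ℕ) : ℝ) + 1 / 2) / Real.Gamma (1 / 2))) : ℝ) : ℂ)
          = -(2 * (m : ℂ) + 3) * (1 : ℝ) / ((1 : ℝ) + 1) *
            (((-1) ^ (m + 1) * (2 ^ (-(1 / 2) : ℝ) *
              (Real.Gamma (((m + 1 : ℕ) : ℝ) + 1 / 2) / Real.Gamma (1 / 2))) : ℝ) : ℂ) +
            (ν ^ 2 - ((m : ℂ) + 1) ^ 2) * ((1 : ℝ) - 1) / ((1 : ℝ) + 1) *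
            (((-1) ^ m * (2 ^ (-(1 / 2) : ℝ) *
              (Real.Gamma (m + 1 / 2) / Real.Gamma (1 / 2))) : ℝ) : ℂ) := by
        have e1 : ((m + 1 + 1 : ℕ) : ℝ) + 1 / 2 = (((m + 1 : ℕ) : ℝ) + 1 / 2) + 1 := by
          push_cast; ring
        rw [e1, Real.Gamma_add_one (by positivity)]
        push_cast
        ring
      rw [e]
      refine h.congr' ?_
      filter_upwards [self_mem_nhdsWithin] with t ht
      have ht : 1 < t := ht
      have ht1 : 0 < t - 1 := by linarith
      have e1 : (t - 1) ^ (((m + 1 + 1 : ℕ) : ℝ) + 1 / 2) = (t - 1) * (t - 1) ^ (((m + 1 : ℕ) : ℝ) + 1 / 2) := by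
        rw [mul_comm, ← Real.rpow_add_one ht1.ne']; congr 1; push_cast; ring
      have e2 : (t - 1) ^ (((m + 1 : ℕ) : ℝ) + 1 / 2) = (t - 1) * (t - 1) ^ ((m : ℝ) + 1 / 2) := by
        rw [mul_comm, ← Real.rpow_add_one ht1.ne']; congr 1; push_cast; ring
      have ht2 : (t : ℂ) - 1 ≠ 0 := by exact_mod_cast ht1.ne'
      have ht3 : (t : ℂ) + 1 ≠ 0 := by
        have : t + 1 ≠ 0 := by linarith
        exact_mod_cast this
      have e3 : (t : ℂ) ^ 2 - 1 = (t - 1) * (t + 1) := by ring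
      rw [weylSeq, e3, e1, e2]
      push_cast
      field_simp
  exact (key m).1

/-- `D_sh^l e^{ν v}` in the variable `t = ch v`. -/
theorem iterate_Dsh (ν : ℂ) (l : ℕ) : ∀ v : ℝ, 0 < v →
    (Dsh^[l] fun w : ℝ => Complex.exp (ν * w)) v
      = (Real.sinh v : ℂ) * weylSeq ν l (Real.cosh v) := by
  induction l with
  | zero =>
    intro v hv
    have h0 : (Real.sinh v : ℂ) ≠ 0 := by exact_mod_cast (Real.sinh_pos_iff.2 hv).ne'
    have h1 : √(Real.cosh v ^ 2 - 1) = Real.sinh v := by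
      rw [Real.cosh_sq, add_sub_cancel_right, Real.sqrt_sq (Real.sinh_pos_iff.2 hv).le]
    rw [weylSeq, h1, Real.arcosh_cosh hv.le, mul_div_cancel₀ _ h0]
    rfl
  | succ l ih =>
    intro v hv
    rw [Function.iterate_succ', Function.comp_apply, Dsh]
    have h1 : (fun v => (Dsh^[l] fun w : ℝ => Complex.exp (ν * w)) v / (Real.sinh v : ℂ))
        =ᶠ[𝓝 v] fun v => weylSeq ν l (Real.cosh v) := by
      filter_upwards [lt_mem_nhds hv] with w hw
      have h0 : (Real.sinh w : ℂ) ≠ 0 := by exact_mod_cast (Real.sinh_pos_iff.2 hw).ne'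
      rw [ih w hw, mul_div_cancel_left₀ _ h0]
    rw [h1.deriv_eq]
    have h2 := (hasDerivAt_weylSeq ν l (Real.one_lt_cosh.2 hv.ne')).scomp v (Real.hasDerivAt_cosh v)
    have h3 := h2.deriv
    rw [Function.comp_def] at h3
    rw [h3, Complex.real_smul]

/-! ### Weyl integrals: convergence, bounds, recursion, differential equation -/

theorem integrableOn_one_add_rpow_mul_rpow {a p : ℝ} (ha : -1 < a) (hp : a + 1 < p) :
    IntegrableOn (fun r : ℝ => (1 + r) ^ (-p) * r ^ a) (Ioi 0) := by
  have hp0 : 0 < p := by linarith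
  have hm : ∀ s : Set ℝ, AEStronglyMeasurable (fun r : ℝ => (1 + r) ^ (-p) * r ^ a)
      (volume.restrict s) := fun s => by
    apply Measurable.aestronglyMeasurable
    fun_prop
  rw [← Ioc_union_Ioi_eq_Ioi zero_le_one]
  refine IntegrableOn.union ?_ ?_
  · have h : IntegrableOn (fun r : ℝ => r ^ a) (Ioc 0 1) :=
      (intervalIntegrable_iff_integrableOn_Ioc_of_le zero_le_one).1
        (intervalIntegral.intervalIntegrable_rpow' ha)
    refine Integrable.mono' h (hm _) ((ae_restrict_iff' measurableSet_Ioc).2 (.of_forall ?_))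
    intro r hr
    have h1 : 0 < r := hr.1
    rw [Real.norm_of_nonneg (by positivity)]
    have : (1 + r) ^ (-p) ≤ 1 := Real.rpow_le_one_of_one_le_of_nonpos (by linarith) (by linarith)
    exact mul_le_of_le_one_left (by positivity) this
  · have h : IntegrableOn (fun r : ℝ => r ^ (a - p)) (Ioi 1) :=
      integrableOn_Ioi_rpow_of_lt (by linarith) one_pos
    refine Integrable.mono' h (hm _) ((ae_restrict_iff' measurableSet_Ioi).2 (.of_forall ?_))
    intro r hr
    have h1 : (1 : ℝ) < r := hr
    have h0 : 0 < r := by linarith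
    rw [Real.norm_of_nonneg (by positivity), sub_eq_neg_add, Real.rpow_add h0]
    refine mul_le_mul_of_nonneg_right ?_ (by positivity)
    exact Real.rpow_le_rpow_of_nonpos h0 (by linarith) (by linarith)

theorem add_rpow_mul_rpow_scale {a p σ : ℝ} (hσ : 0 < σ) {r : ℝ} (hr : 0 < r) :
    (σ + σ * r) ^ (-p) * (σ * r) ^ a = σ ^ (a - p) * ((1 + r) ^ (-p) * r ^ a) := by
  rw [show σ + σ * r = σ * (1 + r) by ring, Real.mul_rpow hσ.le (by linarith),
    Real.mul_rpow hσ.le hr.le, sub_eq_add_neg, Real.rpow_add hσ]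
  ring

theorem integrableOn_add_rpow_mul_rpow {a p σ : ℝ} (hσ : 0 < σ) (ha : -1 < a) (hp : a + 1 < p) :
    IntegrableOn (fun r : ℝ => (σ + r) ^ (-p) * r ^ a) (Ioi 0) := by
  have h := (integrableOn_Ioi_comp_mul_left_iff (fun r : ℝ => (σ + r) ^ (-p) * r ^ a) 0 hσ).1
  rw [mul_zero] at h
  refine h ?_
  have h2 := (integrableOn_one_add_rpow_mul_rpow ha hp).const_mul (σ ^ (a - p))
  refine h2.congr ((ae_restrict_iff' measurableSet_Ioi).2 (.of_forall fun r hr => ?_))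
  exact (add_rpow_mul_rpow_scale hσ hr).symm

theorem integral_add_rpow_mul_rpow {a p σ : ℝ} (hσ : 0 < σ) :
    ∫ r in Ioi (0 : ℝ), (σ + r) ^ (-p) * r ^ a
      = σ ^ (a + 1 - p) * ∫ r in Ioi (0 : ℝ), (1 + r) ^ (-p) * r ^ a := by
  have h := integral_comp_mul_left_Ioi (fun r : ℝ => (σ + r) ^ (-p) * r ^ a) 0 hσ
  rw [mul_zero] at h
  have h2 : ∫ r in Ioi (0 : ℝ), (σ + σ * r) ^ (-p) * (σ * r) ^ a
      = σ ^ (a - p) * ∫ r in Ioi (0 : ℝ), (1 + r) ^ (-p) * r ^ a := by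
    rw [← integral_const_mul]
    refine setIntegral_congr_fun measurableSet_Ioi fun r hr => add_rpow_mul_rpow_scale hσ hr
  rw [h2, eq_inv_smul_iff₀ hσ.ne'] at h
  rw [← h, smul_eq_mul, ← mul_assoc]
  congr 1
  rw [show a + 1 - p = (a - p) + 1 by ring, Real.rpow_add_one hσ.ne', mul_comm]

/-- The Weyl type integral `∫₀^∞ h_m(s + τ) τ^a dτ` of the sequence `weylSeq`. -/
def weyl (ν : ℂ) (m : ℕ) (a s : ℝ) : ℂ :=
  ∫ τ in Ioi (0 : ℝ), weylSeq ν m (s + τ) * ((τ ^ a : ℝ) : ℂ)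

/-- Splitting `t^{-1/2} = t^{-1/2+θ} t^{-θ}` with `t = s + τ`, the first factor is at most its value
at `s` and the second at most `(t - 1)^{-θ}`. The parameter `θ` thus shifts decay from `s` to the
integration variable: larger `θ` gives better convergence in `τ` at the price of a stronger
singularity at `s = 1`. -/
theorem norm_weylSeq_le_rpow {m : ℕ} {C : ℝ} (hC : 0 ≤ C) (h : ∀ (ν : ℂ) (t : ℝ), 1 < t →
    ‖weylSeq ν m t‖ ≤ C * (1 + ‖ν‖) ^ m * Real.exp (ν.re * Real.arcosh t) *
      (t ^ (-(1 / 2) : ℝ) * (t - 1) ^ (-(m : ℝ) - 1 / 2))) {θ : ℝ} (h0 : 0 ≤ θ) (h1 : θ ≤ 1 / 2)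
    {ν : ℂ} (hν : ν.re ≤ 0) {s τ : ℝ} (hs : 1 < s) (hτ : 0 ≤ τ) :
    ‖weylSeq ν m (s + τ)‖ ≤ C * (1 + ‖ν‖) ^ m * Real.exp (ν.re * Real.arcosh s) *
      s ^ (-(1 / 2) + θ) * ((s - 1) + τ) ^ (-((m : ℝ) + 1 / 2 + θ)) := by
  refine (h ν (s + τ) (by linarith)).trans ?_
  have ht : 0 < s + τ - 1 := by linarith
  have hst : s + τ - 1 = s - 1 + τ := by ring
  rw [mul_assoc _ (s ^ _)]
  have hm0 : 0 ≤ s ^ (-(1 / 2) + θ) * (s - 1 + τ) ^ (-((m : ℝ) + 1 / 2 + θ)) := by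
    rw [← hst]; positivity
  have hE : Real.exp (ν.re * Real.arcosh (s + τ)) ≤ Real.exp (ν.re * Real.arcosh s) := by
    apply Real.exp_le_exp.2
    apply mul_le_mul_of_nonpos_left _ hν
    exact (Real.arcosh_le_arcosh (by linarith) (by linarith)).2 (by linarith)
  refine mul_le_mul (by gcongr) ?_ (by positivity) (by positivity)
  have e1 : (s + τ) ^ (-(1 / 2) : ℝ) = (s + τ) ^ (-(1 / 2) + θ) * (s + τ) ^ (-θ) := by
    rw [← Real.rpow_add (by linarith)]; congr 1; ring
  have e2 : (s - 1 + τ) ^ (-((m : ℝ) + 1 / 2 + θ))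
      = (s + τ - 1) ^ (-θ) * (s + τ - 1) ^ (-(m : ℝ) - 1 / 2) := by
    rw [← Real.rpow_add ht, hst]; congr 1; ring
  rw [e1, e2, mul_assoc]
  refine mul_le_mul (Real.rpow_le_rpow_of_nonpos (by linarith) (by linarith) (by linarith))
    (mul_le_mul_of_nonneg_right ?_ (by positivity)) (by positivity) (by positivity)
  exact Real.rpow_le_rpow_of_nonpos ht (by linarith) (by linarith)

/-- This is `θ = 1/2` with the exponential discarded. It makes the Weyl integrals converge whenever
`-1 < a < m`, including `Re ν = 0`. -/
theorem exists_norm_weylSeq_le (m : ℕ) {ν : ℂ} (hν : ν.re ≤ 0) : ∃ C : ℝ, 0 ≤ C ∧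
    ∀ t : ℝ, 1 < t → ‖weylSeq ν m t‖ ≤ C * (t - 1) ^ (-((m : ℝ) + 1)) := by
  obtain ⟨C, hC, h⟩ := norm_weylSeq_le m
  refine ⟨C * (1 + ‖ν‖) ^ m, by positivity, fun t ht => ?_⟩
  have h2 := norm_weylSeq_le_rpow hC h (θ := 1 / 2) (by norm_num) le_rfl hν ht le_rfl
  have e : (m : ℝ) + 1 / 2 + 1 / 2 = m + 1 := by ring
  rw [add_zero, neg_add_cancel, Real.rpow_zero, mul_one, add_zero, e] at h2
  refine h2.trans ?_
  have : 0 < t - 1 := by linarith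
  refine mul_le_mul_of_nonneg_right (mul_le_of_le_one_right (by positivity) ?_) (by positivity)
  rw [Real.exp_le_one_iff]
  exact mul_nonpos_of_nonpos_of_nonneg hν (Real.arcosh_nonneg ht.le)

theorem aestronglyMeasurable_weyl (ν : ℂ) (m : ℕ) (a : ℝ) {s : ℝ} (hs : 1 < s) :
    AEStronglyMeasurable (fun τ => weylSeq ν m (s + τ) * ((τ ^ a : ℝ) : ℂ))
      (volume.restrict (Ioi 0)) := by
  refine AEStronglyMeasurable.mul ?_ ?_
  · refine ContinuousOn.aestronglyMeasurable ?_ measurableSet_Ioi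
    refine (continuousOn_weylSeq ν m).comp (by fun_prop) fun τ hτ => ?_
    have : (0 : ℝ) < τ := hτ
    exact show 1 < s + τ by linarith
  · apply Measurable.aestronglyMeasurable
    fun_prop

theorem integrableOn_weyl {ν : ℂ} (hν : ν.re ≤ 0) {m : ℕ} {a : ℝ} (ha : -1 < a) (ham : a < m)
    {s : ℝ} (hs : 1 < s) :
    IntegrableOn (fun τ => weylSeq ν m (s + τ) * ((τ ^ a : ℝ) : ℂ)) (Ioi 0) := by
  obtain ⟨C, hC, h⟩ := exists_norm_weylSeq_le m hν
  have h1 := (integrableOn_add_rpow_mul_rpow (a := a) (p := m + 1) (σ := s - 1) (by linarith) ha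
    (by linarith)).const_mul C
  refine Integrable.mono' h1 (aestronglyMeasurable_weyl ν m a hs)
    ((ae_restrict_iff' measurableSet_Ioi).2 (.of_forall fun τ hτ => ?_))
  have hτ : 0 < τ := hτ
  rw [norm_mul, Complex.norm_real, Real.norm_of_nonneg (by positivity), ← mul_assoc]
  gcongr
  refine (h (s + τ) (by linarith)).trans (le_of_eq ?_)
  congr 2; ring

/-- The basic estimate of `weyl`. -/
theorem norm_weyl_le (m : ℕ) {a θ : ℝ} (ha : -1 < a) (h0 : 0 ≤ θ) (h1 : θ ≤ 1 / 2)
    (ham : a + 1 / 2 < m + θ) : ∃ C : ℝ, 0 ≤ C ∧ ∀ ν : ℂ, ν.re ≤ 0 → ∀ s : ℝ, 1 < s →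
    ‖weyl ν m a s‖ ≤ C * (1 + ‖ν‖) ^ m * Real.exp (ν.re * Real.arcosh s) *
      (s ^ (-(1 / 2) + θ) * (s - 1) ^ (a + 1 / 2 - m - θ)) := by
  obtain ⟨C, hC, h⟩ := norm_weylSeq_le m
  -- The substitution `τ = (s - 1) r` extracts the power of `s - 1` and leaves this constant.
  set B := ∫ r in Ioi (0 : ℝ), (1 + r) ^ (-((m : ℝ) + 1 / 2 + θ)) * r ^ a with hB
  have hB0 : 0 ≤ B := setIntegral_nonneg measurableSet_Ioi fun r hr => by
    have : (0 : ℝ) < r := hr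
    positivity
  refine ⟨C * B, by positivity, fun ν hν s hs => ?_⟩
  have hi := (integrableOn_add_rpow_mul_rpow (a := a) (p := m + 1 / 2 + θ) (σ := s - 1)
    (by linarith) ha (by linarith)).const_mul (C * (1 + ‖ν‖) ^ m *
      Real.exp (ν.re * Real.arcosh s) * s ^ (-(1 / 2) + θ))
  have := norm_integral_le_of_norm_le hi (f := fun τ => weylSeq ν m (s + τ) * ((τ ^ a : ℝ) : ℂ))
    ((ae_restrict_iff' measurableSet_Ioi).2 (.of_forall fun τ hτ => ?_))
  · refine this.trans (le_of_eq ?_)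
    rw [integral_const_mul, integral_add_rpow_mul_rpow (by linarith), ← hB,
      show a + 1 - ((m : ℝ) + 1 / 2 + θ) = a + 1 / 2 - m - θ by ring]
    ring
  · have hτ : 0 < τ := hτ
    rw [norm_mul, Complex.norm_real, Real.norm_of_nonneg (by positivity), ← mul_assoc]
    gcongr
    exact norm_weylSeq_le_rpow hC h h0 h1 hν hs hτ.le

theorem hasDerivAt_weyl {ν : ℂ} (hν : ν.re ≤ 0) {m : ℕ} {a : ℝ} (ha : -1 < a) (ham : a < m)
    {s : ℝ} (hs : 1 < s) : HasDerivAt (weyl ν m a) (weyl ν (m + 1) a s) s := by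
  obtain ⟨C, hC, h⟩ := exists_norm_weylSeq_le (m + 1) hν
  -- Differentiation under the integral is done for `s' > (s + 1) / 2`, where `s' - 1` stays above
  -- `(s - 1) / 2`, so one majorant serves all `s'`.
  have hσ : 0 < (s - 1) / 2 := by linarith
  have h1 := (integrableOn_add_rpow_mul_rpow (a := a) (p := (m + 1 : ℕ) + 1) hσ ha
    (by push_cast; linarith)).const_mul C
  refine (hasDerivAt_integral_of_dominated_loc_of_deriv_le (s := Ioi ((s + 1) / 2))
    (F := fun s τ => weylSeq ν m (s + τ) * ((τ ^ a : ℝ) : ℂ))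
    (F' := fun s τ => weylSeq ν (m + 1) (s + τ) * ((τ ^ a : ℝ) : ℂ))
    (Ioi_mem_nhds (by linarith)) ?_
    (integrableOn_weyl hν ha ham hs) (aestronglyMeasurable_weyl ν (m + 1) a hs) ?_ h1 ?_).2
  · filter_upwards [lt_mem_nhds hs] with s' hs'
    exact aestronglyMeasurable_weyl ν m a hs'
  · refine (ae_restrict_iff' measurableSet_Ioi).2 (.of_forall fun τ hτ s' hs' => ?_)
    have hτ : 0 < τ := hτ
    have hs' : (s + 1) / 2 < s' := hs'
    rw [norm_mul, Complex.norm_real, Real.norm_of_nonneg (by positivity), ← mul_assoc]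
    gcongr
    refine (h (s' + τ) (by linarith)).trans ?_
    gcongr ?_ * ?_
    refine Real.rpow_le_rpow_of_nonpos (by linarith) (by linarith) ?_
    push_cast
    have : (0 : ℝ) ≤ m := by positivity
    linarith
  · refine (ae_restrict_iff' measurableSet_Ioi).2 (.of_forall fun τ hτ s' hs' => ?_)
    have hτ : 0 < τ := hτ
    have hs' : (s + 1) / 2 < s' := hs'
    have h2 := (hasDerivAt_weylSeq ν m (t := s' + τ) (by linarith)).comp_add_const s' τ
    exact h2.mul_const _

/-- Integration by parts in `τ`. The boundary term vanishes at `0` because `a + 1 > 0`, and at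
infinity because it is `O(τ^{a - m})`. The identity shows the kernel to be independent of `l` and
removes extra powers of `τ` in `weyl_ode`. -/
theorem weyl_succ_succ {ν : ℂ} (hν : ν.re ≤ 0) {m : ℕ} {a : ℝ} (ha : -1 < a) (ham : a < m)
    {s : ℝ} (hs : 1 < s) : weyl ν (m + 1) (a + 1) s = -(a + 1) * weyl ν m a s := by
  have hu : ∀ τ ∈ Ioi (0 : ℝ), HasDerivAt (fun τ : ℝ => ((τ ^ (a + 1) : ℝ) : ℂ))
      (((a + 1) * τ ^ a : ℝ) : ℂ) τ := fun τ hτ => by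
    have h := (Real.hasDerivAt_rpow_const (p := a + 1) (Or.inl (ne_of_gt hτ))).ofReal_comp
    rwa [add_sub_cancel_right] at h
  have hv : ∀ τ ∈ Ioi (0 : ℝ), HasDerivAt (fun τ : ℝ => weylSeq ν m (s + τ))
      (weylSeq ν (m + 1) (s + τ)) τ := fun τ hτ => by
    have hτ : 0 < τ := hτ
    exact (hasDerivAt_weylSeq ν m (t := s + τ) (by linarith)).comp_const_add s τ
  have hi1 := integrableOn_weyl hν (m := m + 1) (a := a + 1) (by linarith)
    (by push_cast; linarith) hs
  have hi2 := integrableOn_weyl hν ha ham hs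
  obtain ⟨C, hC, hb⟩ := exists_norm_weylSeq_le m hν
  have h := integral_Ioi_mul_deriv_eq_deriv_mul (a' := 0) (b' := 0) hu hv ?_ ?_ ?_ ?_
  · rw [weyl, weyl, ← integral_const_mul]
    simp only [mul_comm (weylSeq _ _ _)]
    rw [h, sub_zero, zero_sub, ← integral_neg]
    congr 1
    funext τ
    push_cast
    ring
  · refine hi1.congr (.of_forall fun τ => mul_comm _ _)
  · refine (hi2.const_mul ((a : ℂ) + 1)).congr (.of_forall fun τ => ?_)
    simp only [Pi.mul_apply]
    push_cast
    ring
  · have h1 : ContinuousAt (fun τ : ℝ => ((τ ^ (a + 1) : ℝ) : ℂ) * weylSeq ν m (s + τ)) 0 := by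
      refine ContinuousAt.mul ?_ ?_
      · exact Complex.continuous_ofReal.continuousAt.comp
          (Real.continuousAt_rpow_const _ _ (Or.inr (by linarith)))
      · refine ContinuousAt.comp (g := weylSeq ν m) ?_ (by fun_prop)
        simpa using (hasDerivAt_weylSeq ν m hs).continuousAt
    have h2 := h1.tendsto.mono_left (nhdsWithin_le_nhds (s := Ioi 0))
    simp only [Real.zero_rpow (by linarith : a + 1 ≠ 0)] at h2
    simpa using! h2
  · have h1 : Tendsto (fun τ : ℝ => C * τ ^ (-((m : ℝ) - a))) atTop (𝓝 0) := by
      simpa using (tendsto_rpow_neg_atTop (y := (m : ℝ) - a) (by linarith)).const_mul C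
    refine squeeze_zero_norm' ?_ h1
    filter_upwards [eventually_gt_atTop 0] with τ hτ
    rw [Pi.mul_apply, norm_mul, Complex.norm_real, Real.norm_of_nonneg (by positivity), mul_comm,
      show -((m : ℝ) - a) = -((m : ℝ) + 1) + (a + 1) by ring,
      Real.rpow_add hτ (-((m : ℝ) + 1)) (a + 1), ← mul_assoc]
    refine mul_le_mul_of_nonneg_right ?_ (Real.rpow_nonneg hτ.le _)
    refine (hb (s + τ) (by linarith)).trans ?_
    gcongr ?_ * ?_
    refine Real.rpow_le_rpow_of_nonpos hτ (by linarith) ?_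
    have : (0 : ℝ) ≤ m := by positivity
    linarith

/-- The Legendre type differential equation of the Weyl integrals. -/
theorem weyl_ode {ν : ℂ} (hν : ν.re ≤ 0) {n l : ℕ} (hn : 1 ≤ n) (hl : -1 < -(n : ℝ) / 2 + l)
    {s : ℝ} (hs : 1 < s) :
    ((s : ℂ) ^ 2 - 1) * weyl ν (l + 2) (-(n : ℝ) / 2 + l) s
      + (n + 1) * s * weyl ν (l + 1) (-(n : ℝ) / 2 + l) s
      + ((n : ℂ) ^ 2 / 4 - ν ^ 2) * weyl ν l (-(n : ℝ) / 2 + l) s = 0 := by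
  have hn' : (1 : ℝ) ≤ n := by exact_mod_cast hn
  obtain ⟨a, ha⟩ : ∃ a : ℝ, a = -(n : ℝ) / 2 + l := ⟨_, rfl⟩
  rw [← ha] at hl ⊢
  have hal : a < l := by linarith
  have e1 := weyl_succ_succ hν (m := l + 1) (a := a) hl (by push_cast; linarith) hs
  have e2 := weyl_succ_succ hν (m := l + 1) (a := a + 1) (by linarith) (by push_cast; linarith) hs
  have e3 := weyl_succ_succ hν (m := l) (a := a) hl hal hs
  have i1 := integrableOn_weyl hν (m := l + 2) (a := a) hl (by push_cast; linarith) hs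
  have i2 := integrableOn_weyl hν (m := l + 2) (a := a + 1) (by linarith) (by push_cast; linarith) hs
  have i3 := integrableOn_weyl hν (m := l + 2) (a := a + 1 + 1) (by linarith)
    (by push_cast; linarith) hs
  have i4 := integrableOn_weyl hν (m := l + 1) (a := a) hl (by push_cast; linarith) hs
  have i5 := integrableOn_weyl hν (m := l + 1) (a := a + 1) (by linarith) (by push_cast; linarith) hs
  have i6 := integrableOn_weyl hν (m := l) (a := a) hl hal hs
  -- The equation of `weylSeq` at `t = s + τ`, with `t² - 1 = (s² - 1) + 2 s τ + τ²`, is integrated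
  -- against `τ^a`; the factors `τ` and `τ²` raise the exponent to `a + 1` and `a + 2`.
  have key : ((s : ℂ) ^ 2 - 1) * weyl ν (l + 2) a s + 2 * s * weyl ν (l + 2) (a + 1) s
      + weyl ν (l + 2) (a + 1 + 1) s + (2 * l + 3) * s * weyl ν (l + 1) a s
      + (2 * l + 3) * weyl ν (l + 1) (a + 1) s + ((l + 1) ^ 2 - ν ^ 2) * weyl ν l a s = 0 := by
    simp only [weyl]
    have j1 := (i1.const_mul ((s : ℂ) ^ 2 - 1))
    have j2 := (i2.const_mul (2 * (s : ℂ)))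
    have j4 := (i4.const_mul ((2 * (l : ℂ) + 3) * s))
    have j5 := (i5.const_mul (2 * (l : ℂ) + 3))
    have j6 := (i6.const_mul (((l : ℂ) + 1) ^ 2 - ν ^ 2))
    simp only [← integral_const_mul]
    have j12 := j1.add j2
    have j123 := j12.add i3
    have j1234 := j123.add j4
    have j12345 := j1234.add j5
    rw [← integral_add' j1 j2, ← integral_add' j12 i3, ← integral_add' j123 j4,
      ← integral_add' j1234 j5, ← integral_add' j12345 j6]
    rw [← integral_zero ℝ ℂ (μ := volume.restrict (Ioi 0))]
    refine setIntegral_congr_fun measurableSet_Ioi fun τ hτ => ?_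
    have hτ : 0 < τ := hτ
    have ho := weylSeq_ode ν l (t := s + τ) (by linarith)
    have r1 : τ ^ (a + 1) = τ * τ ^ a := by rw [Real.rpow_add_one hτ.ne', mul_comm]
    have r2 : τ ^ (a + 1 + 1) = τ ^ 2 * τ ^ a := by rw [Real.rpow_add_one hτ.ne', r1]; ring
    simp only [Pi.add_apply]
    rw [r1, r2]
    push_cast at ho ⊢
    linear_combination ((τ ^ a : ℝ) : ℂ) * ho
  -- Integration by parts brings every exponent back to `a`. With `l = a + n/2` the middle
  -- coefficient `2 l + 3 - 2 (a + 1)` is `n + 1`, and the constant terms of the last coefficient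
  -- sum to `n²/4`.
  rw [e2, e1, e3] at key
  have hac : (a : ℂ) = -(n : ℂ) / 2 + l := by rw [ha]; push_cast; ring
  have hln : (l : ℂ) = a + (n : ℂ) / 2 := by rw [hac]; ring
  rw [hln] at key
  push_cast at key ⊢
  linear_combination key

/-- Scaling `τ = σ r` and dominated convergence reduce the leading behaviour at `s = 1` to that of
`weylSeq`, times a Beta integral. -/
theorem tendsto_weyl {ν : ℂ} (hν : ν.re ≤ 0) {m : ℕ} {a : ℝ} (ha : -1 < a)
    (ham : a + 1 / 2 < m) :
    Tendsto (fun σ : ℝ => ((σ ^ ((m : ℝ) - 1 / 2 - a) : ℝ) : ℂ) * weyl ν m a (1 + σ)) (𝓝[>] 0)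
      (𝓝 ((((-1) ^ m * (2 ^ (-(1 / 2) : ℝ) * (Real.Gamma (m + 1 / 2) / Real.Gamma (1 / 2)))) *
        ∫ r in Ioi (0 : ℝ), (1 + r) ^ (-((m : ℝ) + 1 / 2)) * r ^ a : ℝ) : ℂ)) := by
  obtain ⟨C, hC, h⟩ := norm_weylSeq_le m
  set c : ℝ := (-1) ^ m * (2 ^ (-(1 / 2) : ℝ) * (Real.Gamma (m + 1 / 2) / Real.Gamma (1 / 2)))
  have hlim : Tendsto (fun σ : ℝ => ∫ r in Ioi (0 : ℝ), ((σ ^ ((m : ℝ) + 1 / 2) : ℝ) : ℂ) *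
      weylSeq ν m (1 + σ * (1 + r)) * ((r ^ a : ℝ) : ℂ)) (𝓝[>] 0)
      (𝓝 (∫ r in Ioi (0 : ℝ), (c : ℂ) * (((1 + r) ^ (-((m : ℝ) + 1 / 2)) : ℝ) : ℂ)
        * ((r ^ a : ℝ) : ℂ))) := by
    refine tendsto_integral_filter_of_dominated_convergence
      (fun r => C * (1 + ‖ν‖) ^ m * ((1 + r) ^ (-((m : ℝ) + 1 / 2)) * r ^ a)) ?_ ?_ ?_ ?_
    · filter_upwards [self_mem_nhdsWithin] with σ hσ
      have hσ : 0 < σ := hσ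
      refine (AEStronglyMeasurable.const_mul ?_ _).mul ?_
      · refine ContinuousOn.aestronglyMeasurable ?_ measurableSet_Ioi
        refine (continuousOn_weylSeq ν m).comp (by fun_prop) fun r hr => ?_
        have : (0 : ℝ) < r := hr
        have : 0 < σ * (1 + r) := by positivity
        exact show 1 < 1 + σ * (1 + r) by linarith
      · apply Measurable.aestronglyMeasurable
        fun_prop
    · filter_upwards [self_mem_nhdsWithin] with σ hσ
      have hσ : 0 < σ := hσ
      refine (ae_restrict_iff' measurableSet_Ioi).2 (.of_forall fun r hr => ?_)
      have hr : 0 < r := hr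
      have hp : 0 < σ * (1 + r) := by positivity
      have hb := norm_weylSeq_le_rpow hC h le_rfl (by norm_num : (0 : ℝ) ≤ 1 / 2) hν
        (s := 1 + σ * (1 + r)) (by linarith) le_rfl
      rw [add_zero, add_zero, add_zero, add_zero, add_sub_cancel_left] at hb
      rw [norm_mul, norm_mul, Complex.norm_real, Complex.norm_real,
        Real.norm_of_nonneg (by positivity), Real.norm_of_nonneg (by positivity), ← mul_assoc]
      refine mul_le_mul_of_nonneg_right ?_ (by positivity)
      calc σ ^ ((m : ℝ) + 1 / 2) * ‖weylSeq ν m (1 + σ * (1 + r))‖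
          ≤ σ ^ ((m : ℝ) + 1 / 2) * (C * (1 + ‖ν‖) ^ m * 1 * 1 *
            (σ * (1 + r)) ^ (-((m : ℝ) + 1 / 2))) := by
            refine mul_le_mul_of_nonneg_left (hb.trans ?_) (by positivity)
            gcongr
            · rw [Real.exp_le_one_iff]
              exact mul_nonpos_of_nonpos_of_nonneg hν (Real.arcosh_nonneg (by linarith))
            · exact Real.rpow_le_one_of_one_le_of_nonpos (by linarith) (by norm_num)
        _ = C * (1 + ‖ν‖) ^ m * (1 + r) ^ (-((m : ℝ) + 1 / 2)) := by
            rw [Real.mul_rpow hσ.le (by linarith), Real.rpow_neg hσ.le]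
            field_simp
    · exact (integrableOn_one_add_rpow_mul_rpow ha (by linarith)).const_mul _
    · refine (ae_restrict_iff' measurableSet_Ioi).2 (.of_forall fun r hr => ?_)
      have hr : 0 < r := hr
      refine Tendsto.mul_const _ ?_
      have h1 : Tendsto (fun σ : ℝ => 1 + σ * (1 + r)) (𝓝[>] 0) (𝓝[>] 1) := by
        refine tendsto_nhdsWithin_iff.2 ⟨?_, ?_⟩
        · have : ContinuousAt (fun σ : ℝ => 1 + σ * (1 + r)) 0 := by fun_prop
          simpa using this.tendsto.mono_left (nhdsWithin_le_nhds (s := Ioi 0))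
        · filter_upwards [self_mem_nhdsWithin] with σ hσ
          have hσ : 0 < σ := hσ
          have hp : 0 < σ * (1 + r) := by positivity
          exact show 1 < 1 + σ * (1 + r) by linarith
      have h2 := ((tendsto_weylSeq ν m).comp h1).mul_const
        ((((1 + r) ^ (-((m : ℝ) + 1 / 2)) : ℝ) : ℂ))
      refine h2.congr' ?_
      filter_upwards [self_mem_nhdsWithin] with σ hσ
      have hσ : 0 < σ := hσ
      simp only [Function.comp_apply]
      rw [add_sub_cancel_left, Real.mul_rpow hσ.le (by linarith),
        Real.rpow_neg (by linarith : (0 : ℝ) ≤ 1 + r)]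
      have : (((1 + r) ^ ((m : ℝ) + 1 / 2) : ℝ) : ℂ) ≠ 0 := by
        have : (1 + r) ^ ((m : ℝ) + 1 / 2) ≠ 0 := by positivity
        exact_mod_cast this
      generalize (1 + r) ^ ((m : ℝ) + 1 / 2) = A at *
      generalize σ ^ ((m : ℝ) + 1 / 2) = B at *
      push_cast
      field_simp
  have hval : ∫ r in Ioi (0 : ℝ), (c : ℂ) * (((1 + r) ^ (-((m : ℝ) + 1 / 2)) : ℝ) : ℂ)
        * ((r ^ a : ℝ) : ℂ) =
      ((c * ∫ r in Ioi (0 : ℝ), (1 + r) ^ (-((m : ℝ) + 1 / 2)) * r ^ a : ℝ) : ℂ) := by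
    rw [← integral_const_mul, ← integral_complex_ofReal]
    congr 1
    funext r
    push_cast
    ring
  rw [← hval]
  refine hlim.congr' ?_
  filter_upwards [self_mem_nhdsWithin] with σ hσ
  have hσ : 0 < σ := hσ
  have h1 := integral_comp_mul_left_Ioi
    (fun τ : ℝ => weylSeq ν m (1 + σ + τ) * ((τ ^ a : ℝ) : ℂ)) 0 hσ
  rw [mul_zero, eq_inv_smul_iff₀ hσ.ne'] at h1
  rw [weyl, ← h1, ← integral_smul, ← integral_const_mul]
  refine setIntegral_congr_fun measurableSet_Ioi fun r hr => ?_
  have hr : 0 < r := hr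
  have e1 : σ ^ ((m : ℝ) + 1 / 2) = σ ^ ((m : ℝ) - 1 / 2 - a) * σ * σ ^ a := by
    rw [← Real.rpow_add_one hσ.ne', ← Real.rpow_add hσ]; congr 1; ring
  rw [Real.mul_rpow hσ.le hr.le, e1, show 1 + σ + σ * r = 1 + σ * (1 + r) by ring,
    Complex.real_smul]
  push_cast
  ring

/-! ### Translations, inversion, modular function and the distance -/

section Group

variable {n : ℕ}

theorem inv_def (g : AxB n) : g⁻¹ = (-g.1, -(Real.exp (-g.1) • g.2)) := rfl
theorem one_def : (1 : AxB n) = (0, 0) := rfl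
theorem mul_fst (g h : AxB n) : (g * h).1 = g.1 + h.1 := rfl
theorem inv_fst (g : AxB n) : (g⁻¹).1 = -g.1 := rfl
theorem inv_snd (g : AxB n) : (g⁻¹).2 = -(Real.exp (-g.1) • g.2) := rfl

instance : IsTopologicalGroup (AxB n) where
  continuous_mul := by
    change Continuous fun p : AxB n × AxB n =>
      ((p.1.1 + p.2.1, p.1.2 + Real.exp p.1.1 • p.2.2) : AxB n)
    fun_prop
  continuous_inv := by
    change Continuous fun g : AxB n => ((-g.1, -(Real.exp (-g.1) • g.2)) : AxB n)
    fun_prop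

theorem lintegral_add_smul {c : ℝ} (hc : c ≠ 0) (z : EuclideanSpace ℝ (Fin n))
    (F : EuclideanSpace ℝ (Fin n) → ENNReal) (hF : Measurable F) :
    ∫⁻ y, F (z + c • y) = ENNReal.ofReal (|c| ^ n)⁻¹ * ∫⁻ y, F y := by
  have h1 : ∫⁻ y, F (z + c • y) = ∫⁻ y, (fun y => F (z + y)) y
      ∂(Measure.map (c • ·) (volume : Measure (EuclideanSpace ℝ (Fin n)))) := by
    rw [lintegral_map (by fun_prop) (by fun_prop)]
  rw [h1, Measure.map_addHaar_smul _ hc, lintegral_smul_measure,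
    lintegral_add_left_eq_self (μ := volume) F z]
  simp [abs_pow]

theorem measurePreserving_mul_right (h : AxB n) :
    MeasurePreserving (fun g : AxB n => g * h) := by
  have := (measurePreserving_add_right (volume : Measure ℝ) h.1).skew_product
    (g := fun (x : ℝ) (y : EuclideanSpace ℝ (Fin n)) => y + Real.exp x • h.2)
    (μc := volume) (μd := volume) (by fun_prop)
    (.of_forall fun x => (measurePreserving_add_right volume (Real.exp x • h.2)).map_eq)
  exact this

/-- Inversion carries the right Haar measure to the left one. On the fibre over `x` it scales `y`,
and the Jacobian is the modular function. -/
theorem lintegral_inv (F : AxB n → ENNReal) (hF : Measurable F) :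
    ∫⁻ g : AxB n, F g⁻¹ = ∫⁻ g : AxB n, ENNReal.ofReal (Real.exp (-(n * g.1))) * F g := by
  have hFi : Measurable fun g : AxB n => F g⁻¹ := hF.comp continuous_inv.measurable
  rw [Measure.volume_eq_prod, lintegral_prod _ hFi.aemeasurable,
    lintegral_prod _ (by fun_prop : Measurable fun g : AxB n =>
      ENNReal.ofReal (Real.exp (-(n * g.1))) * F g).aemeasurable]
  rw [← lintegral_neg_eq_self]
  refine lintegral_congr fun x => ?_
  have h := lintegral_add_smul (n := n) (c := -Real.exp x) (neg_ne_zero.2 (Real.exp_pos x).ne') 0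
    (fun y => F (x, y)) (by fun_prop)
  have e0 : ∫⁻ y : EuclideanSpace ℝ (Fin n), ENNReal.ofReal (Real.exp (-(n * (x, y).1))) * F (x, y)
      = ENNReal.ofReal (Real.exp (-(n * x))) * ∫⁻ y, F (x, y) :=
    lintegral_const_mul (ENNReal.ofReal (Real.exp (-(n * x)))) (f := fun y => F (x, y)) (by fun_prop)
  have e : (|(-Real.exp x)| ^ n)⁻¹ = Real.exp (-(n * x)) := by
    rw [abs_neg, abs_of_pos (Real.exp_pos x), ← Real.exp_nat_mul, Real.exp_neg]
  rw [e] at h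
  rw [e0, ← h]
  refine lintegral_congr fun y => ?_
  rw [inv_def]
  simp

theorem lintegral_mul_left (h : AxB n) (F : AxB n → ENNReal) (hF : Measurable F) :
    ∫⁻ g : AxB n, F (h * g) = ENNReal.ofReal (Real.exp (-(n * h.1))) * ∫⁻ g : AxB n, F g := by
  have hFi : Measurable fun g : AxB n => F (h * g) := hF.comp (continuous_const_mul h).measurable
  rw [Measure.volume_eq_prod, lintegral_prod _ hFi.aemeasurable,
    lintegral_prod _ hF.aemeasurable, ← lintegral_const_mul _ (by fun_prop),
    ← lintegral_add_left_eq_self (μ := volume) (fun x => _ * ∫⁻ y, F (x, y)) h.1]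
  refine lintegral_congr fun x => ?_
  have h' := lintegral_add_smul (n := n) (Real.exp_pos h.1).ne' h.2
    (fun y => F (h.1 + x, y)) (by fun_prop)
  have e : (|(Real.exp h.1)| ^ n)⁻¹ = Real.exp (-(n * h.1)) := by
    rw [abs_of_pos (Real.exp_pos _), ← Real.exp_nat_mul, Real.exp_neg]
  rw [e] at h'
  exact h'

theorem map_inv_volume : Measure.map (fun g : AxB n => g⁻¹) volume
    = volume.withDensity fun g => ENNReal.ofReal (Real.exp (-(n * g.1))) := by
  refine Measure.ext_of_lintegral _ fun F hF => ?_
  rw [lintegral_map hF continuous_inv.measurable, lintegral_inv F hF,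
    lintegral_withDensity_eq_lintegral_mul _ (by fun_prop) hF]
  rfl

theorem map_mul_left_volume (h : AxB n) : Measure.map (fun g : AxB n => h * g) volume
    = ENNReal.ofReal (Real.exp (-(n * h.1))) • volume := by
  refine Measure.ext_of_lintegral _ fun F hF => ?_
  rw [lintegral_map hF (continuous_const_mul h).measurable, lintegral_mul_left h F hF,
    lintegral_smul_measure, smul_eq_mul]

theorem integrable_comp_inv_iff (F : AxB n → ℂ) : Integrable (fun g : AxB n => F g⁻¹) ↔
    Integrable fun g : AxB n => (Real.exp (-(n * g.1)) : ℂ) * F g := by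
  have he := (Homeomorph.inv (AxB n)).measurableEmbedding
  have h := he.integrable_map_iff (μ := volume) (g := F)
  change Integrable F (Measure.map (fun g : AxB n => g⁻¹) volume) ↔
    Integrable (fun g : AxB n => F g⁻¹) at h
  rw [← h, map_inv_volume, integrable_withDensity_iff_integrable_smul' (by fun_prop) (by simp)]
  simp [ENNReal.toReal_ofReal, Real.exp_nonneg]

theorem integral_comp_inv (F : AxB n → ℂ) : ∫ g : AxB n, F g⁻¹ =
    ∫ g : AxB n, (Real.exp (-(n * g.1)) : ℂ) * F g := by
  have he := (Homeomorph.inv (AxB n)).measurableEmbedding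
  have h := he.integral_map (μ := volume) (g := F)
  change ∫ y, F y ∂(Measure.map (fun g : AxB n => g⁻¹) volume) = ∫ g : AxB n, F g⁻¹ at h
  rw [← h, map_inv_volume, integral_withDensity_eq_integral_toReal_smul (by fun_prop) (by simp)]
  simp [ENNReal.toReal_ofReal, Real.exp_nonneg]

theorem integral_comp_mul_left (h : AxB n) (F : AxB n → ℂ) : ∫ g : AxB n, F (h * g) =
    (Real.exp (-(n * h.1)) : ℂ) * ∫ g : AxB n, F g := by
  have he := (Homeomorph.mulLeft h).measurableEmbedding
  have h' := he.integral_map (μ := volume) (g := F)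
  change ∫ y, F y ∂(Measure.map (fun g : AxB n => h * g) volume) = ∫ g : AxB n, F (h * g) at h'
  rw [← h', map_mul_left_volume, integral_smul_measure, ENNReal.toReal_ofReal (Real.exp_nonneg _),
    Complex.real_smul]

theorem quasiMeasurePreserving_mul_left (h : AxB n) :
    Measure.QuasiMeasurePreserving (fun g : AxB n => h * g) := by
  refine ⟨(continuous_const_mul h).measurable, ?_⟩
  rw [map_mul_left_volume]
  exact Measure.smul_absolutelyContinuous

/-- The hyperbolic cosine of the distance to the identity. -/
def level (g : AxB n) : ℝ := Real.cosh g.1 + 1 / 2 * ‖g.2‖ ^ 2 * Real.exp (-g.1)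

theorem radius_eq (g : AxB n) : radius g = Real.arcosh (level g) := rfl

theorem one_le_level (g : AxB n) : 1 ≤ level g := by
  have := Real.one_le_cosh g.1
  have : 0 ≤ 1 / 2 * ‖g.2‖ ^ 2 * Real.exp (-g.1) := by positivity
  rw [level]; linarith

theorem one_lt_level {g : AxB n} (hg : g ≠ 1) : 1 < level g := by
  rcases (one_le_level g).lt_or_eq with h | h
  · exact h
  · exfalso
    apply hg
    have h1 := Real.one_le_cosh g.1
    have h2 : 0 ≤ 1 / 2 * ‖g.2‖ ^ 2 * Real.exp (-g.1) := by positivity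
    rw [level] at h
    have h3 : g.1 = 0 := by
      by_contra h0
      have := Real.one_lt_cosh.2 h0
      linarith
    have h4 : g.2 = 0 := by
      by_contra h0
      have : 0 < 1 / 2 * ‖g.2‖ ^ 2 * Real.exp (-g.1) := by
        have := norm_pos_iff.2 h0
        positivity
      linarith
    exact Prod.ext h3 h4

theorem level_one : level (1 : AxB n) = 1 := by simp [level, one_def]

theorem radius_nonneg (g : AxB n) : 0 ≤ radius g := Real.arcosh_nonneg (one_le_level g)

theorem radius_pos {g : AxB n} (hg : g ≠ 1) : 0 < radius g := Real.arcosh_pos (one_lt_level hg)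

theorem cosh_radius (g : AxB n) : Real.cosh (radius g) = level g :=
  Real.cosh_arcosh (one_le_level g)

theorem level_inv (g : AxB n) : level g⁻¹ = level g := by
  rw [level, level, inv_fst, inv_snd, Real.cosh_neg, norm_neg, norm_smul, Real.norm_eq_abs,
    Real.abs_exp, neg_neg, mul_pow]
  have : Real.exp (-g.1) * Real.exp g.1 = 1 := by rw [← Real.exp_add]; simp
  linear_combination (1 / 2 * ‖g.2‖ ^ 2 * Real.exp (-g.1)) * this

theorem continuous_level : Continuous (level (n := n)) := by
  unfold level
  have := Real.continuous_cosh
  fun_prop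

theorem contDiff_level : ContDiff ℝ ∞ (level (n := n)) := by
  unfold level
  have h1 : ContDiff ℝ ∞ fun g : AxB n => ‖g.2‖ ^ 2 := contDiff_snd.norm_sq ℝ
  have h2 : ContDiff ℝ ∞ fun g : AxB n => Real.exp (-g.1) := Real.contDiff_exp.comp contDiff_fst.neg
  exact (Real.contDiff_cosh.comp contDiff_fst).add ((contDiff_const.mul h1).mul h2)

theorem continuous_radius : Continuous (radius (n := n)) := by
  exact Real.continuousOn_arcosh.comp_continuous (continuous_level (n := n)) one_le_level

instance : NullSingletonClass (volume : Measure (AxB n)) := by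
  rw [Measure.volume_eq_prod]; infer_instance

theorem ae_ne_one : ∀ᵐ g : AxB n, g ≠ 1 := by
  simp [ae_iff]

end Group

/-! ### Left invariance and Green's formula -/

section Calculus

variable {n : ℕ}

theorem fderiv_comp_mul_left {φ : AxB n → ℂ} (hφ : Differentiable ℝ φ) (h g : AxB n)
    (v : AxB n) : fderiv ℝ (fun g => φ (h * g)) g v
      = fderiv ℝ φ (h * g) (v.1, Real.exp h.1 • v.2) := by
  have h1 : HasFDerivAt (fun g : AxB n => h * g)
      ((ContinuousLinearMap.fst ℝ ℝ (EuclideanSpace ℝ (Fin n))).prod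
        (Real.exp h.1 • ContinuousLinearMap.snd ℝ ℝ (EuclideanSpace ℝ (Fin n)))) g := by
    change HasFDerivAt (fun g : AxB n => ((h.1 + g.1, h.2 + Real.exp h.1 • g.2) : AxB n)) _ g
    exact (hasFDerivAt_fst.const_add h.1).prodMk
      ((Real.exp h.1 • ContinuousLinearMap.snd ℝ ℝ (EuclideanSpace ℝ (Fin n))).hasFDerivAt.const_add
        h.2)
  have h2 := (hφ (h * g)).hasFDerivAt.comp g h1
  have h3 := h2.fderiv
  rw [Function.comp_def] at h3
  rw [h3]
  rfl

theorem X_comp_mul_left {φ : AxB n → ℂ} (hφ : Differentiable ℝ φ) (h : AxB n) :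
    X (fun g => φ (h * g)) = fun g => X φ (h * g) := by
  funext g
  simp only [X]
  rw [fderiv_comp_mul_left hφ, smul_zero]

theorem Y_comp_mul_left (j : Fin n) {φ : AxB n → ℂ} (hφ : Differentiable ℝ φ) (h : AxB n) :
    Y j (fun g => φ (h * g)) = fun g => Y j φ (h * g) := by
  funext g
  simp only [Y]
  have : ((0 : ℝ), Real.exp h.1 • EuclideanSpace.single j (1 : ℝ))
      = Real.exp h.1 • ((0 : ℝ), EuclideanSpace.single j (1 : ℝ)) := by
    rw [Prod.smul_mk, smul_zero]
  rw [fderiv_comp_mul_left hφ, this, map_smul, mul_fst, Real.exp_add, Complex.real_smul]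
  push_cast
  ring

/-- The differential of `g ↦ h g` multiplies `y`-directions by `e^{h.1}`, and the coefficient `eˣ`
of `Y j` absorbs precisely this factor. -/
theorem lap_comp_mul_left {φ : AxB n → ℂ} (hφ : ContDiff ℝ ∞ φ) (h : AxB n) :
    lap (fun g => φ (h * g)) = fun g => lap φ (h * g) := by
  have d : ∀ {ψ : AxB n → ℂ}, ContDiff ℝ ∞ ψ → Differentiable ℝ ψ := fun hψ =>
    hψ.differentiable (by simp)
  funext g
  simp only [lap]
  rw [X_comp_mul_left (d hφ), X_comp_mul_left (d (contDiff_X hφ))]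
  simp_rw [Y_comp_mul_left _ (d hφ)]
  simp_rw [Y_comp_mul_left _ (d (contDiff_Y _ hφ))]

instance : (volume : Measure (AxB n)).IsAddHaarMeasure := by
  rw [Measure.volume_eq_prod]; infer_instance

theorem integral_fderiv_mul {f g : AxB n → ℂ} (hf : ContDiff ℝ 1 f) (hg : ContDiff ℝ 1 g)
    (hc : HasCompactSupport g) (v : AxB n) :
    ∫ p, fderiv ℝ f p v * g p = -∫ p, f p * fderiv ℝ g p v := by
  have hf' : Continuous fun p => fderiv ℝ f p v :=
    (hf.continuous_fderiv one_ne_zero).clm_apply continuous_const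
  have hg' : Continuous fun p => fderiv ℝ g p v :=
    (hg.continuous_fderiv one_ne_zero).clm_apply continuous_const
  have hgc : HasCompactSupport fun p => fderiv ℝ g p v := hc.fderiv_apply (𝕜 := ℝ) v
  have := integral_mul_fderiv_eq_neg_fderiv_mul_of_integrable (μ := volume)
    (f := f) (g := g) (v := v)
    ((hf'.mul hg.continuous).integrable_of_hasCompactSupport hc.mul_left)
    ((hf.continuous.mul hg').integrable_of_hasCompactSupport hgc.mul_left)
    ((hf.continuous.mul hg.continuous).integrable_of_hasCompactSupport (hc.mul_left (f := f)))
    (fun x _ => hf.differentiable one_ne_zero x) (fun x _ => hg.differentiable one_ne_zero x)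
  rw [this, neg_neg]

theorem integral_X_mul {f g : AxB n → ℂ} (hf : ContDiff ℝ 1 f) (hg : ContDiff ℝ 1 g)
    (hc : HasCompactSupport g) : ∫ p, X f p * g p = -∫ p, f p * X g p :=
  integral_fderiv_mul hf hg hc _

theorem contDiff_exp_fst {k : WithTop ℕ∞} :
    ContDiff ℝ k fun g : AxB n => (Real.exp g.1 : ℂ) :=
  Complex.ofRealCLM.contDiff.comp (Real.contDiff_exp.comp contDiff_fst)

theorem fderiv_exp_fst_mul {g : AxB n → ℂ} (hg : Differentiable ℝ g) (p : AxB n)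
    (w : EuclideanSpace ℝ (Fin n)) :
    fderiv ℝ (fun p : AxB n => (Real.exp p.1 : ℂ) * g p) p (0, w)
      = (Real.exp p.1 : ℂ) * fderiv ℝ g p (0, w) := by
  have h1 : HasFDerivAt (fun p : AxB n => (Real.exp p.1 : ℂ))
      (Complex.ofRealCLM.comp (Real.exp p.1 • ContinuousLinearMap.fst ℝ ℝ _)) p :=
    Complex.ofRealCLM.hasFDerivAt.comp p
      ((Real.hasDerivAt_exp p.1).comp_hasFDerivAt p hasFDerivAt_fst)
  have h2 := (h1.mul (hg p).hasFDerivAt).fderiv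
  have h3 : (fun p : AxB n => (Real.exp p.1 : ℂ) * g p) =
    (fun p : AxB n => (Real.exp p.1 : ℂ)) * g := rfl
  rw [h3, h2]
  simp

/-- The coefficient `eˣ` is constant in the direction of differentiation, so `Y j` is divergence
free for `dg` and can be integrated by parts without a zero-order term. -/
theorem integral_Y_mul (j : Fin n) {f g : AxB n → ℂ} (hf : ContDiff ℝ 1 f) (hg : ContDiff ℝ 1 g)
    (hc : HasCompactSupport g) : ∫ p, Y j f p * g p = -∫ p, f p * Y j g p := by
  have h := integral_fderiv_mul hf (contDiff_exp_fst.mul hg) (hc.mul_left (f := fun p : AxB n =>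
    (Real.exp p.1 : ℂ))) (0, EuclideanSpace.single j (1 : ℝ))
  have e : ∀ p, fderiv ℝ (fun p : AxB n => (Real.exp p.1 : ℂ) * g p) p
      (0, EuclideanSpace.single j (1 : ℝ)) = Y j g p := fun p =>
    fderiv_exp_fst_mul (hg.differentiable one_ne_zero) p _
  simp only [e] at h
  rw [← h]
  refine integral_congr_ae (.of_forall fun p => ?_)
  simp only [Y]
  ring

theorem contDiff_X_of_succ {k : ℕ} {φ : AxB n → ℂ} (h : ContDiff ℝ (k + 1 : ℕ) φ) :
    ContDiff ℝ k (X φ) :=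
  (h.fderiv_right (m := k) (by norm_cast)).clm_apply contDiff_const

theorem contDiff_Y_of_succ {k : ℕ} (j : Fin n) {φ : AxB n → ℂ} (h : ContDiff ℝ (k + 1 : ℕ) φ) :
    ContDiff ℝ k (Y j φ) :=
  contDiff_exp_fst.mul ((h.fderiv_right (m := k) (by norm_cast)).clm_apply contDiff_const)

theorem hasCompactSupport_X {φ : AxB n → ℂ} (h : HasCompactSupport φ) : HasCompactSupport (X φ) :=
  h.fderiv_apply (𝕜 := ℝ) _

theorem hasCompactSupport_Y (j : Fin n) {φ : AxB n → ℂ} (h : HasCompactSupport φ) :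
    HasCompactSupport (Y j φ) :=
  (h.fderiv_apply (𝕜 := ℝ) _).mul_left

/-- Green's formula. -/
theorem integral_lap_mul_eq {f g : AxB n → ℂ} (hf : ContDiff ℝ 2 f) (hg : ContDiff ℝ 1 g)
    (hc : HasCompactSupport g) :
    ∫ p, lap f p * g p = ∫ p, (X f p * X g p + ∑ j, Y j f p * Y j g p) := by
  have hX : ContDiff ℝ 1 (X f) := contDiff_X_of_succ (k := 1) hf
  have hY : ∀ j, ContDiff ℝ 1 (Y j f) := fun j => contDiff_Y_of_succ (k := 1) j hf
  have hXX : Continuous (X (X f)) := (contDiff_X_of_succ (k := 0) hX).continuous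
  have hYY : ∀ j, Continuous (Y j (Y j f)) := fun j =>
    (contDiff_Y_of_succ (k := 0) j (hY j)).continuous
  have hgX : Continuous (X g) := (contDiff_X_of_succ (k := 0) hg).continuous
  have hgY : ∀ j, Continuous (Y j g) := fun j => (contDiff_Y_of_succ (k := 0) j hg).continuous
  have i1 : Integrable fun p => X (X f) p * g p :=
    (hXX.mul hg.continuous).integrable_of_hasCompactSupport hc.mul_left
  have i2 : ∀ j, Integrable fun p => Y j (Y j f) p * g p := fun j =>
    ((hYY j).mul hg.continuous).integrable_of_hasCompactSupport hc.mul_left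
  have i3 : Integrable fun p => X f p * X g p :=
    (hX.continuous.mul hgX).integrable_of_hasCompactSupport (hasCompactSupport_X hc).mul_left
  have i4 : ∀ j, Integrable fun p => Y j f p * Y j g p := fun j =>
    ((hY j).continuous.mul (hgY j)).integrable_of_hasCompactSupport
      (hasCompactSupport_Y j hc).mul_left
  have e : ∀ p, lap f p * g p = -(X (X f) p * g p) - ∑ j, Y j (Y j f) p * g p := fun p => by
    rw [lap, sub_mul, neg_mul, Finset.sum_mul]
  simp only [e]
  rw [integral_sub (Integrable.fun_neg i1) (integrable_finsetSum _ fun j _ => i2 j), integral_neg,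
    integral_X_mul hX hg hc, integral_finsetSum _ fun j _ => i2 j,
    integral_add i3 (integrable_finsetSum _ fun j _ => i4 j), integral_finsetSum _ fun j _ => i4 j,
    neg_neg, sub_eq_add_neg, ← Finset.sum_neg_distrib]
  congr 1
  refine Finset.sum_congr rfl fun j _ => ?_
  rw [integral_Y_mul j (hY j) hg hc, neg_neg]

/-- Only one factor has compact support: the other will be the regularized kernel or a smooth weak
solution. -/
theorem integral_lap_mul_comm {f g : AxB n → ℂ} (hf : ContDiff ℝ 2 f) (hg : ContDiff ℝ 2 g)
    (hc : HasCompactSupport g) : ∫ p, lap f p * g p = ∫ p, f p * lap g p := by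
  have hg1 : ContDiff ℝ 1 g := hg.of_le (by norm_num)
  have hf1 : ContDiff ℝ 1 f := hf.of_le (by norm_num)
  have hX : ContDiff ℝ 1 (X g) := contDiff_X_of_succ (k := 1) hg
  have hY : ∀ j, ContDiff ℝ 1 (Y j g) := fun j => contDiff_Y_of_succ (k := 1) j hg
  have hXX : Continuous (X (X g)) := (contDiff_X_of_succ (k := 0) hX).continuous
  have hYY : ∀ j, Continuous (Y j (Y j g)) := fun j =>
    (contDiff_Y_of_succ (k := 0) j (hY j)).continuous
  have hfX : Continuous (X f) := (contDiff_X_of_succ (k := 0) hf1).continuous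
  have hfY : ∀ j, Continuous (Y j f) := fun j => (contDiff_Y_of_succ (k := 0) j hf1).continuous
  have cX := hasCompactSupport_X hc
  have cY := fun j => hasCompactSupport_Y j hc
  have i1 : Integrable fun p => f p * X (X g) p :=
    (hf.continuous.mul hXX).integrable_of_hasCompactSupport (hasCompactSupport_X cX).mul_left
  have i2 : ∀ j, Integrable fun p => f p * Y j (Y j g) p := fun j =>
    (hf.continuous.mul (hYY j)).integrable_of_hasCompactSupport
      (hasCompactSupport_Y j (cY j)).mul_left
  have i3 : Integrable fun p => X f p * X g p :=
    (hfX.mul hX.continuous).integrable_of_hasCompactSupport cX.mul_left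
  have i4 : ∀ j, Integrable fun p => Y j f p * Y j g p := fun j =>
    ((hfY j).mul (hY j).continuous).integrable_of_hasCompactSupport (cY j).mul_left
  rw [integral_lap_mul_eq hf hg1 hc]
  have e : ∀ p, f p * lap g p = -(f p * X (X g) p) - ∑ j, f p * Y j (Y j g) p := fun p => by
    rw [lap, mul_sub, mul_neg, Finset.mul_sum]
  simp only [e]
  rw [integral_sub (Integrable.fun_neg i1) (integrable_finsetSum _ fun j _ => i2 j), integral_neg,
    integral_finsetSum _ fun j _ => i2 j,
    integral_add i3 (integrable_finsetSum _ fun j _ => i4 j), integral_finsetSum _ fun j _ => i4 j,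
    sub_eq_add_neg, ← Finset.sum_neg_distrib, integral_X_mul hf1 hX cX]
  congr 1
  refine Finset.sum_congr rfl fun j _ => ?_
  rw [integral_Y_mul j hf1 (hY j) (cY j)]

end Calculus

/-! ### The Laplacian of `e^{-nx/2} w(ch R)` -/

section Radial

variable {n : ℕ}

theorem X_eq_of_hasDerivAt {f : AxB n → ℂ} {g : AxB n} (hf : DifferentiableAt ℝ f g) {d : ℂ}
    (h : HasDerivAt (fun x : ℝ => f (x, g.2)) d g.1) : X f g = d := by
  have h1 : HasDerivAt (fun x : ℝ => ((x, g.2) : AxB n)) (1, 0) g.1 :=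
    (hasDerivAt_id g.1).prodMk (hasDerivAt_const _ _)
  exact ((hf.hasFDerivAt.comp_hasDerivAt g.1 h1).unique h)

theorem Y_eq_of_hasDerivAt {f : AxB n → ℂ} {g : AxB n} (hf : DifferentiableAt ℝ f g) {d : ℂ}
    {j : Fin n}
    (h : HasDerivAt (fun t : ℝ => f (g.1, g.2 + t • EuclideanSpace.single j (1 : ℝ))) d 0) :
    Y j f g = (Real.exp g.1 : ℂ) * d := by
  have h1 : HasDerivAt (fun t : ℝ => ((g.1, g.2 + t • EuclideanSpace.single j (1 : ℝ)) : AxB n))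
      (0, EuclideanSpace.single j (1 : ℝ)) 0 := by
    refine (hasDerivAt_const _ _).prodMk ?_
    simpa using ((hasDerivAt_id (0 : ℝ)).smul_const (EuclideanSpace.single j (1 : ℝ))).const_add g.2
  have h0 : (g.1, g.2 + (0 : ℝ) • EuclideanSpace.single j (1 : ℝ)) = g := by simp
  have h2 := (h0.symm ▸ hf.hasFDerivAt :
    HasFDerivAt f (fderiv ℝ f g) (g.1, g.2 + (0 : ℝ) • EuclideanSpace.single j (1 : ℝ)))
  rw [Y, (h2.comp_hasDerivAt 0 h1).unique h]

/-- The derivative of `level` along `X`. -/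
def levelX (g : AxB n) : ℝ := Real.sinh g.1 - 1 / 2 * ‖g.2‖ ^ 2 * Real.exp (-g.1)

theorem level_add_levelX (g : AxB n) : level g + levelX g = Real.exp g.1 := by
  rw [level, levelX]; linear_combination Real.cosh_add_sinh g.1

/-- As `X` and `Y j` send `ch R` to `levelX` and `y_j`, this is `|∇ ch R|² = sh² R`. It comes from
multiplying `level + levelX = eˣ` by `level - levelX = e⁻ˣ (1 + ‖y‖²)`. -/
theorem levelX_sq_add (g : AxB n) : levelX g ^ 2 + ‖g.2‖ ^ 2 = level g ^ 2 - 1 := by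
  have h1 := level_add_levelX g
  have h2 : level g - levelX g = Real.exp (-g.1) + ‖g.2‖ ^ 2 * Real.exp (-g.1) := by
    rw [level, levelX]; linear_combination Real.cosh_sub_sinh g.1
  have h3 : Real.exp g.1 * Real.exp (-g.1) = 1 := by rw [← Real.exp_add]; simp
  have h4 : (level g + levelX g) * (level g - levelX g) = 1 + ‖g.2‖ ^ 2 := by
    rw [h1, h2]; linear_combination (1 + ‖g.2‖ ^ 2) * h3
  linarith

theorem hasDerivAt_level_fst (x : ℝ) (y : EuclideanSpace ℝ (Fin n)) :
    HasDerivAt (fun x => level ((x, y) : AxB n)) (levelX (x, y)) x := by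
  have h := (Real.hasDerivAt_cosh x).add
    (((hasDerivAt_neg x).exp).const_mul (1 / 2 * ‖y‖ ^ 2))
  refine h.congr_deriv ?_
  simp [levelX]; ring

theorem hasDerivAt_levelX_fst (x : ℝ) (y : EuclideanSpace ℝ (Fin n)) :
    HasDerivAt (fun x => levelX ((x, y) : AxB n)) (level (x, y)) x := by
  have h := (Real.hasDerivAt_sinh x).sub
    (((hasDerivAt_neg x).exp).const_mul (1 / 2 * ‖y‖ ^ 2))
  refine h.congr_deriv ?_
  simp [level]

theorem hasDerivAt_level_snd (x : ℝ) (y : EuclideanSpace ℝ (Fin n)) (j : Fin n) :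
    HasDerivAt (fun t : ℝ => level ((x, y + t • EuclideanSpace.single j (1 : ℝ)) : AxB n))
      (Real.exp (-x) * y j) 0 := by
  have e : ∀ t : ℝ, level ((x, y + t • EuclideanSpace.single j (1 : ℝ)) : AxB n)
      = Real.cosh x + 1 / 2 * (‖y‖ ^ 2 + 2 * (t * y j) + t ^ 2) * Real.exp (-x) := by
    intro t
    simp only [level]
    rw [norm_add_sq_real, inner_smul_right, norm_smul, EuclideanSpace.inner_single_right]
    simp
  simp only [e]
  have h1 : HasDerivAt (fun t : ℝ => ‖y‖ ^ 2 + 2 * (t * y j) + t ^ 2) (2 * y j) 0 := by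
    have h2 := (((hasDerivAt_id (0 : ℝ)).mul_const (y j)).const_mul 2).const_add (‖y‖ ^ 2)
    have h3 := h2.add (hasDerivAt_pow 2 (0 : ℝ))
    refine h3.congr_deriv ?_
    simp
  have h4 := ((h1.const_mul (1 / 2)).mul_const (Real.exp (-x))).const_add (Real.cosh x)
  refine h4.congr_deriv ?_
  ring

theorem hasDerivAt_exp_half (c x : ℝ) :
    HasDerivAt (fun x : ℝ => (Real.exp (-(c * x / 2)) : ℂ)) (-(c / 2) * Real.exp (-(c * x / 2))) x := by
  have h1 : HasDerivAt (fun x : ℝ => -(c * x / 2)) (-(c / 2)) x := by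
    have := (((hasDerivAt_id x).const_mul c).div_const 2).neg
    refine this.congr_deriv ?_
    ring
  refine h1.exp.ofReal_comp.congr_deriv ?_
  push_cast; ring

theorem differentiableAt_level (g : AxB n) : DifferentiableAt ℝ level g :=
  contDiff_level.differentiable (by simp) g

theorem differentiableAt_exp_half (c : ℝ) (g : AxB n) :
    DifferentiableAt ℝ (fun g : AxB n => (Real.exp (-(c * g.1 / 2)) : ℂ)) g :=
  DifferentiableAt.comp (f := fun g : AxB n => g.1) g
    (hasDerivAt_exp_half c g.1).differentiableAt differentiableAt_fst

theorem differentiableAt_comp_level {w : ℝ → ℂ} {g : AxB n} {w' : ℂ}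
    (hw : HasDerivAt w w' (level g)) : DifferentiableAt ℝ (fun g : AxB n => w (level g)) g :=
  DifferentiableAt.comp (f := level) g hw.differentiableAt (differentiableAt_level g)

theorem differentiableAt_levelX (g : AxB n) :
    DifferentiableAt ℝ (fun g : AxB n => (levelX g : ℂ)) g := by
  have h : Differentiable ℝ (levelX (n := n)) := by
    have e : levelX (n := n) = fun g => Real.exp g.1 - level g := by
      funext g; rw [← level_add_levelX]; ring
    rw [e]
    intro g
    exact ((Real.differentiable_exp _).comp g differentiableAt_fst).sub (differentiableAt_level g)
  exact (Complex.ofRealCLM.differentiable _).comp g (h g)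

/-- The distinguished Laplacian of `e^{-n x / 2} w(ch R)`. -/
theorem lap_exp_mul_comp_level {w w₁ w₂ : ℝ → ℂ} (h1 : ∀ s, 1 ≤ s → HasDerivAt w (w₁ s) s)
    (h2 : ∀ s, 1 ≤ s → HasDerivAt w₁ (w₂ s) s) (g : AxB n) :
    lap (fun g : AxB n => (Real.exp (-(n * g.1 / 2)) : ℂ) * w (level g)) g
      = -((Real.exp (-(n * g.1 / 2)) : ℂ) * (((level g : ℂ) ^ 2 - 1) * w₂ (level g)
        + (n + 1) * level g * w₁ (level g) + (n : ℂ) ^ 2 / 4 * w (level g))) := by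
  have hX1 : X (fun g : AxB n => (Real.exp (-(n * g.1 / 2)) : ℂ) * w (level g))
      = fun g : AxB n => (Real.exp (-(n * g.1 / 2)) : ℂ) *
        (-(n / 2) * w (level g) + levelX g * w₁ (level g)) := by
    funext g
    refine X_eq_of_hasDerivAt ((differentiableAt_exp_half n g).mul
      (differentiableAt_comp_level (h1 _ (one_le_level g)))) ?_
    refine ((hasDerivAt_exp_half n g.1).mul
      ((h1 _ (one_le_level g)).scomp g.1 (hasDerivAt_level_fst g.1 g.2))).congr_deriv ?_
    simp only [Function.comp_apply, Complex.real_smul, Prod.mk.eta]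
    push_cast
    ring
  have hX2 : X (X (fun g : AxB n => (Real.exp (-(n * g.1 / 2)) : ℂ) * w (level g))) g
      = (Real.exp (-(n * g.1 / 2)) : ℂ) * ((n : ℂ) ^ 2 / 4 * w (level g)
        - n * levelX g * w₁ (level g) + (levelX g) ^ 2 * w₂ (level g)
        + level g * w₁ (level g)) := by
    rw [hX1]
    refine X_eq_of_hasDerivAt ((differentiableAt_exp_half n g).mul
      (((differentiableAt_comp_level (h1 _ (one_le_level g))).const_mul _).add
        ((differentiableAt_levelX g).mul (differentiableAt_comp_level (h2 _ (one_le_level g)))))) ?_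
    refine ((hasDerivAt_exp_half n g.1).mul
      ((((h1 _ (one_le_level g)).scomp g.1 (hasDerivAt_level_fst g.1 g.2)).const_mul
        (-((n : ℂ) / 2))).add
      ((hasDerivAt_levelX_fst g.1 g.2).ofReal_comp.mul
        ((h2 _ (one_le_level g)).scomp g.1 (hasDerivAt_level_fst g.1 g.2))))).congr_deriv ?_
    simp only [Function.comp_apply, Complex.real_smul, Prod.mk.eta, Pi.add_apply, Pi.mul_apply]
    push_cast
    ring
  have hY1 : ∀ j, Y j (fun g : AxB n => (Real.exp (-(n * g.1 / 2)) : ℂ) * w (level g))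
      = fun g : AxB n => (Real.exp (-(n * g.1 / 2)) : ℂ) * ((g.2 j : ℂ) * w₁ (level g)) := by
    intro j
    funext g
    have e0 : Real.exp g.1 * Real.exp (-g.1) = 1 := by rw [← Real.exp_add]; simp
    have e1 : (Real.exp g.1 : ℂ) * (Real.exp (-g.1) : ℂ) = 1 := by exact_mod_cast e0
    have h0 : level ((g.1, g.2 + (0 : ℝ) • EuclideanSpace.single j (1 : ℝ)) : AxB n) = level g := by
      simp
    have h1' := (h0.symm ▸ h1 _ (one_le_level g) :
      HasDerivAt w (w₁ (level g)) (level ((g.1, g.2 + (0 : ℝ) • EuclideanSpace.single j (1 : ℝ)) : AxB n)))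
    refine (Y_eq_of_hasDerivAt ((differentiableAt_exp_half n g).mul
      (differentiableAt_comp_level (h1 _ (one_le_level g))))
      ((h1'.scomp 0 (hasDerivAt_level_snd g.1 g.2 j)).const_mul
        (Real.exp (-(n * g.1 / 2)) : ℂ))).trans ?_
    rw [Complex.real_smul]
    push_cast at e1 ⊢
    linear_combination (Complex.exp (-(n * g.1 / 2)) * (g.2 j * w₁ (level g))) * e1
  have hY2 : ∀ j, Y j (Y j (fun g : AxB n => (Real.exp (-(n * g.1 / 2)) : ℂ) * w (level g))) g
      = (Real.exp (-(n * g.1 / 2)) : ℂ) * (((g.2 j ^ 2 : ℝ) : ℂ) * w₂ (level g)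
        + (Real.exp g.1 : ℂ) * w₁ (level g)) := by
    intro j
    rw [hY1 j]
    have e0 : Real.exp g.1 * Real.exp (-g.1) = 1 := by rw [← Real.exp_add]; simp
    have e1 : (Real.exp g.1 : ℂ) * (Real.exp (-g.1) : ℂ) = 1 := by exact_mod_cast e0
    have h0 : level ((g.1, g.2 + (0 : ℝ) • EuclideanSpace.single j (1 : ℝ)) : AxB n) = level g := by
      simp
    have h2' := (h0.symm ▸ h2 _ (one_le_level g) :
      HasDerivAt w₁ (w₂ (level g)) (level ((g.1, g.2 + (0 : ℝ) • EuclideanSpace.single j (1 : ℝ)) : AxB n)))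
    have hd : Differentiable ℝ (fun g : AxB n => (g.2 j : ℂ)) := by
      have : Differentiable ℝ (fun g : AxB n => g.2 j) := by fun_prop
      exact Complex.ofRealCLM.differentiable.comp this
    have hj : HasDerivAt (fun t : ℝ => ((g.2 + t • EuclideanSpace.single j (1 : ℝ)) j : ℂ)) 1 0 := by
      have : (fun t : ℝ => ((g.2 + t • EuclideanSpace.single j (1 : ℝ)) j : ℂ))
          = fun t : ℝ => (g.2 j : ℂ) + (t : ℂ) := by
        funext t; simp
      rw [this]
      exact (hasDerivAt_ofReal 0).const_add _
    refine (Y_eq_of_hasDerivAt ((differentiableAt_exp_half n g).mul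
      ((hd g).mul (differentiableAt_comp_level (h2 _ (one_le_level g)))))
      ((hj.mul (h2'.scomp 0 (hasDerivAt_level_snd g.1 g.2 j))).const_mul
        (Real.exp (-(n * g.1 / 2)) : ℂ))).trans ?_
    simp only [Function.comp_apply, Complex.real_smul, zero_smul, add_zero, Prod.mk.eta]
    push_cast at e1 ⊢
    linear_combination (Complex.exp (-(n * g.1 / 2)) * (g.2 j ^ 2 * w₂ (level g))) * e1
  rw [lap, hX2]
  simp only [hY2]
  rw [← Finset.mul_sum, Finset.sum_add_distrib, ← Finset.sum_mul, ← Complex.ofReal_sum,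
    ← EuclideanSpace.real_norm_sq_eq, Finset.sum_const, Finset.card_univ, Fintype.card_fin,
    nsmul_eq_mul]
  -- The coefficient of `w₂` is the squared gradient of the level. That of `w₁` is `level - n levelX
  -- + n eˣ`, which is `(n + 1) level` because `eˣ = level + levelX`; the factor `e^{-nx/2}` is what
  -- supplies the term `-n levelX`.
  have e1 : ((levelX g : ℂ)) ^ 2 + ((‖g.2‖ ^ 2 : ℝ) : ℂ) = (level g : ℂ) ^ 2 - 1 := by
    exact_mod_cast levelX_sq_add g
  have e2 : (level g : ℂ) + (levelX g : ℂ) = (Real.exp g.1 : ℂ) := by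
    exact_mod_cast level_add_levelX g
  rw [← e2]
  linear_combination (-(Real.exp (-(n * g.1 / 2)) : ℂ) * w₂ (level g)) * e1

end Radial

/-! ### The kernel as a Weyl integral, independence of `l`, pointwise bound -/

section Kernel

variable {n : ℕ}

theorem cosh_sub_image {R : ℝ} (hR : 0 ≤ R) :
    (fun v => Real.cosh v - Real.cosh R) '' Ioi R = Ioi 0 := by
  ext τ
  constructor
  · rintro ⟨v, hv, rfl⟩
    have hv : R < v := hv
    exact sub_pos.2 (Real.cosh_strictMonoOn hR (hR.trans hv.le) hv)
  · intro hτ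
    have hτ : 0 < τ := hτ
    have h1 := Real.one_le_cosh R
    refine ⟨Real.arcosh (Real.cosh R + τ), ?_, ?_⟩
    · have h2 : Real.arcosh (Real.cosh R) < Real.arcosh (Real.cosh R + τ) :=
        (Real.arcosh_lt_arcosh (by linarith) (by linarith)).2 (by linarith)
      rwa [Real.arcosh_cosh hR] at h2
    · simp only
      rw [Real.cosh_arcosh (by linarith)]; ring

theorem cosh_sub_injOn {R : ℝ} (hR : 0 ≤ R) :
    InjOn (fun v => Real.cosh v - Real.cosh R) (Ioi R) := fun v hv w hw h => by
  have hv : R < v := hv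
  have hw : R < w := hw
  exact Real.cosh_strictMonoOn.injOn (show v ∈ Ici 0 from hR.trans hv.le)
    (show w ∈ Ici 0 from hR.trans hw.le) (sub_left_inj.1 h)

theorem hasDerivAt_cosh_sub (R v : ℝ) :
    HasDerivAt (fun v => Real.cosh v - Real.cosh R) (Real.sinh v) v :=
  (Real.hasDerivAt_cosh v).sub_const _

theorem abs_sinh_smul_eq_integrand (ν : ℂ) (l : ℕ) {R : ℝ} (hR : 0 ≤ R) :
    EqOn (fun v => |Real.sinh v| • (weylSeq ν l (Real.cosh R + (Real.cosh v - Real.cosh R)) *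
      (((Real.cosh v - Real.cosh R) ^ (-(n : ℝ) / 2 + l) : ℝ) : ℂ))) (integrand n ν l R) (Ioi R) := by
  intro v hv
  have hv : 0 < v := hR.trans_lt hv
  have h1 := iterate_Dsh ν l v hv
  simp only [integrand]
  rw [h1, abs_of_pos (Real.sinh_pos_iff.2 hv), add_sub_cancel, Complex.real_smul]
  ring

theorem integrableOn_integrand {ν : ℂ} (hν : ν.re ≤ 0) (hn : 1 ≤ n) {l : ℕ}
    (hl : -1 < -(n : ℝ) / 2 + l) {R : ℝ} (hR : 0 < R) :
    IntegrableOn (integrand n ν l R) (Ioi R) := by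
  have hn' : (1 : ℝ) ≤ n := by exact_mod_cast hn
  have h := integrableOn_weyl (m := l) hν hl (by linarith) (Real.one_lt_cosh.2 hR.ne')
  rw [← cosh_sub_image hR.le, integrableOn_image_iff_integrableOn_abs_deriv_smul measurableSet_Ioi
    (fun v _ => (hasDerivAt_cosh_sub R v).hasDerivWithinAt) (cosh_sub_injOn hR.le)] at h
  exact h.congr_fun (abs_sinh_smul_eq_integrand ν l hR.le) measurableSet_Ioi

/-- The substitution is `τ = ch v - ch R`; its Jacobian `sh v` is the factor that `iterate_Dsh`
pulls out of `D_sh^l e^{νv}`. -/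
theorem integral_integrand (ν : ℂ) (l : ℕ) {R : ℝ} (hR : 0 ≤ R) :
    ∫ v in Ioi R, integrand n ν l R v = weyl ν l (-(n : ℝ) / 2 + l) (Real.cosh R) := by
  rw [weyl, ← cosh_sub_image hR, integral_image_eq_integral_abs_deriv_smul measurableSet_Ioi
    (fun v _ => (hasDerivAt_cosh_sub R v).hasDerivWithinAt) (cosh_sub_injOn hR)]
  exact (setIntegral_congr_fun measurableSet_Ioi (abs_sinh_smul_eq_integrand ν l hR)).symm

variable (n) in
/-- The numerical constant in front of the kernel. -/
def kernelConst (l : ℕ) : ℝ :=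
  (-1) ^ l * ((2 : ℝ) ^ (-1 - (n : ℝ) / 2) * Real.pi ^ (-(n : ℝ) / 2)
      / Real.Gamma (1 - (n : ℝ) / 2 + l))

theorem kernel_eq (ν : ℂ) (l : ℕ) (g : AxB n) :
    kernel ν l g = (Real.exp (-(n * g.1 / 2)) : ℂ) *
      (kernelConst n l * weyl ν l (-(n : ℝ) / 2 + l) (level g)) := by
  rw [kernel, integral_integrand ν l (radius_nonneg g), cosh_radius, kernelConst,
    show -(n : ℝ) * g.1 / 2 = -(n * g.1 / 2) by ring]
  push_cast
  ring

/-- The factor `-(a + 1)` of the integration by parts is cancelled by the sign `(-1)^l` and by the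
functional equation of the Gamma function in the denominator. -/
theorem kernel_succ {ν : ℂ} (hν : ν.re ≤ 0) (hn : 1 ≤ n) {l : ℕ} (hl : -1 < -(n : ℝ) / 2 + l)
    {g : AxB n} (hg : g ≠ 1) : kernel ν (l + 1) g = kernel ν l g := by
  have hn' : (1 : ℝ) ≤ n := by exact_mod_cast hn
  have h := weyl_succ_succ (m := l) hν hl (by linarith) (one_lt_level hg)
  have hΓ : Real.Gamma (1 - (n : ℝ) / 2 + (l + 1 : ℕ))
      = (1 - (n : ℝ) / 2 + l) * Real.Gamma (1 - (n : ℝ) / 2 + l) := by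
    rw [← Real.Gamma_add_one (by linarith)]; congr 1; push_cast; ring
  have hΓ0 : (Real.Gamma (1 - (n : ℝ) / 2 + l) : ℂ) ≠ 0 := by
    have := (Real.Gamma_pos_of_pos (by linarith : 0 < 1 - (n : ℝ) / 2 + l)).ne'
    exact_mod_cast this
  have h0 : ((1 - (n : ℝ) / 2 + l : ℝ) : ℂ) ≠ 0 := by
    have : 1 - (n : ℝ) / 2 + l ≠ 0 := by linarith
    exact_mod_cast this
  have h1 : -((-(n : ℝ) / 2 + l : ℝ) + 1 : ℂ) = -((1 - (n : ℝ) / 2 + l : ℝ) : ℂ) := by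
    push_cast; ring
  rw [kernel_eq, kernel_eq, show -(n : ℝ) / 2 + (l + 1 : ℕ) = -(n : ℝ) / 2 + l + 1 by push_cast; ring,
    h, kernelConst, kernelConst, hΓ, h1]
  generalize Real.Gamma (1 - (n : ℝ) / 2 + l) = G at *
  generalize 1 - (n : ℝ) / 2 + l = b at *
  rw [Complex.ofReal_mul, Complex.ofReal_mul, Complex.ofReal_div, Complex.ofReal_div,
    Complex.ofReal_mul b]
  field_simp
  push_cast
  ring

theorem neg_half_add_div_two (n : ℕ) :
    -1 < -(n : ℝ) / 2 + (n / 2 : ℕ) ∧ -(n : ℝ) / 2 + (n / 2 : ℕ) ≤ 0 := by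
  have h1 : n < 2 * (n / 2) + 2 := by omega
  have h2 : 2 * (n / 2) ≤ n := by omega
  have h1' : (n : ℝ) < 2 * ((n / 2 : ℕ) : ℝ) + 2 := by exact_mod_cast h1
  have h2' : 2 * ((n / 2 : ℕ) : ℝ) ≤ n := by exact_mod_cast h2
  constructor <;> linarith

/-- The integer `⌊n/2⌋` is the least admissible `l`. Passing to it makes the constants independent
of `l` and keeps the power of `1 + ‖ν‖` at most `n/2`. -/
theorem kernel_eq_kernel_div_two {ν : ℂ} (hν : ν.re ≤ 0) (hn : 1 ≤ n) {l : ℕ}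
    (hl : -1 < -(n : ℝ) / 2 + l) {g : AxB n} (hg : g ≠ 1) :
    kernel ν l g = kernel ν (n / 2) g := by
  have hle : n / 2 ≤ l := by
    have : (n : ℝ) < 2 * l + 2 := by linarith
    have : n < 2 * l + 2 := by exact_mod_cast this
    omega
  induction l, hle using Nat.le_induction with
  | base => rfl
  | succ l hle ih =>
    have h1 := (neg_half_add_div_two n).1
    have h2 : ((n / 2 : ℕ) : ℝ) ≤ l := by exact_mod_cast hle
    rw [kernel_succ hν hn (by linarith) hg, ih (by linarith)]

/-- The distance to the identity is invariant under inversion, and `e^{-nx/2}` is a square root of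
the modular function. This symmetry rewrites right convolution with `k` as an average of right
translates. -/
theorem kernel_inv (ν : ℂ) (l : ℕ) (g : AxB n) :
    (Real.exp (-(n * g.1)) : ℂ) * kernel ν l g⁻¹ = kernel ν l g := by
  rw [kernel_eq, kernel_eq, level_inv, inv_fst, ← mul_assoc, ← Complex.ofReal_mul, ← Real.exp_add]
  congr 4
  ring

theorem continuousOn_kernel {ν : ℂ} (hν : ν.re ≤ 0) (hn : 1 ≤ n) {l : ℕ}
    (hl : -1 < -(n : ℝ) / 2 + l) : ContinuousOn (kernel (n := n) ν l) {g | g ≠ 1} := by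
  have hn' : (1 : ℝ) ≤ n := by exact_mod_cast hn
  have h1 : ContinuousOn (fun g : AxB n => weyl ν l (-(n : ℝ) / 2 + l) (level g)) {g | g ≠ 1} := by
    refine ContinuousOn.comp (g := weyl ν l (-(n : ℝ) / 2 + l)) (t := Ioi 1) ?_ continuous_level.continuousOn fun g hg => one_lt_level hg
    exact fun s hs => (hasDerivAt_weyl (m := l) hν hl (by linarith) hs).continuousAt.continuousWithinAt
  have h2 : Continuous (fun g : AxB n => (Real.exp (-(n * g.1 / 2)) : ℂ)) := by fun_prop
  refine (h2.continuousOn.mul (h1.const_mul _)).congr fun g _ => kernel_eq ν l g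

theorem aestronglyMeasurable_kernel {ν : ℂ} (hν : ν.re ≤ 0) (hn : 1 ≤ n) {l : ℕ}
    (hl : -1 < -(n : ℝ) / 2 + l) : AEStronglyMeasurable (kernel (n := n) ν l) := by
  have h := (continuousOn_kernel hν hn hl).aestronglyMeasurable (μ := volume)
    (isOpen_ne.measurableSet)
  have e : (volume : Measure (AxB n)).restrict {g | g ≠ 1} = volume :=
    Measure.restrict_eq_self_of_ae_mem ae_ne_one
  rwa [e] at h

-- This is `norm_weyl_le` at `l = ⌊n/2⌋` with `θ = 1/4`. A positive `θ` is required when `n = 1`: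
-- there `l = 0`, `a = -1/2`, and the condition `a + 1/2 < l + θ` fails for `θ = 0`.
variable (n) in
theorem norm_kernel_le (hn : 1 ≤ n) : ∃ C : ℝ, 0 ≤ C ∧ ∀ ν : ℂ, ν.re ≤ 0 → ∀ g : AxB n, g ≠ 1 →
    ‖kernel ν (n / 2) g‖ ≤ C * (1 + ‖ν‖) ^ ((n : ℝ) / 2) * (Real.exp (-(n * g.1 / 2)) *
      (Real.exp (ν.re * radius g) * (Real.cosh (radius g) ^ (-(1 / 4) : ℝ) *
        (Real.cosh (radius g) - 1) ^ (1 / 4 - (n : ℝ) / 2)))) := by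
  have hn' : (1 : ℝ) ≤ n := by exact_mod_cast hn
  obtain ⟨ha, ha'⟩ := neg_half_add_div_two n
  obtain ⟨C, hC, h⟩ := norm_weyl_le (n / 2) ha (θ := 1 / 4) (by norm_num) (by norm_num)
    (by linarith)
  refine ⟨|kernelConst n (n / 2)| * C, by positivity, fun ν hν g hg => ?_⟩
  have h1 := h ν hν _ (one_lt_level hg)
  rw [← radius_eq, show -(n : ℝ) / 2 + (n / 2 : ℕ) + 1 / 2 - (n / 2 : ℕ) - 1 / 4
    = 1 / 4 - (n : ℝ) / 2 by ring, show (-(1 / 2) + 1 / 4 : ℝ) = -(1 / 4) by norm_num] at h1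
  rw [kernel_eq, norm_mul, norm_mul, Complex.norm_real, Complex.norm_real, Real.norm_eq_abs,
    Real.norm_eq_abs, Real.abs_exp, cosh_radius]
  have h2 : (1 + ‖ν‖) ^ (n / 2 : ℕ) ≤ (1 + ‖ν‖) ^ ((n : ℝ) / 2) := by
    rw [← Real.rpow_natCast]
    exact Real.rpow_le_rpow_of_exponent_le (by linarith [norm_nonneg ν]) (by linarith)
  have h3 : 0 ≤ Real.exp (ν.re * radius g) * (level g ^ (-(1 / 4) : ℝ) *
      (level g - 1) ^ (1 / 4 - (n : ℝ) / 2)) := by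
    have := one_lt_level hg
    have : 0 ≤ level g - 1 := by linarith
    have : 0 ≤ level g := by linarith
    positivity
  calc _ ≤ Real.exp (-(n * g.1 / 2)) * (|kernelConst n (n / 2)| * (C * (1 + ‖ν‖) ^ ((n : ℝ) / 2) *
        Real.exp (ν.re * radius g) * (level g ^ (-(1 / 4) : ℝ) *
        (level g - 1) ^ (1 / 4 - (n : ℝ) / 2)))) := by
        refine mul_le_mul_of_nonneg_left (mul_le_mul_of_nonneg_left (h1.trans ?_) (abs_nonneg _))
          (Real.exp_nonneg _)
        rw [mul_assoc _ (Real.exp _), mul_assoc _ (Real.exp _)]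
        exact mul_le_mul_of_nonneg_right (mul_le_mul_of_nonneg_left h2 hC) h3
    _ = _ := by ring

end Kernel

/-! ### Integration of radial functions against `e^{-nx/2}` -/

section Polar

variable {n : ℕ}

theorem lintegral_fun_norm (hn : 1 ≤ n) (f : ℝ → ENNReal) (hf : Measurable f) :
    ∫⁻ z : EuclideanSpace ℝ (Fin n), f ‖z‖ =
      (volume : Measure (EuclideanSpace ℝ (Fin n))).toSphere univ *
        ∫⁻ r in Ioi (0 : ℝ), ENNReal.ofReal (r ^ (n - 1)) * f r := by
  have : Nonempty (Fin n) := ⟨⟨0, hn⟩⟩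
  set μ : Measure (EuclideanSpace ℝ (Fin n)) := volume
  have h1 : ∫⁻ z, f ‖z‖ ∂μ = ∫⁻ z : ({(0)}ᶜ : Set (EuclideanSpace ℝ (Fin n))), f ‖z.1‖
      ∂(μ.comap (↑)) := by
    rw [lintegral_subtype_comap (measurableSet_singleton _).compl fun x => f ‖x‖,
      restrict_compl_singleton]
  have h2 : ∫⁻ z : ({(0)}ᶜ : Set (EuclideanSpace ℝ (Fin n))), f ‖z.1‖ ∂(μ.comap (↑))
      = ∫⁻ p, f p.2 ∂μ.toSphere.prod (.volumeIoiPow (n - 1)) := by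
    have := μ.measurePreserving_homeomorphUnitSphereProd.lintegral_comp_emb
      (Homeomorph.measurableEmbedding _) (f ∘ Subtype.val ∘ Prod.snd)
    rw [finrank_euclideanSpace_fin] at this
    simpa using this
  have hfs : Measurable fun x : Ioi (0 : ℝ) => f x := hf.comp measurable_subtype_coe
  rw [h1, h2, lintegral_prod (fun p : Metric.sphere (0 : EuclideanSpace ℝ (Fin n)) 1 × Ioi (0 : ℝ) =>
      f p.2) (hfs.comp measurable_snd).aemeasurable]
  simp only [lintegral_const]
  rw [mul_comm, Measure.volumeIoiPow, lintegral_withDensity_eq_lintegral_mul _ (by fun_prop) hfs]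
  congr 1
  exact lintegral_subtype_comap measurableSet_Ioi fun r => ENNReal.ofReal (r ^ (n - 1)) * f r

theorem polar_image {x : ℝ} :
    (fun v => √(2 * (Real.cosh v - Real.cosh x))) '' Ioi |x| = Ioi 0 := by
  have h := cosh_sub_image (abs_nonneg x)
  rw [Real.cosh_abs] at h
  have h2 : (fun v => √(2 * (Real.cosh v - Real.cosh x)))
      = (fun τ => √(2 * τ)) ∘ fun v => Real.cosh v - Real.cosh x := rfl
  rw [h2, image_comp, h]
  ext r
  constructor
  · rintro ⟨τ, hτ, rfl⟩
    have hτ : 0 < τ := hτ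
    exact Real.sqrt_pos.2 (by positivity)
  · intro hr
    have hr : 0 < r := hr
    refine ⟨r ^ 2 / 2, show 0 < r ^ 2 / 2 by positivity, ?_⟩
    simp only
    rw [mul_div_cancel₀ _ two_ne_zero, Real.sqrt_sq hr.le]

theorem cosh_sub_cosh_pos {x v : ℝ} (hv : |x| < v) : 0 < Real.cosh v - Real.cosh x := by
  rw [← Real.cosh_abs x]
  exact sub_pos.2 (Real.cosh_strictMonoOn (show |x| ∈ Ici 0 from abs_nonneg x)
    (show v ∈ Ici 0 from (abs_nonneg x).trans hv.le) hv)

/-- The substitution `r = √(2 (ch v - ch x))` makes `v` the distance to the identity on the fibre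
over `x`, and `r^{n-1} dr` becomes `sh v (2 (ch v - ch x))^{n/2-1} dv`. -/
theorem lintegral_Ioi_polar (hn : 1 ≤ n) (x : ℝ) (F : ℝ → ENNReal) :
    ∫⁻ r in Ioi (0 : ℝ), ENNReal.ofReal (r ^ (n - 1)) * F (Real.arcosh (Real.cosh x + 1 / 2 * r ^ 2))
      = ∫⁻ v in Ioi |x|, ENNReal.ofReal (Real.sinh v *
        (2 * (Real.cosh v - Real.cosh x)) ^ ((n : ℝ) / 2 - 1)) * F v := by
  have hpos : ∀ v ∈ Ioi |x|, 0 < 2 * (Real.cosh v - Real.cosh x) := fun v hv => by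
    have := cosh_sub_cosh_pos hv
    linarith
  have hd : ∀ v ∈ Ioi |x|, HasDerivWithinAt (fun v => √(2 * (Real.cosh v - Real.cosh x)))
      (Real.sinh v / √(2 * (Real.cosh v - Real.cosh x))) (Ioi |x|) v := fun v hv => by
    have h := ((hasDerivAt_cosh_sub x v).const_mul 2).sqrt (hpos v hv).ne'
    rw [mul_div_mul_left _ _ two_ne_zero] at h
    exact h.hasDerivWithinAt
  have hinj : InjOn (fun v => √(2 * (Real.cosh v - Real.cosh x))) (Ioi |x|) := fun v hv w hw h => by
    have h1 := (Real.sqrt_inj (hpos v hv).le (hpos w hw).le).1 h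
    have h2 := cosh_sub_injOn (abs_nonneg x) hv hw
    rw [Real.cosh_abs] at h2
    exact h2 (by simpa using h1)
  rw [← polar_image (x := x), lintegral_image_eq_lintegral_abs_deriv_mul measurableSet_Ioi hd hinj]
  refine setLIntegral_congr_fun measurableSet_Ioi fun v hv => ?_
  have hp := hpos v hv
  have hs : 0 < √(2 * (Real.cosh v - Real.cosh x)) := Real.sqrt_pos.2 hp
  have hv0 : 0 < v := (abs_nonneg x).trans_lt hv
  have hsh : 0 < Real.sinh v := Real.sinh_pos_iff.2 hv0
  rw [Real.sq_sqrt hp.le, show Real.cosh x + 1 / 2 * (2 * (Real.cosh v - Real.cosh x)) = Real.cosh v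
    by ring, Real.arcosh_cosh hv0.le, ← mul_assoc, ← ENNReal.ofReal_mul (abs_nonneg _),
    abs_of_pos (by positivity)]
  congr 2
  have e : (2 * (Real.cosh v - Real.cosh x)) ^ ((n : ℝ) / 2 - 1)
      = √(2 * (Real.cosh v - Real.cosh x)) ^ (n - 1) / √(2 * (Real.cosh v - Real.cosh x)) := by
    rw [← Real.rpow_natCast, ← Real.rpow_sub_one hs.ne', Real.sqrt_eq_rpow, ← Real.rpow_mul hp.le]
    congr 1
    push_cast [Nat.cast_sub hn]
    ring
  rw [e]
  ring

/-- Convexity of `exp` on `[0, v]` and on `[-v, 0]` bounds `ch x` by the chord of `ch` between `0`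
and `v`. -/
theorem cosh_sub_one_mul_le {x v : ℝ} (hv : |x| < v) :
    (Real.cosh v - 1) * (1 - |x| / v) ≤ Real.cosh v - Real.cosh x := by
  have hv0 : 0 < v := (abs_nonneg x).trans_lt hv
  have h0 : |x| / v ≤ 1 := by rw [div_le_one hv0]; exact hv.le
  have h1 := convexOn_exp.2 (mem_univ 0) (mem_univ v) (show 0 ≤ 1 - |x| / v by linarith)
    (show 0 ≤ |x| / v by positivity) (by ring)
  have h2 := convexOn_exp.2 (mem_univ 0) (mem_univ (-v)) (show 0 ≤ 1 - |x| / v by linarith)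
    (show 0 ≤ |x| / v by positivity) (by ring)
  simp only [smul_eq_mul, mul_zero, zero_add, Real.exp_zero, mul_one, mul_neg] at h1 h2
  rw [div_mul_cancel₀ _ hv0.ne'] at h1 h2
  rw [← Real.cosh_abs x, Real.cosh_eq, Real.cosh_eq]
  linarith

/-- If `n ≥ 2` the exponent is nonnegative and `ch x ≥ 1` suffices. If `n = 1` the exponent is
`-1/2`, and the chord bound leaves a factor `(1 - |x|/v)^{-1/2}`. That factor is kept in both cases,
since its integral over `|x| < v` is just a multiple of `v`. -/
theorem cosh_sub_rpow_le (hn : 1 ≤ n) {x v : ℝ} (hv : |x| < v) :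
    (Real.cosh v - Real.cosh x) ^ ((n : ℝ) / 2 - 1)
      ≤ (Real.cosh v - 1) ^ ((n : ℝ) / 2 - 1) * (1 - |x| / v) ^ (-(1 / 2) : ℝ) := by
  have hn' : (1 : ℝ) ≤ n := by exact_mod_cast hn
  have hv0 : 0 < v := (abs_nonneg x).trans_lt hv
  have h1 := cosh_sub_cosh_pos hv
  have h2 : 0 < 1 - |x| / v := by rw [sub_pos, div_lt_one hv0]; exact hv
  have h3 : 0 < Real.cosh v - 1 := by linarith [Real.one_lt_cosh.2 hv0.ne']
  have h4 : 1 - |x| / v ≤ 1 := by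
    have : 0 ≤ |x| / v := by positivity
    linarith
  rcases le_or_gt 0 ((n : ℝ) / 2 - 1) with h | h
  · calc _ ≤ (Real.cosh v - 1) ^ ((n : ℝ) / 2 - 1) :=
          Real.rpow_le_rpow h1.le (by linarith [Real.one_le_cosh x]) h
      _ ≤ _ := le_mul_of_one_le_right (by positivity)
          (Real.one_le_rpow_of_pos_of_le_one_of_nonpos h2 h4 (by norm_num))
  · calc _ ≤ ((Real.cosh v - 1) * (1 - |x| / v)) ^ ((n : ℝ) / 2 - 1) :=
          Real.rpow_le_rpow_of_nonpos (by positivity) (cosh_sub_one_mul_le hv) h.le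
      _ = (Real.cosh v - 1) ^ ((n : ℝ) / 2 - 1) * (1 - |x| / v) ^ ((n : ℝ) / 2 - 1) :=
          Real.mul_rpow h3.le h2.le
      _ ≤ _ := by
          refine mul_le_mul_of_nonneg_left ?_ (by positivity)
          exact Real.rpow_le_rpow_of_exponent_ge h2 h4 (by linarith)

theorem lintegral_one_sub_abs_lt_top :
    ∫⁻ t in Ioo (-1 : ℝ) 1, ENNReal.ofReal ((1 - |t|) ^ (-(1 / 2) : ℝ)) < ⊤ := by
  have h0 : IntervalIntegrable (fun t : ℝ => t ^ (-(1 / 2) : ℝ)) volume 0 2 :=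
    intervalIntegral.intervalIntegrable_rpow' (by norm_num)
  have h1 : IntervalIntegrable (fun t : ℝ => (1 - t) ^ (-(1 / 2) : ℝ)) volume (-1) 1 := by
    have := (h0.comp_sub_left 1).symm
    norm_num at this
    norm_num
    exact this
  have h2 : IntervalIntegrable (fun t : ℝ => (1 + t) ^ (-(1 / 2) : ℝ)) volume (-1) 1 := by
    have := h0.comp_add_right 1
    norm_num at this
    norm_num
    simpa only [add_comm (1 : ℝ)] using this
  have h3 := (intervalIntegrable_iff_integrableOn_Ioo_of_le (by norm_num)).1 (h1.add h2)
  refine (lintegral_mono_ae ?_).trans_lt h3.lintegral_lt_top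
  refine (ae_restrict_iff' measurableSet_Ioo).2 (.of_forall fun t ht => ?_)
  apply ENNReal.ofReal_le_ofReal
  have ht1 : 0 < 1 - t := by linarith [ht.2]
  have ht2 : 0 < 1 + t := by linarith [ht.1]
  rcases abs_cases t with ⟨h, -⟩ | ⟨h, -⟩
  · rw [h]
    exact le_add_of_nonneg_right (by positivity)
  · rw [h, sub_neg_eq_add]
    exact le_add_of_nonneg_left (by positivity)

theorem lintegral_one_sub_abs_div {v : ℝ} (hv : 0 < v) :
    ∫⁻ x in Ioo (-v) v, ENNReal.ofReal ((1 - |x| / v) ^ (-(1 / 2) : ℝ))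
      = ENNReal.ofReal v * ∫⁻ t in Ioo (-1 : ℝ) 1, ENNReal.ofReal ((1 - |t|) ^ (-(1 / 2) : ℝ)) := by
  have him : (fun t => v * t) '' Ioo (-1 : ℝ) 1 = Ioo (-v) v := by
    rw [image_mul_left_Ioo hv]; simp
  rw [← him, lintegral_image_eq_lintegral_abs_deriv_mul measurableSet_Ioo (f' := fun _ => v)
    (fun t _ => by simpa using ((hasDerivAt_id t).const_mul v).hasDerivWithinAt)
    (mul_right_injective₀ hv.ne').injOn, ← lintegral_const_mul _ (by fun_prop)]
  refine lintegral_congr fun t => ?_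
  rw [abs_of_pos hv, abs_mul, abs_of_pos hv, mul_div_cancel_left₀ _ hv.ne']

/-- Scaling `y` by `e^{x/2}` consumes the factor `e^{-nx/2}` and removes `e⁻ˣ` from the level, so
that polar coordinates apply. -/
theorem lintegral_radial_snd (hn : 1 ≤ n) {F : ℝ → ENNReal} (hF : Measurable F) (x : ℝ) :
    ∫⁻ y : EuclideanSpace ℝ (Fin n),
      ENNReal.ofReal (Real.exp (-(n * x / 2))) * F (radius (x, y))
      = (volume : Measure (EuclideanSpace ℝ (Fin n))).toSphere univ *
        ∫⁻ v in Ioi |x|, ENNReal.ofReal (Real.sinh v *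
        (2 * (Real.cosh v - Real.cosh x)) ^ ((n : ℝ) / 2 - 1)) * F v := by
  have hFr : Measurable fun y : EuclideanSpace ℝ (Fin n) => F (radius (x, y)) :=
    (hF.comp continuous_radius.measurable).comp measurable_prodMk_left
  have harc : Measurable Real.arcosh := by unfold Real.arcosh; fun_prop
  rw [← lintegral_Ioi_polar hn x F, ← lintegral_fun_norm hn
    (fun r => F (Real.arcosh (Real.cosh x + 1 / 2 * r ^ 2))) (by fun_prop)]
  have h := lintegral_add_smul (n := n) (Real.exp_pos (x / 2)).ne' 0
    (fun y => F (radius (x, y))) hFr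
  have e : (|Real.exp (x / 2)| ^ n)⁻¹ = Real.exp (-(n * x / 2)) := by
    rw [abs_of_pos (Real.exp_pos _), ← Real.exp_nat_mul, ← Real.exp_neg]
    congr 1; ring
  rw [e] at h
  rw [lintegral_const_mul _ hFr, ← h]
  refine lintegral_congr fun y => ?_
  rw [zero_add, radius_eq, level, norm_smul, Real.norm_eq_abs, Real.abs_exp, mul_pow,
    ← Real.exp_nat_mul]
  congr 3
  have : Real.exp ((2 : ℕ) * (x / 2)) * Real.exp (-x) = 1 := by
    rw [← Real.exp_add, Real.exp_eq_one_iff]; push_cast; ring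
  linear_combination (1 / 2 * ‖y‖ ^ 2) * this

theorem radial_density_le (hn : 1 ≤ n) (x v : ℝ) (F : ℝ → ENNReal) :
    (Ioi |x|).indicator (fun v => ENNReal.ofReal (Real.sinh v *
        (2 * (Real.cosh v - Real.cosh x)) ^ ((n : ℝ) / 2 - 1)) * F v) v
      ≤ (Ioi (0 : ℝ)).indicator (fun v => (ENNReal.ofReal (2 ^ ((n : ℝ) / 2 - 1)) *
        (ENNReal.ofReal (Real.sinh v * (Real.cosh v - 1) ^ ((n : ℝ) / 2 - 1)) * F v)) *
        (Ioo (-v) v).indicator (fun x => ENNReal.ofReal ((1 - |x| / v) ^ (-(1 / 2) : ℝ))) x) v := by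
  by_cases hv : |x| < v
  · have hv0 : 0 < v := (abs_nonneg x).trans_lt hv
    have hc2 : (0 : ℝ) ≤ 2 ^ ((n : ℝ) / 2 - 1) := by positivity
    have hsh : 0 < Real.sinh v := Real.sinh_pos_iff.2 hv0
    have h3 : 0 < Real.cosh v - 1 := by linarith [Real.one_lt_cosh.2 hv0.ne']
    rw [indicator_of_mem (show v ∈ Ioi |x| from hv), indicator_of_mem (show v ∈ Ioi 0 from hv0),
      indicator_of_mem (show x ∈ Ioo (-v) v from abs_lt.1 hv), mul_right_comm, ← mul_assoc,
      mul_right_comm (ENNReal.ofReal _), ← ENNReal.ofReal_mul hc2,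
      ← ENNReal.ofReal_mul (by positivity)]
    refine mul_le_mul' (ENNReal.ofReal_le_ofReal ?_) le_rfl
    rw [Real.mul_rpow zero_le_two (cosh_sub_cosh_pos hv).le]
    calc _ = 2 ^ ((n : ℝ) / 2 - 1) * Real.sinh v *
          (Real.cosh v - Real.cosh x) ^ ((n : ℝ) / 2 - 1) := by ring
      _ ≤ 2 ^ ((n : ℝ) / 2 - 1) * Real.sinh v * ((Real.cosh v - 1) ^ ((n : ℝ) / 2 - 1) *
          (1 - |x| / v) ^ (-(1 / 2) : ℝ)) :=
          mul_le_mul_of_nonneg_left (cosh_sub_rpow_le hn hv) (by positivity)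
      _ = _ := by ring
  · rw [indicator_of_notMem (show v ∉ Ioi |x| from hv)]
    exact zero_le

/-- After exchanging the order of integration, the variable `x` runs over `(-v, v)` and the inner
integral contributes the extra factor `v` of the weight. -/
theorem lintegral_radial_fst_le (hn : 1 ≤ n) {F : ℝ → ENNReal} (hF : Measurable F) :
    ∫⁻ x : ℝ, ∫⁻ v in Ioi |x|, ENNReal.ofReal (Real.sinh v *
        (2 * (Real.cosh v - Real.cosh x)) ^ ((n : ℝ) / 2 - 1)) * F v
      ≤ ENNReal.ofReal (2 ^ ((n : ℝ) / 2 - 1)) *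
        (∫⁻ t in Ioo (-1 : ℝ) 1, ENNReal.ofReal ((1 - |t|) ^ (-(1 / 2) : ℝ))) *
        ∫⁻ v in Ioi (0 : ℝ), ENNReal.ofReal (v * (Real.sinh v *
          (Real.cosh v - 1) ^ ((n : ℝ) / 2 - 1))) * F v := by
  have hcosh := Real.measurable_cosh
  have hsinh := Real.measurable_sinh
  calc _ ≤ ∫⁻ x : ℝ, ∫⁻ v in Ioi (0 : ℝ), (ENNReal.ofReal (2 ^ ((n : ℝ) / 2 - 1)) *
        (ENNReal.ofReal (Real.sinh v * (Real.cosh v - 1) ^ ((n : ℝ) / 2 - 1)) * F v)) *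
        (Ioo (-v) v).indicator (fun x => ENNReal.ofReal ((1 - |x| / v) ^ (-(1 / 2) : ℝ))) x := by
        refine lintegral_mono fun x => ?_
        rw [← lintegral_indicator measurableSet_Ioi, ← lintegral_indicator measurableSet_Ioi]
        exact lintegral_mono fun v => radial_density_le hn x v F
    _ = ∫⁻ v in Ioi (0 : ℝ), ∫⁻ x : ℝ, (ENNReal.ofReal (2 ^ ((n : ℝ) / 2 - 1)) *
        (ENNReal.ofReal (Real.sinh v * (Real.cosh v - 1) ^ ((n : ℝ) / 2 - 1)) * F v)) *
        (Ioo (-v) v).indicator (fun x => ENNReal.ofReal ((1 - |x| / v) ^ (-(1 / 2) : ℝ))) x := by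
        refine lintegral_lintegral_swap (Measurable.aemeasurable ?_)
        refine Measurable.mul (by fun_prop) ?_
        have : MeasurableSet {p : ℝ × ℝ | p.1 ∈ Ioo (-p.2) p.2} :=
          (measurableSet_lt measurable_snd.neg measurable_fst).inter
            (measurableSet_lt measurable_fst measurable_snd)
        exact Measurable.indicator (f := fun p : ℝ × ℝ =>
          ENNReal.ofReal ((1 - |p.1| / p.2) ^ (-(1 / 2) : ℝ))) (by fun_prop) this
    _ = ∫⁻ v in Ioi (0 : ℝ), (ENNReal.ofReal (2 ^ ((n : ℝ) / 2 - 1)) *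
        (∫⁻ t in Ioo (-1 : ℝ) 1, ENNReal.ofReal ((1 - |t|) ^ (-(1 / 2) : ℝ)))) *
        (ENNReal.ofReal (v * (Real.sinh v * (Real.cosh v - 1) ^ ((n : ℝ) / 2 - 1))) * F v) := by
        refine setLIntegral_congr_fun measurableSet_Ioi fun v hv => ?_
        have hv : 0 < v := hv
        rw [lintegral_const_mul _ (Measurable.indicator (by fun_prop) measurableSet_Ioo),
          lintegral_indicator measurableSet_Ioo, lintegral_one_sub_abs_div hv,
          ENNReal.ofReal_mul hv.le]
        ring
    _ = _ := lintegral_const_mul' _ _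
        (ENNReal.mul_ne_top ENNReal.ofReal_ne_top lintegral_one_sub_abs_lt_top.ne)

variable (n) in
/-- Integration of radial functions against `e^{-n x / 2}`, as an upper bound. -/
theorem lintegral_radial_le (hn : 1 ≤ n) : ∃ C : ENNReal, C ≠ ⊤ ∧ ∀ F : ℝ → ENNReal, Measurable F →
    ∫⁻ g : AxB n, ENNReal.ofReal (Real.exp (-(n * g.1 / 2))) * F (radius g)
      ≤ C * ∫⁻ v in Ioi (0 : ℝ), ENNReal.ofReal (v * (Real.sinh v *
        (Real.cosh v - 1) ^ ((n : ℝ) / 2 - 1))) * F v := by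
  refine ⟨_, ENNReal.mul_ne_top (measure_ne_top
    (volume : Measure (EuclideanSpace ℝ (Fin n))).toSphere univ)
    (ENNReal.mul_ne_top (ENNReal.ofReal_ne_top (r := 2 ^ ((n : ℝ) / 2 - 1)))
      lintegral_one_sub_abs_lt_top.ne), fun F hF => ?_⟩
  have hFr : Measurable fun g : AxB n => F (radius g) := hF.comp continuous_radius.measurable
  rw [Measure.volume_eq_prod, lintegral_prod (fun g : AxB n =>
    ENNReal.ofReal (Real.exp (-(n * g.1 / 2))) * F (radius g)) ((Measurable.ennreal_ofReal (by fun_prop)).mul hFr).aemeasurable]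
  simp only [lintegral_radial_snd hn hF]
  rw [lintegral_const_mul' _ _ (measure_ne_top _ _), mul_assoc]
  exact mul_le_mul' le_rfl (lintegral_radial_fst_le hn hF)

/-- The powers depending on `n` cancel, leaving `v sh v (ch v - 1)^{-3/4} (ch v)^{-1/4}`. This is
bounded near `0` because `ch v - 1 ≥ v²/2`, and grows like `v` at infinity. -/
theorem radial_weight_le {v : ℝ} (hv : 0 < v) :
    v * (Real.sinh v * (Real.cosh v - 1) ^ ((n : ℝ) / 2 - 1)) * (Real.cosh v ^ (-(1 / 4) : ℝ) *
      (Real.cosh v - 1) ^ (1 / 4 - (n : ℝ) / 2)) ≤ 2 * (1 + v) := by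
  have hσ : 0 < Real.cosh v - 1 := by linarith [Real.one_lt_cosh.2 hv.ne']
  have hc : 0 < Real.cosh v := Real.cosh_pos v
  have hsh : 0 < Real.sinh v := Real.sinh_pos_iff.2 hv
  have e1 : v * (Real.sinh v * (Real.cosh v - 1) ^ ((n : ℝ) / 2 - 1)) * (Real.cosh v ^ (-(1 / 4) : ℝ) *
      (Real.cosh v - 1) ^ (1 / 4 - (n : ℝ) / 2)) =
      v * Real.sinh v * ((Real.cosh v - 1) ^ (-(3 / 4) : ℝ) * Real.cosh v ^ (-(1 / 4) : ℝ)) := by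
    have : (Real.cosh v - 1) ^ (-(3 / 4) : ℝ) = (Real.cosh v - 1) ^ ((n : ℝ) / 2 - 1) *
        (Real.cosh v - 1) ^ (1 / 4 - (n : ℝ) / 2) := by
      rw [← Real.rpow_add hσ]; congr 1; ring
    rw [this]; ring
  rw [e1]
  -- Fourth powers clear the quarter exponents and leave a polynomial inequality in `v` and `ch v`.
  refine le_of_pow_le_pow_left₀ (n := 4) (by norm_num) (by positivity) ?_
  have e2 : ((Real.cosh v - 1) ^ (-(3 / 4) : ℝ)) ^ 4 = ((Real.cosh v - 1) ^ 3)⁻¹ := by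
    rw [← Real.rpow_natCast, ← Real.rpow_mul hσ.le, ← Real.rpow_natCast, ← Real.rpow_neg hσ.le]
    norm_num
  have e3 : (Real.cosh v ^ (-(1 / 4) : ℝ)) ^ 4 = (Real.cosh v)⁻¹ := by
    rw [← Real.rpow_natCast, ← Real.rpow_mul hc.le, ← Real.rpow_neg_one]
    norm_num
  have e4 : Real.sinh v ^ 4 = (Real.cosh v - 1) ^ 2 * (Real.cosh v + 1) ^ 2 := by
    have : Real.sinh v ^ 2 = Real.cosh v ^ 2 - 1 := by rw [Real.cosh_sq]; ring
    calc Real.sinh v ^ 4 = (Real.sinh v ^ 2) ^ 2 := by ring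
      _ = _ := by rw [this]; ring
  have h5 : v ^ 2 / 2 ≤ Real.cosh v - 1 := by
    have h1 : v / 2 ≤ Real.sinh (v / 2) := Real.self_le_sinh_iff.2 (by positivity)
    have h2 := Real.cosh_two_mul (v / 2)
    have h3 := Real.cosh_sq (v / 2)
    rw [mul_div_cancel₀ _ two_ne_zero] at h2
    nlinarith
  rw [mul_pow, mul_pow, mul_pow, e2, e3, e4]
  rw [show v ^ 4 * ((Real.cosh v - 1) ^ 2 * (Real.cosh v + 1) ^ 2) *
    (((Real.cosh v - 1) ^ 3)⁻¹ * (Real.cosh v)⁻¹)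
    = v ^ 4 * (Real.cosh v + 1) ^ 2 / ((Real.cosh v - 1) * Real.cosh v) by field_simp]
  rw [div_le_iff₀ (by positivity)]
  set σ := Real.cosh v - 1 with hσd
  have hcσ : Real.cosh v = σ + 1 := by rw [hσd]; ring
  rw [hcσ]
  have h6 : (σ + 1 + 1) ^ 2 ≤ 4 * (σ + 1) ^ 2 := by nlinarith
  calc v ^ 4 * (σ + 1 + 1) ^ 2 ≤ v ^ 4 * (4 * (σ + 1) ^ 2) := by gcongr
    _ = (4 * v ^ 4 * σ + 4 * v ^ 2 * v ^ 2) * (σ + 1) := by ring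
    _ ≤ (4 * v ^ 4 * σ + 4 * v ^ 2 * (2 * σ)) * (σ + 1) := by gcongr; linarith
    _ = (4 * v ^ 4 + 8 * v ^ 2) * (σ * (σ + 1)) := by ring
    _ ≤ (2 * (1 + v)) ^ 4 * (σ * (σ + 1)) := by
        gcongr
        nlinarith [pow_pos hv 2, pow_pos hv 3, pow_pos hv 4]

end Polar

/-! ### Integrability of the kernel and the estimate on balls -/

section Bound

variable {n : ℕ}

variable (n) in
/-- The radial profile, up to constants, of the bound for the kernel. -/
def radialMajorant (μ v : ℝ) : ℝ :=
  Real.exp (μ * v) * (Real.cosh v ^ (-(1 / 4) : ℝ) * (Real.cosh v - 1) ^ (1 / 4 - (n : ℝ) / 2))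

theorem measurable_radialMajorant (μ : ℝ) : Measurable (radialMajorant n μ) := by
  have hcosh := Real.measurable_cosh
  unfold radialMajorant
  fun_prop

theorem radialMajorant_nonneg (μ : ℝ) (v : ℝ) : 0 ≤ radialMajorant n μ v := by
  have := Real.one_le_cosh v
  have h3 : 0 ≤ Real.cosh v - 1 := by linarith
  unfold radialMajorant
  positivity

variable (n) in
theorem lintegral_radialMajorant_le (hn : 1 ≤ n) : ∃ D : ENNReal, D ≠ ⊤ ∧ ∀ μ : ℝ,
    ∀ A : Set ℝ, MeasurableSet A →
    ∫⁻ g : AxB n, ENNReal.ofReal (Real.exp (-(n * g.1 / 2))) *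
        A.indicator (fun v => ENNReal.ofReal (radialMajorant n μ v)) (radius g)
      ≤ D * ∫⁻ v in Ioi 0 ∩ A, ENNReal.ofReal (Real.exp (μ * v) * (1 + v)) := by
  obtain ⟨D, hD, h'⟩ := lintegral_radial_le n hn
  refine ⟨D * ENNReal.ofReal 2, ENNReal.mul_ne_top hD ENNReal.ofReal_ne_top, fun μ A hA => ?_⟩
  have hF : Measurable (A.indicator fun v => ENNReal.ofReal (radialMajorant n μ v)) :=
    Measurable.indicator (measurable_radialMajorant μ).ennreal_ofReal hA
  refine (h' _ hF).trans ?_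
  rw [mul_assoc, ← lintegral_const_mul' _ _ ENNReal.ofReal_ne_top]
  refine mul_le_mul' le_rfl ?_
  rw [← lintegral_indicator measurableSet_Ioi,
    ← lintegral_indicator (measurableSet_Ioi.inter hA)]
  refine lintegral_mono fun v => ?_
  by_cases hv : 0 < v
  · rw [indicator_of_mem (show v ∈ Ioi 0 from hv)]
    by_cases hvA : v ∈ A
    · have hsh : 0 < Real.sinh v := Real.sinh_pos_iff.2 hv
      have h3 : 0 < Real.cosh v - 1 := by linarith [Real.one_lt_cosh.2 hv.ne']
      rw [indicator_of_mem hvA, indicator_of_mem (show v ∈ Ioi 0 ∩ A from ⟨hv, hvA⟩),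
        ← ENNReal.ofReal_mul (by positivity), ← ENNReal.ofReal_mul (by positivity)]
      refine ENNReal.ofReal_le_ofReal ?_
      have := mul_le_mul_of_nonneg_left (radial_weight_le (n := n) hv)
        (Real.exp_nonneg (μ * v))
      simp only [radialMajorant]
      linarith
    · rw [indicator_of_notMem hvA, mul_zero]
      exact zero_le
  · rw [indicator_of_notMem (show v ∉ Ioi 0 from hv)]
    exact zero_le

variable (n) in
/-- The estimate of the kernel integrated over measurable sets of radii. -/
theorem lintegral_norm_kernel_le (hn : 1 ≤ n) : ∃ C : ℝ, 0 ≤ C ∧ ∀ ν : ℂ, ν.re ≤ 0 →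
    ∀ A : Set ℝ, MeasurableSet A →
    ∫⁻ g : AxB n in radius ⁻¹' A, ENNReal.ofReal ‖kernel ν (n / 2) g‖
      ≤ ENNReal.ofReal (C * (1 + ‖ν‖) ^ ((n : ℝ) / 2)) *
        ∫⁻ v in Ioi 0 ∩ A, ENNReal.ofReal (Real.exp (ν.re * v) * (1 + v)) := by
  obtain ⟨C, hC, h⟩ := norm_kernel_le n hn
  obtain ⟨D, hD, h'⟩ := lintegral_radialMajorant_le n hn
  refine ⟨C * D.toReal, by positivity, fun ν hν A hA => ?_⟩
  have hAr : MeasurableSet (radius (n := n) ⁻¹' A) := continuous_radius.measurable hA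
  have hc : 0 ≤ C * (1 + ‖ν‖) ^ ((n : ℝ) / 2) := by positivity
  calc _ ≤ ∫⁻ g : AxB n, ENNReal.ofReal (C * (1 + ‖ν‖) ^ ((n : ℝ) / 2)) *
        (ENNReal.ofReal (Real.exp (-(n * g.1 / 2))) *
          A.indicator (fun v => ENNReal.ofReal (radialMajorant n ν.re v)) (radius g)) := by
        rw [← lintegral_indicator hAr]
        refine lintegral_mono_ae ?_
        filter_upwards [ae_ne_one] with g hg
        by_cases hgA : radius g ∈ A
        · rw [indicator_of_mem (show g ∈ radius ⁻¹' A from hgA), indicator_of_mem hgA,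
            ← ENNReal.ofReal_mul (Real.exp_nonneg _), ← ENNReal.ofReal_mul hc]
          exact ENNReal.ofReal_le_ofReal (h ν hν g hg)
        · rw [indicator_of_notMem (show g ∉ radius ⁻¹' A from hgA)]
          exact zero_le
    _ = ENNReal.ofReal (C * (1 + ‖ν‖) ^ ((n : ℝ) / 2)) * ∫⁻ g : AxB n,
        (ENNReal.ofReal (Real.exp (-(n * g.1 / 2))) *
          A.indicator (fun v => ENNReal.ofReal (radialMajorant n ν.re v)) (radius g)) :=
        lintegral_const_mul' _ _ ENNReal.ofReal_ne_top
    _ ≤ ENNReal.ofReal (C * (1 + ‖ν‖) ^ ((n : ℝ) / 2)) * (D *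
        ∫⁻ v in Ioi 0 ∩ A, ENNReal.ofReal (Real.exp (ν.re * v) * (1 + v))) :=
        mul_le_mul' le_rfl (h' _ _ hA)
    _ = _ := by
        rw [← mul_assoc]
        congr 1
        have e : D = ENNReal.ofReal D.toReal := (ENNReal.ofReal_toReal hD).symm
        rw [show C * D.toReal * (1 + ‖ν‖) ^ ((n : ℝ) / 2)
          = C * (1 + ‖ν‖) ^ ((n : ℝ) / 2) * D.toReal by ring, ENNReal.ofReal_mul hc, ← e]

theorem integrableOn_exp_mul_one_add {μ : ℝ} (hμ : μ < 0) :
    IntegrableOn (fun v : ℝ => Real.exp (μ * v) * (1 + v)) (Ioi 0) := by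
  have h1 := integrableOn_exp_mul_Ioi hμ 0
  have h2 := integrableOn_rpow_mul_exp_neg_mul_rpow (p := 1) (s := 1) (b := -μ)
    (by norm_num) one_pos (by linarith)
  have h3 : IntegrableOn (fun v : ℝ => Real.exp (μ * v) + v ^ (1 : ℝ) * Real.exp (-(-μ) * v ^ (1 : ℝ)))
    (Ioi 0) := h1.add h2
  refine h3.congr (.of_forall fun v => ?_)
  simp only [Real.rpow_one, neg_neg]
  ring

theorem integrable_radialMajorant {μ : ℝ} (hμ : μ < 0) (hn : 1 ≤ n) :
    Integrable fun g : AxB n => Real.exp (-(n * g.1 / 2)) * radialMajorant n μ (radius g) := by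
  obtain ⟨D, hD, h⟩ := lintegral_radialMajorant_le n hn
  have hm : Measurable fun g : AxB n =>
      Real.exp (-(n * g.1 / 2)) * radialMajorant n μ (radius g) :=
    Measurable.mul (by fun_prop) ((measurable_radialMajorant μ).comp continuous_radius.measurable)
  refine ⟨hm.aestronglyMeasurable, ?_⟩
  rw [hasFiniteIntegral_iff_norm]
  have h1 := h μ univ MeasurableSet.univ
  rw [inter_univ] at h1
  refine lt_of_le_of_lt (le_trans (le_of_eq ?_) h1)
    (ENNReal.mul_lt_top hD.lt_top (integrableOn_exp_mul_one_add hμ).lintegral_lt_top)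
  refine lintegral_congr fun g => ?_
  rw [indicator_univ, ← ENNReal.ofReal_mul (Real.exp_nonneg _),
    Real.norm_of_nonneg (mul_nonneg (Real.exp_nonneg _) (radialMajorant_nonneg μ _))]

theorem integrable_kernel {ν : ℂ} (hν : ν.re < 0) (hn : 1 ≤ n) {l : ℕ}
    (hl : -1 < -(n : ℝ) / 2 + l) : Integrable (kernel (n := n) ν l) := by
  obtain ⟨C, hC, h⟩ := lintegral_norm_kernel_le n hn
  have h1 : Integrable (kernel (n := n) ν (n / 2)) := by
    refine ⟨aestronglyMeasurable_kernel hν.le hn (neg_half_add_div_two n).1, ?_⟩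
    rw [hasFiniteIntegral_iff_norm]
    have := h ν hν.le univ MeasurableSet.univ
    rw [preimage_univ, Measure.restrict_univ, inter_univ] at this
    refine this.trans_lt (ENNReal.mul_lt_top ENNReal.ofReal_lt_top ?_)
    exact (integrableOn_exp_mul_one_add hν).lintegral_lt_top
  refine h1.congr ?_
  filter_upwards [ae_ne_one] with g hg
  exact (kernel_eq_kernel_div_two hν.le hn hl hg).symm

/-- For `v ≤ 1` the integrand is at most `2`, and for `v > 1` one has `1 + v ≤ 2 v`. This replaces
the weight `1 + v` of the radial integration by the bracket of the theorem. -/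
theorem integral_exp_mul_one_add_le {μ R : ℝ} (hμ : μ ≤ 0) (hR : 0 < R) :
    ∫ v in (0 : ℝ)..R, Real.exp (μ * v) * (1 + v)
      ≤ 2 * (1 + ∫ v in (0 : ℝ)..R, Real.exp (μ * v) * v) := by
  have hc : Continuous fun v : ℝ => Real.exp (μ * v) * (1 + v) := by fun_prop
  have hc2 : Continuous fun v : ℝ => Real.exp (μ * v) * v := by fun_prop
  have h1 : ∫ v in (0 : ℝ)..R, (Iic (1 : ℝ)).indicator (fun _ => (1 : ℝ)) v ≤ 1 := by
    rw [intervalIntegral.integral_of_le hR.le, integral_indicator measurableSet_Iic,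
      Measure.restrict_restrict measurableSet_Iic, setIntegral_const, smul_eq_mul, mul_one]
    have : volume.real (Iic 1 ∩ Ioc 0 R) ≤ volume.real (Ioc (0 : ℝ) 1) :=
      measureReal_mono (fun v hv => ⟨hv.2.1, hv.1⟩) (by simp)
    simpa using this
  have hi : IntervalIntegrable ((Iic (1 : ℝ)).indicator (fun _ => (1 : ℝ))) volume 0 R := by
    rw [intervalIntegrable_iff_integrableOn_Ioc_of_le hR.le]
    exact (integrableOn_const (by simp)).indicator measurableSet_Iic
  have h2 : ∫ v in (0 : ℝ)..R, Real.exp (μ * v) * (1 + v) ≤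
      ∫ v in (0 : ℝ)..R, (2 * (Iic (1 : ℝ)).indicator (fun _ => (1 : ℝ)) v
        + 2 * (Real.exp (μ * v) * v)) := by
    refine intervalIntegral.integral_mono_on hR.le (hc.intervalIntegrable _ _)
      ((hi.const_mul 2).add ((hc2.intervalIntegrable _ _).const_mul 2)) fun v hv => ?_
    have hv0 : 0 ≤ v := hv.1
    have hE : Real.exp (μ * v) ≤ 1 := by
      rw [Real.exp_le_one_iff]; exact mul_nonpos_of_nonpos_of_nonneg hμ hv0
    have hE0 := Real.exp_nonneg (μ * v)
    by_cases h : v ≤ 1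
    · rw [indicator_of_mem (show v ∈ Iic 1 from h)]
      nlinarith
    · rw [indicator_of_notMem (show v ∉ Iic 1 from h)]
      nlinarith
  rw [intervalIntegral.integral_add (hi.const_mul 2) ((hc2.intervalIntegrable _ _).const_mul 2),
    intervalIntegral.integral_const_mul, intervalIntegral.integral_const_mul] at h2
  linarith

variable (n) in
theorem integral_ball_norm_kernel_le (hn : 1 ≤ n) : ∃ C : ℝ, ∀ ν : ℂ, ν.re < 0 → ∀ l : ℕ,
    -1 < -(n : ℝ) / 2 + l → ∀ R : ℝ, 0 < R →
    ∫ g in ball n R, ‖kernel ν l g‖ ≤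
      C * (1 + ‖ν‖) ^ ((n : ℝ) / 2) * (1 + ∫ r in (0 : ℝ)..R, Real.exp (ν.re * r) * r) := by
  obtain ⟨C, hC, h⟩ := lintegral_norm_kernel_le n hn
  refine ⟨C * 2, fun ν hν l hl R hR => ?_⟩
  have h1 : ∫ g in ball n R, ‖kernel ν l g‖ = ∫ g in ball n R, ‖kernel ν (n / 2) g‖ := by
    refine integral_congr_ae (ae_restrict_of_ae ?_)
    filter_upwards [ae_ne_one] with g hg
    rw [kernel_eq_kernel_div_two hν.le hn hl hg]
  have hm := aestronglyMeasurable_kernel hν.le hn (neg_half_add_div_two n).1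
  have hI : 0 ≤ ∫ v in (0 : ℝ)..R, Real.exp (ν.re * v) * (1 + v) :=
    intervalIntegral.integral_nonneg hR.le fun v hv => by
      have := hv.1
      positivity
  rw [h1, integral_eq_lintegral_of_nonneg_ae (.of_forall fun g => norm_nonneg _) hm.norm.restrict]
  have h2 := h ν hν.le (Iio R) measurableSet_Iio
  have h3 : ∫⁻ v in Ioi 0 ∩ Iio R, ENNReal.ofReal (Real.exp (ν.re * v) * (1 + v))
      = ENNReal.ofReal (∫ v in (0 : ℝ)..R, Real.exp (ν.re * v) * (1 + v)) := by
    have hc : Continuous fun v : ℝ => Real.exp (ν.re * v) * (1 + v) := by fun_prop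
    rw [Ioi_inter_Iio, intervalIntegral.integral_of_le hR.le, integral_Ioc_eq_integral_Ioo,
      ofReal_integral_eq_lintegral_ofReal]
    · exact (hc.integrableOn_Icc (a := 0) (b := R)).mono_set Ioo_subset_Icc_self
    · refine (ae_restrict_iff' measurableSet_Ioo).2 (.of_forall fun v hv => ?_)
      have := hv.1
      simp only [Pi.zero_apply]
      positivity
  rw [h3, ← ENNReal.ofReal_mul (by positivity)] at h2
  refine (ENNReal.toReal_mono ENNReal.ofReal_ne_top h2).trans ?_
  rw [ENNReal.toReal_ofReal (by positivity)]
  calc _ ≤ C * (1 + ‖ν‖) ^ ((n : ℝ) / 2) *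
        (2 * (1 + ∫ v in (0 : ℝ)..R, Real.exp (ν.re * v) * v)) := by
        gcongr
        exact integral_exp_mul_one_add_le hν.le hR
    _ = _ := by ring

end Bound

/-! ### Averages of translates on `L²(G)` -/

section Averaging

variable {n : ℕ}

/-- Cauchy–Schwarz for `F k = (F k^{1/2}) · k^{1/2}`. -/
theorem lintegral_mul_sq_le {α : Type*} [MeasurableSpace α] {μ : Measure α} {F k : α → ENNReal}
    (hF : AEMeasurable F μ) (hk : AEMeasurable k μ) :
    (∫⁻ a, F a * k a ∂μ) ^ 2 ≤ (∫⁻ a, k a ∂μ) * ∫⁻ a, F a ^ 2 * k a ∂μ := by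
  have h := ENNReal.lintegral_mul_le_Lp_mul_Lq μ Real.HolderConjugate.two_two
    (f := fun a => F a * k a ^ (1 / 2 : ℝ)) (g := fun a => k a ^ (1 / 2 : ℝ))
    (hF.mul (hk.pow_const _)) (hk.pow_const _)
  have e1 : ∀ a, k a ^ (1 / 2 : ℝ) * k a ^ (1 / 2 : ℝ) = k a := fun a => by
    rw [← ENNReal.rpow_add_of_nonneg _ _ (by norm_num) (by norm_num)]; norm_num
  have e2 : ∀ a, (k a ^ (1 / 2 : ℝ)) ^ (2 : ℝ) = k a := fun a => by
    rw [← ENNReal.rpow_mul]; norm_num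
  simp only [Pi.mul_apply, mul_assoc, e1, e2, ENNReal.mul_rpow_of_nonneg _ _ zero_le_two] at h
  calc _ ≤ ((∫⁻ a, F a ^ (2 : ℝ) * k a ∂μ) ^ (1 / 2 : ℝ) * (∫⁻ a, k a ∂μ) ^ (1 / 2 : ℝ)) ^ 2 := by
        gcongr
    _ = _ := by
        rw [mul_pow, ← ENNReal.rpow_natCast, ← ENNReal.rpow_natCast, ← ENNReal.rpow_mul,
          ← ENNReal.rpow_mul, mul_comm]
        norm_num

/-- Minkowski's inequality for averages of the translates `f ∘ φ h`. -/
theorem lintegral_average_sq_le {φ : AxB n → AxB n → AxB n} (hφ : Measurable (Function.uncurry φ))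
    {c : AxB n → ENNReal} (hc : ∀ h, ∀ F : AxB n → ENNReal, Measurable F →
      ∫⁻ g, F (φ h g) ≤ c h * ∫⁻ g, F g) {F k : AxB n → ENNReal} (hF : Measurable F)
    (hF2 : ∫⁻ g, F g ^ 2 ≠ ⊤) (hk : Measurable k) :
    ∫⁻ g, (∫⁻ h, F (φ h g) * k h) ^ 2 ≤
      (∫⁻ h, k h) * ((∫⁻ h, k h * c h) * ∫⁻ g, F g ^ 2) := by
  have hφ1 : ∀ g, Measurable fun h => φ h g := fun g => hφ.comp measurable_prodMk_right
  have hφ2 : ∀ h, Measurable fun g => φ h g := fun h => hφ.comp measurable_prodMk_left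
  have hm : Measurable (Function.uncurry fun g h => F (φ h g) ^ 2 * k h) := by
    have h1 : Measurable fun p : AxB n × AxB n => φ p.2 p.1 := hφ.comp measurable_swap
    exact ((hF.comp h1).pow_const 2).mul (hk.comp measurable_snd)
  calc _ ≤ ∫⁻ g, (∫⁻ h, k h) * ∫⁻ h, F (φ h g) ^ 2 * k h := by
        refine lintegral_mono fun g => ?_
        exact lintegral_mul_sq_le (hF.comp (hφ1 g)).aemeasurable hk.aemeasurable
    _ = (∫⁻ h, k h) * ∫⁻ g, ∫⁻ h, F (φ h g) ^ 2 * k h :=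
        lintegral_const_mul _ hm.lintegral_prod_right'
    _ = (∫⁻ h, k h) * ∫⁻ h, ∫⁻ g, F (φ h g) ^ 2 * k h := by
        rw [lintegral_lintegral_swap hm.aemeasurable]
    _ ≤ (∫⁻ h, k h) * ∫⁻ h, (k h * c h) * ∫⁻ g, F g ^ 2 := by
        refine mul_le_mul' le_rfl (lintegral_mono fun h => ?_)
        simp only
        have h1 : Measurable fun g => F (φ h g) ^ 2 := (hF.comp (hφ2 h)).pow_const 2
        rw [lintegral_mul_const _ h1, mul_comm, mul_assoc]
        exact mul_le_mul' le_rfl (hc h (fun g => F g ^ 2) (hF.pow_const 2))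
    _ = _ := by rw [lintegral_mul_const' _ _ hF2]

theorem eLpNorm_two_sq (f : AxB n → ℂ) : eLpNorm f 2 volume ^ 2 = ∫⁻ g, ‖f g‖ₑ ^ 2 := by
  have h := eLpNorm_nnreal_pow_eq_lintegral (f := f) (μ := volume) (p := 2) two_ne_zero
  simpa using h

theorem lintegral_enorm_sq_ne_top {f : AxB n → ℂ} (hf : MemLp f 2) :
    ∫⁻ g, ‖f g‖ₑ ^ 2 ≠ ⊤ := by
  rw [← eLpNorm_two_sq]
  exact ENNReal.pow_ne_top hf.2.ne

/-- Schur's test for the averages `∫ f (φ h g) * k h dh`, in terms of the squared norm. -/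
theorem lintegral_average_enorm_sq_le {φ : AxB n → AxB n → AxB n}
    (hφ : Measurable (Function.uncurry φ))
    {c : AxB n → ENNReal} (hc : ∀ h, ∀ F : AxB n → ENNReal, Measurable F →
      ∫⁻ g, F (φ h g) ≤ c h * ∫⁻ g, F g) {f k : AxB n → ℂ} (hf : StronglyMeasurable f)
    (hf2 : MemLp f 2) (hk : AEStronglyMeasurable k volume) :
    Measurable (fun g => ∫⁻ h, ‖f (φ h g) * k h‖ₑ) ∧
    ∫⁻ g, (∫⁻ h, ‖f (φ h g) * k h‖ₑ) ^ 2 ≤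
      (∫⁻ h, ‖k h‖ₑ) * ((∫⁻ h, ‖k h‖ₑ * c h) * ∫⁻ g, ‖f g‖ₑ ^ 2) := by
  have hae : ∀ᵐ h, ‖k h‖ₑ = ‖hk.mk k h‖ₑ := by
    filter_upwards [hk.ae_eq_mk] with h hh using by rw [hh]
  have hmk : Measurable fun h => ‖hk.mk k h‖ₑ := hk.stronglyMeasurable_mk.measurable.enorm
  have e : (fun g => ∫⁻ h, ‖f (φ h g) * k h‖ₑ) = fun g => ∫⁻ h, ‖f (φ h g)‖ₑ * ‖hk.mk k h‖ₑ := by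
    funext g
    refine lintegral_congr_ae ?_
    filter_upwards [hae] with h hh
    rw [enorm_mul, hh]
  have h1 := lintegral_average_sq_le hφ hc (F := fun g => ‖f g‖ₑ) hf.measurable.enorm
    (lintegral_enorm_sq_ne_top hf2) hmk
  have hm : Measurable (Function.uncurry fun g h => ‖f (φ h g)‖ₑ * ‖hk.mk k h‖ₑ) := by
    have h1 : Measurable fun p : AxB n × AxB n => φ p.2 p.1 := hφ.comp measurable_swap
    exact ((hf.measurable.comp h1).enorm).mul (hmk.comp measurable_snd)
  refine ⟨?_, ?_⟩
  · rw [e]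
    exact hm.lintegral_prod_right'
  · have e' := fun g => congrFun e g
    simp only [e']
    have e1 : ∫⁻ h, ‖k h‖ₑ = ∫⁻ h, ‖hk.mk k h‖ₑ := lintegral_congr_ae hae
    have e2 : ∫⁻ h, ‖k h‖ₑ * c h = ∫⁻ h, ‖hk.mk k h‖ₑ * c h := by
      refine lintegral_congr_ae ?_
      filter_upwards [hae] with h hh using by rw [hh]
    rw [e1, e2]
    exact h1

/-- The translation `φ` and the factor `c` by which it distorts the measure stay general, because
two cases are needed: right translations with `c = 1` for the kernel, and left translations with `c`
the modular function for mollifying. -/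
theorem ae_integrable_average {φ : AxB n → AxB n → AxB n} (hφ : Measurable (Function.uncurry φ))
    {c : AxB n → ENNReal} (hc : ∀ h, ∀ F : AxB n → ENNReal, Measurable F →
      ∫⁻ g, F (φ h g) ≤ c h * ∫⁻ g, F g) {f k : AxB n → ℂ} (hf : StronglyMeasurable f)
    (hf2 : MemLp f 2) (hk : Integrable k) (hkc : ∫⁻ h, ‖k h‖ₑ * c h ≠ ⊤) :
    ∀ᵐ g, Integrable fun h => f (φ h g) * k h := by
  obtain ⟨h1, h2⟩ := lintegral_average_enorm_sq_le hφ hc hf hf2 hk.1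
  have h3 : ∫⁻ g, (∫⁻ h, ‖f (φ h g) * k h‖ₑ) ^ 2 ≠ ⊤ :=
    ne_top_of_le_ne_top (ENNReal.mul_ne_top hk.2.ne
      (ENNReal.mul_ne_top hkc (lintegral_enorm_sq_ne_top hf2))) h2
  filter_upwards [ae_lt_top (h1.pow_const 2) h3] with g hg
  refine ⟨?_, ?_⟩
  · exact ((hf.measurable.comp (hφ.comp measurable_prodMk_right)).aestronglyMeasurable).mul hk.1
  · exact lt_of_not_ge fun h => by
      rw [top_le_iff.1 h] at hg
      simp at hg

theorem memLp_average {φ : AxB n → AxB n → AxB n} (hφ : Measurable (Function.uncurry φ))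
    {c : AxB n → ENNReal} (hc : ∀ h, ∀ F : AxB n → ENNReal, Measurable F →
      ∫⁻ g, F (φ h g) ≤ c h * ∫⁻ g, F g) {f k : AxB n → ℂ} (hf : StronglyMeasurable f)
    (hf2 : MemLp f 2) (hk : Integrable k) (hkc : ∫⁻ h, ‖k h‖ₑ * c h ≠ ⊤) :
    MemLp (fun g => ∫ h, f (φ h g) * k h) 2 ∧
    eLpNorm (fun g => ∫ h, f (φ h g) * k h) 2 volume ^ 2 ≤
      (∫⁻ h, ‖k h‖ₑ) * ((∫⁻ h, ‖k h‖ₑ * c h) * eLpNorm f 2 volume ^ 2) := by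
  obtain ⟨-, h2⟩ := lintegral_average_enorm_sq_le hφ hc hf hf2 hk.1
  have hle : eLpNorm (fun g => ∫ h, f (φ h g) * k h) 2 volume ^ 2 ≤
      (∫⁻ h, ‖k h‖ₑ) * ((∫⁻ h, ‖k h‖ₑ * c h) * eLpNorm f 2 volume ^ 2) := by
    rw [eLpNorm_two_sq, eLpNorm_two_sq]
    refine le_trans (lintegral_mono fun g => ?_) h2
    exact pow_le_pow_left' (enorm_integral_le_lintegral_enorm _) 2
  refine ⟨⟨?_, ?_⟩, hle⟩
  · have e : (fun g => ∫ h, f (φ h g) * k h) = fun g => ∫ h, f (φ h g) * hk.1.mk k h := by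
      funext g
      refine integral_congr_ae ?_
      filter_upwards [hk.1.ae_eq_mk] with h hh
      rw [hh]
    rw [e]
    have h1 : Measurable fun p : AxB n × AxB n => φ p.2 p.1 := hφ.comp measurable_swap
    have hm : StronglyMeasurable (Function.uncurry fun g h => f (φ h g) * hk.1.mk k h) :=
      (hf.comp_measurable h1).mul (hk.1.stronglyMeasurable_mk.comp_measurable measurable_snd)
    exact hm.integral_prod_right'.aestronglyMeasurable
  · have h3 : eLpNorm (fun g => ∫ h, f (φ h g) * k h) 2 volume ^ 2 < ⊤ :=
      lt_of_le_of_lt hle (ENNReal.mul_lt_top hk.2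
        (ENNReal.mul_lt_top hkc.lt_top (ENNReal.pow_lt_top hf2.2)))
    exact lt_of_not_ge fun h => by
      rw [top_le_iff.1 h] at h3
      simp at h3

theorem lintegral_mul_right (h : AxB n) (F : AxB n → ENNReal) (hF : Measurable F) :
    ∫⁻ g, F (g * h) = ∫⁻ g, F g :=
  (measurePreserving_mul_right h).lintegral_comp hF

theorem measurable_mul_swap :
    Measurable (Function.uncurry fun h g : AxB n => g * h) :=
  (continuous_snd.mul continuous_fst).measurable

/-- Convolution with an integrable kernel is a bounded operator on `L²(G)`. -/
theorem exists_averaging_operator {k : AxB n → ℂ} (hk : Integrable k) :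
    ∃ T : L2 n →L[ℂ] L2 n, ∀ f : L2 n, (∀ᵐ g, Integrable fun h => f (g * h) * k h) ∧
      T f =ᵐ[volume] fun g => ∫ h, f (g * h) * k h := by
  have hc : ∀ h : AxB n, ∀ F : AxB n → ENNReal, Measurable F →
      ∫⁻ g, F (g * h) ≤ (fun _ => 1 : AxB n → ENNReal) h * ∫⁻ g, F g := fun h F hF => by
    simp [lintegral_mul_right h F hF]
  have hkc : ∫⁻ h, ‖k h‖ₑ * (fun _ => 1 : AxB n → ENNReal) h ≠ ⊤ := by
    simpa using hk.2.ne
  have hint : ∀ f : L2 n, ∀ᵐ g, Integrable fun h => f (g * h) * k h := fun f =>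
    ae_integrable_average measurable_mul_swap hc (Lp.stronglyMeasurable f) (Lp.memLp f) hk hkc
  have hmem : ∀ f : L2 n, MemLp (fun g => ∫ h, f (g * h) * k h) 2 ∧ _ := fun f =>
    memLp_average measurable_mul_swap hc (Lp.stronglyMeasurable f) (Lp.memLp f) hk hkc
  let T₀ : L2 n →ₗ[ℂ] L2 n :=
    { toFun := fun f => (hmem f).1.toLp
      map_add' := fun f₁ f₂ => by
        refine Lp.ext ?_
        filter_upwards [(hmem (f₁ + f₂)).1.coeFn_toLp, (hmem f₁).1.coeFn_toLp,
          (hmem f₂).1.coeFn_toLp, Lp.coeFn_add ((hmem f₁).1.toLp) ((hmem f₂).1.toLp),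
          hint f₁, hint f₂] with g h1 h2 h3 h4 h5 h6
        rw [h1, h4, Pi.add_apply, h2, h3, ← integral_add h5 h6]
        refine integral_congr_ae ?_
        -- Left translation multiplies the measure by a constant, so an almost everywhere identity
        -- for representatives survives the passage from `h` to `g h`.
        filter_upwards [(quasiMeasurePreserving_mul_left g).ae (Lp.coeFn_add f₁ f₂)] with h hh
        rw [hh, Pi.add_apply, add_mul]
      map_smul' := fun a f => by
        refine Lp.ext ?_
        filter_upwards [(hmem (a • f)).1.coeFn_toLp, (hmem f).1.coeFn_toLp,
          Lp.coeFn_smul a ((hmem f).1.toLp)] with g h1 h2 h3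
        rw [h1, RingHom.id_apply, h3, Pi.smul_apply, h2, ← integral_smul]
        refine integral_congr_ae ?_
        filter_upwards [(quasiMeasurePreserving_mul_left g).ae (Lp.coeFn_smul a f)] with h hh
        rw [hh, Pi.smul_apply, smul_mul_assoc] }
  refine ⟨T₀.mkContinuous (∫⁻ h, ‖k h‖ₑ).toReal fun f => ?_, fun f => ⟨hint f, ?_⟩⟩
  · change ‖(hmem f).1.toLp‖ ≤ _
    have h1 := (hmem f).2
    simp only [mul_one, ← mul_assoc, ← pow_two] at h1
    rw [← mul_pow] at h1
    have h2 := (ENNReal.pow_le_pow_left_iff two_ne_zero).1 h1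
    rw [Lp.norm_toLp, Lp.norm_def, ← ENNReal.toReal_mul]
    exact ENNReal.toReal_mono (ENNReal.mul_ne_top hk.2.ne (Lp.memLp f).2.ne) h2
  · exact (hmem f).1.coeFn_toLp

/-- Right convolution with a kernel `k` for which `k(g⁻¹) = e^{n x} k(g)`, in two forms. -/
theorem convolution_kernel_inv {k : AxB n → ℂ}
    (hk : ∀ g : AxB n, (Real.exp (-(n * g.1)) : ℂ) * k g⁻¹ = k g) (f : AxB n → ℂ) (g' : AxB n) :
    (Integrable (fun g => f g⁻¹ * k (g * g')) ↔ Integrable fun h => f (g' * h) * k h) ∧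
    ∫ g, f g⁻¹ * k (g * g') = ∫ h, f (g' * h) * k h := by
  -- The substitution is `h = (g g')⁻¹`, so `g⁻¹ = g' h`. Right translation by `g'` preserves `dg`,
  -- inversion brings in `e^{-nx}`, and the symmetry of `k` absorbs it.
  have e1 : (fun g => f g⁻¹ * k (g * g')) =
      (fun h => (fun q => f (g' * q) * k q⁻¹) h⁻¹) ∘ fun g => g * g' := by
    funext g
    simp
  have e2 : (fun h => (Real.exp (-(n * h.1)) : ℂ) * (fun q => f (g' * q) * k q⁻¹) h) =
      fun h => f (g' * h) * k h := by
    funext h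
    simp only
    rw [mul_left_comm, hk h]
  have hemb : MeasurableEmbedding fun g : AxB n => g * g' :=
    (MeasurableEquiv.mulRight g').measurableEmbedding
  constructor
  · rw [e1, (measurePreserving_mul_right g').integrable_comp_emb hemb,
      integrable_comp_inv_iff fun q => f (g' * q) * k q⁻¹, e2]
  · have h1 := (measurePreserving_mul_right g').integral_comp hemb
      fun h => (fun q => f (g' * q) * k q⁻¹) h⁻¹
    rw [integral_comp_inv (fun q => f (g' * q) * k q⁻¹), e2] at h1
    rw [← h1]
    simp

end Averaging

/-! ### Beta and Gaussian integrals, normalisation constant -/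

section GammaIntegrals

theorem lintegral_rpow_mul_exp {q r : ℝ} (hq : 0 < q) (hr : 0 < r) :
    ∫⁻ t in Ioi (0 : ℝ), ENNReal.ofReal (t ^ (q - 1) * Real.exp (-(r * t))) =
      ENNReal.ofReal (r ^ (-q) * Real.Gamma q) := by
  have h := Real.integral_rpow_mul_exp_neg_mul_Ioi hq hr
  have hpos : 0 < (1 / r) ^ q * Real.Gamma q :=
    mul_pos (Real.rpow_pos_of_pos (by positivity) _) (Real.Gamma_pos_of_pos hq)
  have hi : IntegrableOn (fun t : ℝ => t ^ (q - 1) * Real.exp (-(r * t))) (Ioi 0) := by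
    by_contra hc
    rw [integral_undef hc] at h
    exact hpos.ne h
  rw [← ofReal_integral_eq_lintegral_ofReal hi, h, Real.rpow_neg hr.le, one_div, Real.inv_rpow hr.le]
  refine (ae_restrict_iff' measurableSet_Ioi).2 (.of_forall fun t ht => ?_)
  have : (0 : ℝ) < t := ht
  simp only [Pi.zero_apply]
  positivity

/-- From `Γ(q) (1 + A)^{-q} = ∫₀^∞ t^{q-1} e^{-t(1+A)} dt` and Tonelli. It reduces integrals of
powers to integrals of exponentials, which are known for `A` linear or quadratic. -/
theorem Gamma_mul_lintegral {α : Type*} [MeasurableSpace α] {μ : Measure α} [SFinite μ] {A : α → ℝ}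
    (hA : Measurable A) (hA0 : ∀ x, 0 ≤ A x) {W : α → ENNReal} (hW : Measurable W) {q : ℝ}
    (hq : 0 < q) :
    ENNReal.ofReal (Real.Gamma q) * ∫⁻ x, ENNReal.ofReal ((1 + A x) ^ (-q)) * W x ∂μ =
      ∫⁻ t in Ioi (0 : ℝ), ENNReal.ofReal (t ^ (q - 1) * Real.exp (-t)) *
        ∫⁻ x, ENNReal.ofReal (Real.exp (-(t * A x))) * W x ∂μ := by
  have hG := Real.Gamma_pos_of_pos hq
  have h1 : ∀ x, ENNReal.ofReal (Real.Gamma q) * (ENNReal.ofReal ((1 + A x) ^ (-q)) * W x) =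
      ∫⁻ t in Ioi (0 : ℝ), ENNReal.ofReal (t ^ (q - 1) * Real.exp (-t)) *
        (ENNReal.ofReal (Real.exp (-(t * A x))) * W x) := fun x => by
    have hx : 0 < 1 + A x := by linarith [hA0 x]
    rw [← mul_assoc, mul_comm (ENNReal.ofReal (Real.Gamma q)),
      ← ENNReal.ofReal_mul (by positivity), ← lintegral_rpow_mul_exp hq hx,
      ← lintegral_mul_const _ (by fun_prop)]
    refine setLIntegral_congr_fun measurableSet_Ioi fun t ht => ?_
    have ht0 : (0 : ℝ) < t := ht
    rw [← mul_assoc, ← ENNReal.ofReal_mul (by positivity), mul_assoc, ← Real.exp_add]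
    ring_nf
  rw [← lintegral_const_mul _ (by fun_prop)]
  simp only [h1]
  rw [lintegral_lintegral_swap (by fun_prop)]
  refine setLIntegral_congr_fun measurableSet_Ioi fun t ht => ?_
  rw [lintegral_const_mul _ (by fun_prop)]

theorem lintegral_one_add_rpow_mul_rpow {a q : ℝ} (ha : -1 < a) (haq : a + 1 < q) :
    ENNReal.ofReal (Real.Gamma q) *
      ∫⁻ r in Ioi (0 : ℝ), ENNReal.ofReal ((1 + r) ^ (-q) * r ^ a) =
      ENNReal.ofReal (Real.Gamma (a + 1) * Real.Gamma (q - a - 1)) := by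
  -- The function `max r 0` agrees with `r` on the domain of integration and is nonnegative on the
  -- whole line, as `Gamma_mul_lintegral` asks.
  have h := Gamma_mul_lintegral (μ := volume.restrict (Ioi 0)) (A := fun r : ℝ => max r 0)
    (by fun_prop) (fun x => le_max_right _ _) (W := fun r => ENNReal.ofReal (r ^ a))
    (by fun_prop) (q := q) (by linarith)
  have e1 : ∫⁻ r in Ioi (0 : ℝ), ENNReal.ofReal ((1 + max r 0) ^ (-q)) * ENNReal.ofReal (r ^ a) =
      ∫⁻ r in Ioi (0 : ℝ), ENNReal.ofReal ((1 + r) ^ (-q) * r ^ a) := by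
    refine setLIntegral_congr_fun measurableSet_Ioi fun r hr => ?_
    have hr0 : (0 : ℝ) < r := hr
    rw [max_eq_left hr0.le, ENNReal.ofReal_mul (by positivity)]
  have e2 : ∀ t : ℝ, 0 < t → ∫⁻ r in Ioi (0 : ℝ), ENNReal.ofReal (Real.exp (-(t * max r 0))) *
      ENNReal.ofReal (r ^ a) = ENNReal.ofReal (t ^ (-(a + 1)) * Real.Gamma (a + 1)) := by
    intro t ht
    rw [← lintegral_rpow_mul_exp (q := a + 1) (by linarith) ht]
    refine setLIntegral_congr_fun measurableSet_Ioi fun r hr => ?_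
    have hr0 : (0 : ℝ) < r := hr
    rw [max_eq_left hr0.le, ← ENNReal.ofReal_mul (by positivity), mul_comm]
    ring_nf
  rw [e1] at h
  have hG : 0 < Real.Gamma (a + 1) := Real.Gamma_pos_of_pos (by linarith)
  rw [h, ENNReal.ofReal_mul hG.le]
  have h3 := lintegral_rpow_mul_exp (q := q - a - 1) (r := 1) (by linarith) one_pos
  rw [Real.one_rpow, one_mul] at h3
  rw [← h3, ← lintegral_const_mul _ (by fun_prop)]
  refine setLIntegral_congr_fun measurableSet_Ioi fun t ht => ?_
  have ht0 : (0 : ℝ) < t := ht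
  rw [e2 t ht0, ← ENNReal.ofReal_mul (by positivity), ← ENNReal.ofReal_mul hG.le]
  congr 1
  rw [show q - a - 1 - 1 = (q - 1) + (-(a + 1)) by ring, Real.rpow_add ht0]
  ring_nf

theorem integral_one_add_rpow_mul_rpow {a q : ℝ} (ha : -1 < a) (haq : a + 1 < q) :
    Real.Gamma q * ∫ r in Ioi (0 : ℝ), (1 + r) ^ (-q) * r ^ a =
      Real.Gamma (a + 1) * Real.Gamma (q - a - 1) := by
  have h := congrArg ENNReal.toReal (lintegral_one_add_rpow_mul_rpow ha haq)
  have hG1 : 0 < Real.Gamma (a + 1) := Real.Gamma_pos_of_pos (by linarith)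
  have hG2 : 0 < Real.Gamma (q - a - 1) := Real.Gamma_pos_of_pos (by linarith)
  have hG : 0 < Real.Gamma q := Real.Gamma_pos_of_pos (by linarith)
  rw [ENNReal.toReal_mul, ENNReal.toReal_ofReal hG.le, ENNReal.toReal_ofReal (by positivity)] at h
  rw [← h, integral_eq_lintegral_of_nonneg_ae]
  · refine (ae_restrict_iff' measurableSet_Ioi).2 (.of_forall fun t ht => ?_)
    have : (0 : ℝ) < t := ht
    simp only [Pi.zero_apply]
    positivity
  · exact (by fun_prop : Measurable fun r : ℝ => (1 + r) ^ (-q) * r ^ a).aestronglyMeasurable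

theorem lintegral_exp_neg_norm_sq {V : Type*} [NormedAddCommGroup V] [InnerProductSpace ℝ V]
    [FiniteDimensional ℝ V] [MeasurableSpace V] [BorelSpace V] {b : ℝ} (hb : 0 < b) :
    ∫⁻ v : V, ENNReal.ofReal (Real.exp (-b * ‖v‖ ^ 2)) =
      ENNReal.ofReal ((Real.pi / b) ^ (Module.finrank ℝ V / 2 : ℝ)) := by
  have h := GaussianFourier.integral_rexp_neg_mul_sq_norm (V := V) hb
  have hpos : 0 < (Real.pi / b) ^ (Module.finrank ℝ V / 2 : ℝ) :=
    Real.rpow_pos_of_pos (by positivity) _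
  have hi : Integrable fun v : V => Real.exp (-b * ‖v‖ ^ 2) := by
    by_contra hc
    rw [integral_undef hc] at h
    exact hpos.ne h
  rw [← h, ofReal_integral_eq_lintegral_ofReal hi (.of_forall fun v => Real.exp_nonneg _)]

/-- The Gaussian integral in dimension `n + 1` is `(2π/t)^{(n+1)/2}`; its power of `t` cancels
`t^{q-1}` exactly for `q = (n + 3)/2`, leaving `∫₀^∞ e^{-t} dt = 1`. -/
theorem integral_one_add_norm_sq_rpow (n : ℕ) :
    Real.Gamma (((n : ℝ) + 3) / 2) *
      ∫ g : AxB n, (1 + (g.1 ^ 2 + ‖g.2‖ ^ 2) / 2) ^ (-(((n : ℝ) + 3) / 2)) =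
      (2 * Real.pi) ^ (((n : ℝ) + 1) / 2) := by
  have hq : (0 : ℝ) < ((n : ℝ) + 3) / 2 := by positivity
  have hG : 0 < Real.Gamma (((n : ℝ) + 3) / 2) := Real.Gamma_pos_of_pos hq
  have h := Gamma_mul_lintegral (μ := (volume : Measure (AxB n)))
    (A := fun g => (g.1 ^ 2 + ‖g.2‖ ^ 2) / 2)
    (by fun_prop) (fun x => by positivity) (W := fun _ => 1) (by fun_prop) hq
  have e2 : ∀ t : ℝ, 0 < t →
      ∫⁻ g : AxB n, ENNReal.ofReal (Real.exp (-(t * ((g.1 ^ 2 + ‖g.2‖ ^ 2) / 2)))) * 1 =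
      ENNReal.ofReal ((2 * Real.pi / t) ^ (((n : ℝ) + 1) / 2)) := by
    intro t ht
    have ht2 : 0 < t / 2 := by positivity
    have e3 : ∀ g : AxB n, ENNReal.ofReal (Real.exp (-(t * ((g.1 ^ 2 + ‖g.2‖ ^ 2) / 2)))) * 1 =
        ENNReal.ofReal (Real.exp (-(t / 2) * ‖g.1‖ ^ 2)) *
        ENNReal.ofReal (Real.exp (-(t / 2) * ‖g.2‖ ^ 2)) := fun g => by
      rw [mul_one, ← ENNReal.ofReal_mul (Real.exp_nonneg _), ← Real.exp_add, Real.norm_eq_abs,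
        sq_abs]
      ring_nf
    rw [lintegral_congr e3, Measure.volume_eq_prod,
      lintegral_prod_mul (f := fun x : ℝ => ENNReal.ofReal (Real.exp (-(t / 2) * ‖x‖ ^ 2)))
        (g := fun y : EuclideanSpace ℝ (Fin n) =>
          ENNReal.ofReal (Real.exp (-(t / 2) * ‖y‖ ^ 2))) (by fun_prop) (by fun_prop),
      lintegral_exp_neg_norm_sq ht2, lintegral_exp_neg_norm_sq ht2,
      ← ENNReal.ofReal_mul (by positivity), ← Real.rpow_add (by positivity)]
    congr 2
    · field_simp
    · simp
      ring
  have h4 : ∫⁻ t in Ioi (0 : ℝ), ENNReal.ofReal (t ^ (((n : ℝ) + 3) / 2 - 1) * Real.exp (-t)) *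
      ∫⁻ g : AxB n, ENNReal.ofReal (Real.exp (-(t * ((g.1 ^ 2 + ‖g.2‖ ^ 2) / 2)))) * 1 =
      ENNReal.ofReal ((2 * Real.pi) ^ (((n : ℝ) + 1) / 2)) := by
    have h5 := lintegral_rpow_mul_exp (q := 1) (r := 1) one_pos one_pos
    rw [Real.one_rpow, one_mul, Real.Gamma_one, ENNReal.ofReal_one] at h5
    refine Eq.trans ?_ (mul_one _)
    refine Eq.trans ?_ (congrArg _ h5)
    rw [← lintegral_const_mul _ (by fun_prop)]
    refine setLIntegral_congr_fun measurableSet_Ioi fun t ht => ?_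
    have ht0 : (0 : ℝ) < t := ht
    rw [e2 t ht0, ← ENNReal.ofReal_mul (by positivity), ← ENNReal.ofReal_mul (by positivity)]
    congr 1
    rw [Real.div_rpow (by positivity) ht0.le, show ((n : ℝ) + 3) / 2 - 1 = ((n : ℝ) + 1) / 2 by ring]
    have := Real.rpow_pos_of_pos ht0 (((n : ℝ) + 1) / 2)
    field_simp
    simp
  rw [h4] at h
  have h6 := congrArg ENNReal.toReal h
  rw [ENNReal.toReal_mul, ENNReal.toReal_ofReal hG.le, ENNReal.toReal_ofReal (by positivity)] at h6
  rw [← h6, integral_eq_lintegral_of_nonneg_ae]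
  · simp
  · exact .of_forall fun g => by simp only [Pi.zero_apply]; positivity
  · exact (by fun_prop : Measurable fun g : AxB n =>
      (1 + (g.1 ^ 2 + ‖g.2‖ ^ 2) / 2) ^ (-(((n : ℝ) + 3) / 2))).aestronglyMeasurable

/-- The normalisation of the kernel: the factors produced by the blow-up at the identity cancel. -/
theorem kernelConst_normalization {n : ℕ} (hn : 1 ≤ n) {l : ℕ} (hl : -1 < -(n : ℝ) / 2 + l) :
    2 * (kernelConst n l * ((-1) ^ (l + 2) * (2 ^ (-(1 / 2) : ℝ) *
        (Real.Gamma ((l + 2 : ℕ) + 1 / 2) / Real.Gamma (1 / 2))) *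
        ∫ r in Ioi (0 : ℝ), (1 + r) ^ (-(((l + 2 : ℕ) : ℝ) + 1 / 2)) * r ^ (-(n : ℝ) / 2 + l))) *
      ∫ g : AxB n, (1 + (g.1 ^ 2 + ‖g.2‖ ^ 2) / 2) ^ (-(((n : ℝ) + 3) / 2)) = 1 := by
  have hn' : (1 : ℝ) ≤ n := by exact_mod_cast hn
  have h1 := integral_one_add_rpow_mul_rpow hl (q := ((l + 2 : ℕ) : ℝ) + 1 / 2)
    (by push_cast; linarith)
  have h2 := integral_one_add_norm_sq_rpow n
  set I := ∫ g : AxB n, (1 + (g.1 ^ 2 + ‖g.2‖ ^ 2) / 2) ^ (-(((n : ℝ) + 3) / 2))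
  set J := ∫ r in Ioi (0 : ℝ), (1 + r) ^ (-(((l + 2 : ℕ) : ℝ) + 1 / 2)) * r ^ (-(n : ℝ) / 2 + l)
  rw [show ((l + 2 : ℕ) : ℝ) + 1 / 2 - (-(n : ℝ) / 2 + l) - 1 = ((n : ℝ) + 3) / 2 by
    push_cast; ring] at h1
  have hg1 : 0 < Real.Gamma (-(n : ℝ) / 2 + l + 1) := Real.Gamma_pos_of_pos (by linarith)
  have hp : (0 : ℝ) < Real.pi := Real.pi_pos
  have e1 : (2 : ℝ) * 2 ^ (-1 - (n : ℝ) / 2) * 2 ^ (-(1 / 2) : ℝ) * 2 ^ (((n : ℝ) + 1) / 2) = 1 := by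
    nth_rewrite 1 [← Real.rpow_one 2]
    rw [← Real.rpow_add two_pos, ← Real.rpow_add two_pos, ← Real.rpow_add two_pos]
    rw [show (1 : ℝ) + (-1 - (n : ℝ) / 2) + -(1 / 2) + ((n : ℝ) + 1) / 2 = 0 by ring, Real.rpow_zero]
  have e2 : Real.pi ^ (-(n : ℝ) / 2) * Real.pi ^ (((n : ℝ) + 1) / 2) / √Real.pi = 1 := by
    rw [Real.sqrt_eq_rpow, ← Real.rpow_add hp, ← Real.rpow_sub hp,
      show -(n : ℝ) / 2 + ((n : ℝ) + 1) / 2 - 1 / 2 = 0 by ring, Real.rpow_zero]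
  have e3 : ((-1 : ℝ)) ^ l * (-1) ^ (l + 2) = 1 := by
    rw [← pow_add]; exact Even.neg_one_pow ⟨l + 1, by ring⟩
  rw [kernelConst, Real.Gamma_one_half_eq, show 1 - (n : ℝ) / 2 + l = -(n : ℝ) / 2 + l + 1 by ring]
  -- The Beta integral trades `Γ(l + 5/2)` for `Γ(1 - n/2 + l) Γ((n + 3)/2)`. The first of these
  -- cancels the denominator of the kernel constant and the second is used up by the Euclidean
  -- integral; the exponents of `2` and of `π` then add up to zero.
  calc _ = (2 * 2 ^ (-1 - (n : ℝ) / 2) * 2 ^ (-(1 / 2) : ℝ)) * (Real.pi ^ (-(n : ℝ) / 2) / √Real.pi)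
        * ((-1) ^ l * (-1) ^ (l + 2)) *
        (Real.Gamma ((l + 2 : ℕ) + 1 / 2) * J) / Real.Gamma (-(n : ℝ) / 2 + l + 1) * I := by ring
    _ = (2 * 2 ^ (-1 - (n : ℝ) / 2) * 2 ^ (-(1 / 2) : ℝ)) * (Real.pi ^ (-(n : ℝ) / 2) / √Real.pi)
        * (Real.Gamma (((n : ℝ) + 3) / 2) * I) := by
        rw [e3, h1]
        generalize Real.Gamma (-(n : ℝ) / 2 + l + 1) = G at hg1
        have hG := hg1.ne'
        field_simp
    _ = (2 * 2 ^ (-1 - (n : ℝ) / 2) * 2 ^ (-(1 / 2) : ℝ) * 2 ^ (((n : ℝ) + 1) / 2)) *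
        (Real.pi ^ (-(n : ℝ) / 2) * Real.pi ^ (((n : ℝ) + 1) / 2) / √Real.pi) := by
        rw [h2, Real.mul_rpow two_pos.le hp.le]
        ring
    _ = 1 := by rw [e1, e2, one_mul]

end GammaIntegrals

/-! ### The radial profile and the regularized kernel -/

section Profile

variable {n : ℕ}

variable (n) in
/-- The radial profile of the kernel (`m = 0`) and its derivatives, as functions of the level. -/
def profile (ν : ℂ) (m : ℕ) (s : ℝ) : ℂ :=
  kernelConst n (n / 2) * weyl ν (n / 2 + m) (-(n : ℝ) / 2 + (n / 2 : ℕ)) s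

theorem kernel_eq_profile (ν : ℂ) (g : AxB n) :
    kernel ν (n / 2) g = (Real.exp (-(n * g.1 / 2)) : ℂ) * profile n ν 0 (level g) :=
  kernel_eq ν (n / 2) g

theorem hasDerivAt_profile {ν : ℂ} (hν : ν.re ≤ 0) (hn : 1 ≤ n) (m : ℕ) {s : ℝ} (hs : 1 < s) :
    HasDerivAt (profile n ν m) (profile n ν (m + 1) s) s := by
  have hn' : (1 : ℝ) ≤ n := by exact_mod_cast hn
  have hm : (0 : ℝ) ≤ m := m.cast_nonneg
  exact (hasDerivAt_weyl (m := n / 2 + m) hν (neg_half_add_div_two n).1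
    (by push_cast; linarith) hs).const_mul _

theorem profile_ode {ν : ℂ} (hν : ν.re ≤ 0) (hn : 1 ≤ n) {s : ℝ} (hs : 1 < s) :
    ((s : ℂ) ^ 2 - 1) * profile n ν 2 s + (n + 1) * s * profile n ν 1 s
      + ((n : ℂ) ^ 2 / 4 - ν ^ 2) * profile n ν 0 s = 0 := by
  have h := weyl_ode hν hn (neg_half_add_div_two n).1 hs
  simp only [profile, add_zero]
  linear_combination (kernelConst n (n / 2) : ℂ) * h

theorem contDiffOn_profile {ν : ℂ} (hν : ν.re ≤ 0) (hn : 1 ≤ n) (k m : ℕ) :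
    ContDiffOn ℝ k (profile n ν m) (Ioi 1) := by
  have hd : ∀ m, DifferentiableOn ℝ (profile n ν m) (Ioi 1) := fun m s hs =>
    (hasDerivAt_profile hν hn m hs).differentiableAt.differentiableWithinAt
  induction k generalizing m with
  | zero => exact contDiffOn_zero.2 (hd m).continuousOn
  | succ k ih =>
    push_cast
    rw [contDiffOn_succ_iff_deriv_of_isOpen isOpen_Ioi]
    refine ⟨hd m, by simp, (ih (m + 1)).congr fun s hs => (hasDerivAt_profile hν hn m hs).deriv⟩

theorem contDiff_profile_level {ν : ℂ} (hν : ν.re ≤ 0) (hn : 1 ≤ n) (k m : ℕ) {ε : ℝ} (hε : 0 < ε) :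
    ContDiff ℝ k fun g : AxB n => profile n ν m (level g + ε) :=
  (contDiffOn_profile hν hn k m).comp_contDiff
    (((contDiff_level (n := n)).of_le (by exact_mod_cast le_top)).add contDiff_const)
    fun g => by
      have := one_le_level g
      simp only [mem_Ioi]
      linarith

/-- With `θ = 0` the power of `s - 1` is the exact order of the singularity at `1`. At least one
derivative is taken because for `n = 1` the choice `θ = 0` is not available for the profile itself.
-/
theorem norm_profile_succ_le {ν : ℂ} (hν : ν.re ≤ 0) (hn : 1 ≤ n) (m : ℕ) :
    ∃ C : ℝ, 0 ≤ C ∧ ∀ s : ℝ, 1 < s →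
      ‖profile n ν (m + 1) s‖ ≤ C * (s - 1) ^ (-((n : ℝ) + 1) / 2 - m) := by
  have hn' : (1 : ℝ) ≤ n := by exact_mod_cast hn
  have hm : (0 : ℝ) ≤ m := m.cast_nonneg
  obtain ⟨C, hC, h⟩ := norm_weyl_le (n / 2 + (m + 1)) (neg_half_add_div_two n).1 (θ := 0) le_rfl
    (by norm_num) (by push_cast; linarith)
  refine ⟨|kernelConst n (n / 2)| * (C * (1 + ‖ν‖) ^ (n / 2 + (m + 1))), by positivity,
    fun s hs => ?_⟩
  have h1 := h ν hν s hs
  have hs1 : 0 < s - 1 := by linarith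
  have h2 : Real.exp (ν.re * Real.arcosh s) ≤ 1 := by
    rw [Real.exp_le_one_iff]
    exact mul_nonpos_of_nonpos_of_nonneg hν (Real.arcosh_nonneg hs.le)
  have h3 : s ^ (-(1 / 2) + 0 : ℝ) ≤ 1 := Real.rpow_le_one_of_one_le_of_nonpos hs.le (by norm_num)
  rw [show -(n : ℝ) / 2 + (n / 2 : ℕ) + 1 / 2 - ((n / 2 + (m + 1) : ℕ) : ℝ) - 0 =
    -((n : ℝ) + 1) / 2 - m by push_cast; ring] at h1
  rw [profile, norm_mul, Complex.norm_real, Real.norm_eq_abs, mul_assoc]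
  refine mul_le_mul_of_nonneg_left (h1.trans ?_) (abs_nonneg _)
  have h4 : 0 < (s - 1) ^ (-((n : ℝ) + 1) / 2 - m) := Real.rpow_pos_of_pos hs1 _
  calc _ ≤ C * (1 + ‖ν‖) ^ (n / 2 + (m + 1)) * 1 * (1 * (s - 1) ^ (-((n : ℝ) + 1) / 2 - m)) := by
        gcongr
    _ = _ := by ring

/-- Each factor of the bound decreases in the level, so shifting the level by `ε ≥ 0` keeps the same
majorant. This dominates the limit `ε → 0`. -/
theorem norm_profile_zero_le {ν : ℂ} (hν : ν.re ≤ 0) (hn : 1 ≤ n) :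
    ∃ C : ℝ, 0 ≤ C ∧ ∀ g : AxB n, g ≠ 1 → ∀ ε : ℝ, 0 ≤ ε →
      ‖profile n ν 0 (level g + ε)‖ ≤ C * radialMajorant n ν.re (radius g) := by
  have hn' : (1 : ℝ) ≤ n := by exact_mod_cast hn
  have ha := neg_half_add_div_two n
  obtain ⟨C, hC, h⟩ := norm_weyl_le (n / 2 + 0) ha.1 (θ := 1 / 4) (by norm_num)
    (by norm_num) (by push_cast; linarith)
  refine ⟨|kernelConst n (n / 2)| * (C * (1 + ‖ν‖) ^ (n / 2 + 0)), by positivity,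
    fun g hg ε hε => ?_⟩
  have hu := one_lt_level hg
  have hs : 1 < level g + ε := by linarith
  have h1 := h ν hν _ hs
  rw [show -(n : ℝ) / 2 + (n / 2 : ℕ) + 1 / 2 - ((n / 2 + 0 : ℕ) : ℝ) - 1 / 4 =
    1 / 4 - (n : ℝ) / 2 by push_cast; ring, show -(1 / 2) + 1 / 4 = (-(1 / 4) : ℝ) by norm_num] at h1
  rw [profile, norm_mul, Complex.norm_real, Real.norm_eq_abs, mul_assoc]
  refine mul_le_mul_of_nonneg_left (h1.trans ?_) (abs_nonneg _)
  have h2 : Real.arcosh (level g) ≤ Real.arcosh (level g + ε) :=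
    (Real.arcosh_le_arcosh (by linarith) (by linarith)).2 (by linarith)
  have h3 : Real.exp (ν.re * Real.arcosh (level g + ε)) ≤ Real.exp (ν.re * radius g) :=
    Real.exp_le_exp.2 (mul_le_mul_of_nonpos_left h2 hν)
  have h4 : (level g + ε) ^ (-(1 / 4) : ℝ) ≤ level g ^ (-(1 / 4) : ℝ) :=
    Real.rpow_le_rpow_of_nonpos (by linarith) (by linarith) (by norm_num)
  have h5 : (level g + ε - 1) ^ (1 / 4 - (n : ℝ) / 2) ≤ (level g - 1) ^ (1 / 4 - (n : ℝ) / 2) :=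
    Real.rpow_le_rpow_of_nonpos (by linarith) (by linarith) (by linarith)
  have h6 : 0 ≤ (level g + ε - 1) ^ (1 / 4 - (n : ℝ) / 2) :=
    Real.rpow_nonneg (by linarith) _
  have h7 : 0 ≤ level g ^ (-(1 / 4) : ℝ) := Real.rpow_nonneg (by linarith) _
  rw [radialMajorant, cosh_radius, mul_assoc]
  gcongr

theorem tendsto_profile_two {ν : ℂ} (hν : ν.re ≤ 0) (hn : 1 ≤ n) :
    Tendsto (fun σ : ℝ => ((σ ^ (((n : ℝ) + 3) / 2) : ℝ) : ℂ) * profile n ν 2 (1 + σ)) (𝓝[>] 0)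
      (𝓝 ((kernelConst n (n / 2) * ((-1) ^ (n / 2 + 2) * (2 ^ (-(1 / 2) : ℝ) *
        (Real.Gamma ((n / 2 + 2 : ℕ) + 1 / 2) / Real.Gamma (1 / 2))) *
        ∫ r in Ioi (0 : ℝ), (1 + r) ^ (-(((n / 2 + 2 : ℕ) : ℝ) + 1 / 2)) *
          r ^ (-(n : ℝ) / 2 + (n / 2 : ℕ))) : ℝ) : ℂ)) := by
  have hn' : (1 : ℝ) ≤ n := by exact_mod_cast hn
  have h := (tendsto_weyl hν (m := n / 2 + 2) (neg_half_add_div_two n).1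
    (by push_cast; linarith)).const_mul (kernelConst n (n / 2) : ℂ)
  rw [← Complex.ofReal_mul, show ((n / 2 + 2 : ℕ) : ℝ) - 1 / 2 - (-(n : ℝ) / 2 + (n / 2 : ℕ)) =
    ((n : ℝ) + 3) / 2 by push_cast; ring] at h
  refine h.congr fun σ => ?_
  rw [profile]
  ring

theorem tendsto_profile_one {ν : ℂ} (hν : ν.re ≤ 0) (hn : 1 ≤ n) :
    Tendsto (fun σ : ℝ => ((σ ^ (((n : ℝ) + 3) / 2) : ℝ) : ℂ) * profile n ν 1 (1 + σ)) (𝓝[>] 0)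
      (𝓝 0) := by
  obtain ⟨C, hC, h⟩ := norm_profile_succ_le hν hn 0
  have h0 : Tendsto (fun σ : ℝ => C * σ) (𝓝[>] 0) (𝓝 0) := by
    have : Tendsto (fun σ : ℝ => C * σ) (𝓝 0) (𝓝 (C * 0)) := tendsto_id.const_mul C
    rw [mul_zero] at this
    exact this.mono_left nhdsWithin_le_nhds
  refine squeeze_zero_norm' ?_ h0
  filter_upwards [self_mem_nhdsWithin] with σ hσ
  have hσ0 : (0 : ℝ) < σ := hσ
  have h1 := h (1 + σ) (by linarith)
  rw [add_sub_cancel_left] at h1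
  rw [norm_mul, Complex.norm_real, Real.norm_of_nonneg (by positivity)]
  calc _ ≤ σ ^ (((n : ℝ) + 3) / 2) * (C * σ ^ (-((n : ℝ) + 1) / 2 - (0 : ℕ))) := by gcongr
    _ = C * (σ ^ (((n : ℝ) + 3) / 2) * σ ^ (-((n : ℝ) + 1) / 2 - (0 : ℕ))) := by ring
    _ = C * σ := by
        rw [← Real.rpow_add hσ0]
        congr 1
        rw [show ((n : ℝ) + 3) / 2 + (-((n : ℝ) + 1) / 2 - (0 : ℕ)) = 1 by push_cast; ring,
          Real.rpow_one]

/-- The profile satisfies its equation with coefficients taken at `level g + ε`, whereas `lap`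
produces coefficients at `level g`. The differences are `(u + ε)² - u² = ε (2 u + ε)` and `(n + 1)
ε`, so the error carries an explicit factor `ε`. -/
theorem lap_regularized_kernel {ν : ℂ} (hν : ν.re ≤ 0) (hn : 1 ≤ n) {ε : ℝ} (hε : 0 < ε)
    (g : AxB n) :
    lap (fun g : AxB n => (Real.exp (-(n * g.1 / 2)) : ℂ) * profile n ν 0 (level g + ε)) g
      + ν ^ 2 * ((Real.exp (-(n * g.1 / 2)) : ℂ) * profile n ν 0 (level g + ε)) =
    ε * ((Real.exp (-(n * g.1 / 2)) : ℂ) * ((2 * level g + ε) * profile n ν 2 (level g + ε)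
      + (n + 1) * profile n ν 1 (level g + ε))) := by
  have hd : ∀ m s, 1 ≤ s → HasDerivAt (fun t => profile n ν m (t + ε))
      (profile n ν (m + 1) (s + ε)) s := fun m s hs =>
    (hasDerivAt_profile hν hn m (by linarith)).comp_add_const s ε
  have h1 := lap_exp_mul_comp_level (hd 0) (hd 1) g
  have h2 := profile_ode hν hn (s := level g + ε) (by linarith [one_le_level g])
  simp only [zero_add, Nat.reduceAdd] at h1
  rw [h1]
  push_cast at h2
  linear_combination -(Real.exp (-(n * g.1 / 2)) : ℂ) * h2

theorem contDiff_lap {φ : AxB n → ℂ} (h : ContDiff ℝ ∞ φ) : ContDiff ℝ ∞ (lap φ) :=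
  (contDiff_X (contDiff_X h)).neg.sub (ContDiff.sum fun j _ => contDiff_Y j (contDiff_Y j h))

theorem hasCompactSupport_lap {φ : AxB n → ℂ} (h : HasCompactSupport φ) :
    HasCompactSupport (lap φ) := by
  refine h.mono' fun g hg => ?_
  by_contra hg'
  have h0 : φ =ᶠ[𝓝 g] 0 := notMem_tsupport_iff_eventuallyEq.1 hg'
  have hX : ∀ {φ : AxB n → ℂ}, φ =ᶠ[𝓝 g] 0 → X φ =ᶠ[𝓝 g] 0 := fun {φ} h0 => by
    filter_upwards [h0.eventuallyEq_nhds] with p hp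
    simp [X, hp.fderiv_eq]
  have hY : ∀ j, ∀ {φ : AxB n → ℂ}, φ =ᶠ[𝓝 g] 0 → Y j φ =ᶠ[𝓝 g] 0 := fun j {φ} h0 => by
    filter_upwards [h0.eventuallyEq_nhds] with p hp
    simp [Y, hp.fderiv_eq]
  refine hg ?_
  have e1 : X (X φ) g = 0 := (hX (hX h0)).eq_of_nhds
  have e2 : ∀ j, Y j (Y j φ) g = 0 := fun j => (hY j (hY j h0)).eq_of_nhds
  simp [lap, e1, e2]

/-- The shift by `ε` keeps the profile away from its singularity at `1`, so the regularized kernel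
is `C²` on the whole group and Green's formula applies without a boundary term. -/
theorem integral_lap_add_mul_regularized_kernel {ν : ℂ} (hν : ν.re ≤ 0) (hn : 1 ≤ n) {ε : ℝ}
    (hε : 0 < ε) {ψ : AxB n → ℂ} (hψ : ContDiff ℝ ∞ ψ) (hc : HasCompactSupport ψ) :
    ∫ g, (lap ψ g + ν ^ 2 * ψ g) *
        ((Real.exp (-(n * g.1 / 2)) : ℂ) * profile n ν 0 (level g + ε)) =
    ε * ∫ g, ψ g * (Real.exp (-(n * g.1 / 2)) : ℂ) *
      ((2 * level g + ε) * profile n ν 2 (level g + ε)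
      + (n + 1) * profile n ν 1 (level g + ε)) := by
  set k : AxB n → ℂ := fun g => (Real.exp (-(n * g.1 / 2)) : ℂ) * profile n ν 0 (level g + ε) with hk
  have hk2 : ContDiff ℝ 2 k := by
    refine ContDiff.mul ?_ (contDiff_profile_level hν hn 2 0 hε)
    exact Complex.ofRealCLM.contDiff.comp (Real.contDiff_exp.comp
      ((contDiff_const.mul contDiff_fst).div_const 2).neg)
  have h1 := integral_lap_mul_comm hk2 (by exact_mod_cast contDiff_infty.1 hψ 2) hc
  have hlk : Continuous (lap k) := by
    have hX : Continuous (X (X k)) :=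
      (contDiff_X_of_succ (k := 0) (contDiff_X_of_succ (k := 1) hk2)).continuous
    have hY : ∀ j, Continuous (Y j (Y j k)) := fun j =>
      (contDiff_Y_of_succ (k := 0) j (contDiff_Y_of_succ (k := 1) j hk2)).continuous
    exact hX.neg.sub (continuous_finsetSum _ fun j _ => hY j)
  have i1 : Integrable fun g => k g * lap ψ g :=
    (hk2.continuous.mul (contDiff_lap hψ).continuous).integrable_of_hasCompactSupport
      (hasCompactSupport_lap hc).mul_left
  have i2 : Integrable fun g => ν ^ 2 * (k g * ψ g) :=
    ((hk2.continuous.mul hψ.continuous).integrable_of_hasCompactSupport hc.mul_left).const_mul _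
  have i3 : Integrable fun g => lap k g * ψ g :=
    (hlk.mul hψ.continuous).integrable_of_hasCompactSupport hc.mul_left
  calc ∫ g, (lap ψ g + ν ^ 2 * ψ g) * k g = ∫ g, (k g * lap ψ g + ν ^ 2 * (k g * ψ g)) := by
        refine integral_congr_ae (.of_forall fun g => ?_)
        simp only
        ring
    _ = ∫ g, (lap k g * ψ g + ν ^ 2 * (k g * ψ g)) := by
        rw [integral_add i1 i2, ← h1, integral_add i3 i2]
    _ = ∫ g, (ε : ℂ) * (ψ g * (Real.exp (-(n * g.1 / 2)) : ℂ) *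
        ((2 * level g + ε) * profile n ν 2 (level g + ε)
        + (n + 1) * profile n ν 1 (level g + ε))) := by
        refine integral_congr_ae (.of_forall fun g => ?_)
        simp only
        linear_combination ψ g * lap_regularized_kernel hν hn hε g
    _ = _ := integral_const_mul _ _

theorem tendsto_integral_mul_regularized_kernel {ν : ℂ} (hν : ν.re < 0) (hn : 1 ≤ n)
    {φ : AxB n → ℂ} (hφ : Continuous φ) (hc : HasCompactSupport φ) :
    Tendsto (fun ε : ℝ => ∫ g, φ g *
        ((Real.exp (-(n * g.1 / 2)) : ℂ) * profile n ν 0 (level g + ε))) (𝓝[>] 0)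
      (𝓝 (∫ g, φ g * kernel ν (n / 2) g)) := by
  obtain ⟨C, hC, h⟩ := norm_profile_zero_le hν.le hn
  obtain ⟨M, hM⟩ := hφ.bounded_above_of_compact_support hc
  have hM0 : 0 ≤ M := (norm_nonneg _).trans (hM 1)
  refine tendsto_integral_filter_of_dominated_convergence
    (fun g => M * C * (Real.exp (-(n * g.1 / 2)) * radialMajorant n ν.re (radius g))) ?_ ?_
    ((integrable_radialMajorant hν hn).const_mul _) ?_
  · filter_upwards [self_mem_nhdsWithin] with ε hε
    have h1 := (contDiff_profile_level (n := n) hν.le hn 0 0 hε).continuous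
    exact (hφ.mul (Continuous.mul (by fun_prop) h1)).aestronglyMeasurable
  · filter_upwards [self_mem_nhdsWithin] with ε hε
    filter_upwards [ae_ne_one] with g hg
    have h1 := h g hg ε (le_of_lt hε)
    rw [norm_mul, norm_mul, Complex.norm_real, Real.norm_of_nonneg (Real.exp_nonneg _)]
    calc _ ≤ M * (Real.exp (-(n * g.1 / 2)) * (C * radialMajorant n ν.re (radius g))) :=
          mul_le_mul (hM g) (mul_le_mul_of_nonneg_left h1 (Real.exp_nonneg _)) (by positivity) hM0
      _ = _ := by ring
  · filter_upwards [ae_ne_one] with g hg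
    rw [kernel_eq_profile]
    refine (Tendsto.const_mul _ ?_).const_mul _
    have h1 := (hasDerivAt_profile hν.le hn 0 (one_lt_level hg)).continuousAt
    have h2 : Tendsto (fun ε : ℝ => level g + ε) (𝓝[>] 0) (𝓝 (level g)) := by
      have : Tendsto (fun ε : ℝ => level g + ε) (𝓝 0) (𝓝 (level g + 0)) :=
        tendsto_const_nhds.add tendsto_id
      rw [add_zero] at this
      exact this.mono_left nhdsWithin_le_nhds
    exact h1.tendsto.comp h2

end Profile

/-! ### Blow-up at the identity: the kernel is a fundamental solution -/

section FundamentalSolution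

variable {n : ℕ}

theorem half_sq_le_cosh_sub_one (x : ℝ) : x ^ 2 / 2 ≤ Real.cosh x - 1 := by
  have h1 : |x| / 2 ≤ Real.sinh (|x| / 2) := Real.self_le_sinh_iff.2 (by positivity)
  have h2 : Real.cosh x = 1 + 2 * Real.sinh (|x| / 2) ^ 2 := by
    rw [← Real.cosh_abs, show |x| = 2 * (|x| / 2) by ring, Real.cosh_two_mul, Real.cosh_sq]
    ring_nf
  have h3 : (|x| / 2) ^ 2 ≤ Real.sinh (|x| / 2) ^ 2 := by gcongr
  rw [div_pow, sq_abs] at h3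
  linarith

/-- On bounded sets `ch R - 1` dominates a multiple of the squared Euclidean norm. This gives a
majorant in the blow-up that is uniform in the scale. -/
theorem le_level_sub_one {M : ℝ} (hM : 0 ≤ M) {g : AxB n} (hg : ‖g‖ ≤ M) :
    Real.exp (-M) / 2 * ‖g‖ ^ 2 ≤ level g - 1 := by
  have h1 : |g.1| ≤ M := by
    have := (norm_fst_le g).trans hg
    rwa [Real.norm_eq_abs] at this
  have h2 := half_sq_le_cosh_sub_one g.1
  have h3 : Real.exp (-M) ≤ Real.exp (-g.1) := Real.exp_le_exp.2 (by linarith [le_abs_self g.1])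
  have h4 : Real.exp (-M) ≤ 1 := Real.exp_le_one_iff.2 (by linarith)
  have h5 : ‖g‖ ^ 2 ≤ g.1 ^ 2 + ‖g.2‖ ^ 2 := by
    rcases max_cases ‖g.1‖ ‖g.2‖ with ⟨h, -⟩ | ⟨h, -⟩ <;> rw [Prod.norm_def, h]
    · rw [Real.norm_eq_abs, sq_abs]
      nlinarith [sq_nonneg ‖g.2‖]
    · nlinarith [sq_nonneg g.1]
  have h6 : 0 < Real.exp (-M) := Real.exp_pos _
  have h7 : Real.exp (-M) / 2 * ‖g‖ ^ 2 ≤ Real.exp (-M) / 2 * (g.1 ^ 2 + ‖g.2‖ ^ 2) := by gcongr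
  have h8 : Real.exp (-M) * g.1 ^ 2 ≤ 1 * g.1 ^ 2 := by gcongr
  have h9 : Real.exp (-M) * ‖g.2‖ ^ 2 ≤ Real.exp (-g.1) * ‖g.2‖ ^ 2 := by gcongr
  rw [level]
  nlinarith

/-- At small scales the geometry is Euclidean: `ch R - 1` is asymptotic to half the squared
Euclidean length. The summand `δ²` is the regularization parameter `ε` at the matching scale. -/
theorem tendsto_level_smul (g : AxB n) :
    Tendsto (fun δ : ℝ => (level (δ • g) - 1 + δ ^ 2) / δ ^ 2) (𝓝[>] 0)
      (𝓝 (1 + (g.1 ^ 2 + ‖g.2‖ ^ 2) / 2)) := by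
  have h1 : Tendsto (fun δ : ℝ => Real.sinh (δ * (g.1 / 2)) / δ) (𝓝[>] 0) (𝓝 (g.1 / 2)) := by
    have hd : HasDerivAt (fun δ : ℝ => Real.sinh (δ * (g.1 / 2))) (g.1 / 2) 0 := by
      have := (Real.hasDerivAt_sinh (0 * (g.1 / 2))).comp (0 : ℝ)
        ((hasDerivAt_id (0 : ℝ)).mul_const (g.1 / 2))
      simpa [Function.comp_def] using this
    have h2 := hd.tendsto_slope.mono_left (nhdsWithin_mono 0 fun x (hx : 0 < x) => hx.ne')
    refine h2.congr fun δ => ?_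
    simp [slope_def_field]
  have h2 : Tendsto (fun δ : ℝ => Real.exp (-(δ * g.1))) (𝓝[>] 0) (𝓝 1) := by
    have : Continuous fun δ : ℝ => Real.exp (-(δ * g.1)) := by fun_prop
    have h := this.tendsto 0
    simp only [zero_mul, neg_zero, Real.exp_zero] at h
    exact h.mono_left nhdsWithin_le_nhds
  have h3 := ((h1.pow 2).const_mul 2).add ((h2.const_mul (1 / 2 * ‖g.2‖ ^ 2)).const_add 1)
  rw [show 2 * (g.1 / 2) ^ 2 + (1 + 1 / 2 * ‖g.2‖ ^ 2 * 1) = 1 + (g.1 ^ 2 + ‖g.2‖ ^ 2) / 2 by ring]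
    at h3
  refine h3.congr' ?_
  filter_upwards [self_mem_nhdsWithin] with δ hδ
  have hδ0 : δ ≠ 0 := ne_of_gt hδ
  have e1 : Real.cosh (δ * g.1) = 1 + 2 * Real.sinh (δ * (g.1 / 2)) ^ 2 := by
    rw [show δ * g.1 = 2 * (δ * (g.1 / 2)) by ring, Real.cosh_two_mul, Real.cosh_sq]
    ring
  have e2 : level (δ • g) = 1 + 2 * Real.sinh (δ * (g.1 / 2)) ^ 2 +
      1 / 2 * (δ ^ 2 * ‖g.2‖ ^ 2) * Real.exp (-(δ * g.1)) := by
    rw [level, Prod.smul_fst, Prod.smul_snd, norm_smul, smul_eq_mul, e1, mul_pow, Real.norm_eq_abs,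
      sq_abs]
  rw [e2]
  field_simp
  ring

theorem tendsto_level_smul_nhdsGT (g : AxB n) :
    Tendsto (fun δ : ℝ => level (δ • g) - 1 + δ ^ 2) (𝓝[>] 0) (𝓝[>] 0) := by
  refine tendsto_nhdsWithin_iff.2 ⟨?_, ?_⟩
  · have : Continuous fun δ : ℝ => level (δ • g) - 1 + δ ^ 2 :=
      ((continuous_level.comp (by fun_prop : Continuous fun δ : ℝ => δ • g)).sub continuous_const).add
        (by fun_prop)
    have h := this.tendsto 0
    have e : level ((0 : ℝ) • g) - 1 + 0 ^ 2 = 0 := by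
      rw [zero_smul, ← Prod.mk_zero_zero, ← one_def, level_one]; ring
    rw [e] at h
    exact h.mono_left nhdsWithin_le_nhds
  · filter_upwards [self_mem_nhdsWithin] with δ hδ
    have h1 := one_le_level (δ • g)
    have h2 : 0 < δ ^ 2 := pow_pos hδ 2
    simp only [mem_Ioi]
    linarith

/-- The factor multiplying the test function in the blow-up at scale `δ` of the distribution
`(lap + ν²) k_ε`, `ε = δ²`. -/
def blowup (n : ℕ) (ν : ℂ) (δ u : ℝ) : ℂ :=
  (2 * u + (δ ^ 2 : ℝ)) * profile n ν 2 (u + δ ^ 2) + (n + 1) * profile n ν 1 (u + δ ^ 2)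

theorem pow_mul_rpow_div {δ σ : ℝ} (hδ : 0 < δ) (hσ : 0 < σ) (n : ℕ) :
    (σ / δ ^ 2) ^ (-(((n : ℝ) + 3) / 2)) * σ ^ (((n : ℝ) + 3) / 2) = δ ^ (n + 3) := by
  have h1 : (δ ^ 2) ^ (((n : ℝ) + 3) / 2) = δ ^ (n + 3) := by
    rw [← Real.rpow_natCast δ 2, ← Real.rpow_mul hδ.le, ← Real.rpow_natCast]
    congr 1
    push_cast
    ring
  have h2 : 0 < σ ^ (((n : ℝ) + 3) / 2) := Real.rpow_pos_of_pos hσ _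
  rw [Real.rpow_neg (by positivity), Real.div_rpow hσ.le (by positivity), h1]
  field_simp

/-- The second derivative of the profile has exactly the scaling order `-(n + 3)/2`. The first
derivative is better by one power of `σ`, and `σ ≤ U` because the level is bounded on the support of
the test function. -/
theorem norm_blowup_le {ν : ℂ} (hν : ν.re ≤ 0) (hn : 1 ≤ n) {U : ℝ} (hU : 1 ≤ U) :
    ∃ C : ℝ, 0 ≤ C ∧ ∀ δ : ℝ, 0 < δ → δ < 1 → ∀ u : ℝ, 1 ≤ u → u ≤ U →
      δ ^ (n + 3) * ‖blowup n ν δ u‖ ≤ C * ((u - 1 + δ ^ 2) / δ ^ 2) ^ (-(((n : ℝ) + 3) / 2)) := by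
  obtain ⟨C₁, hC₁, h₁⟩ := norm_profile_succ_le hν hn 0
  obtain ⟨C₂, hC₂, h₂⟩ := norm_profile_succ_le hν hn 1
  refine ⟨(2 * U + 1) * C₂ + (n + 1) * (C₁ * U), by positivity, fun δ hδ hδ1 u hu huU => ?_⟩
  have hδ2 : 0 < δ ^ 2 := by positivity
  have hδ3 : δ ^ 2 ≤ 1 := by nlinarith
  set σ := u - 1 + δ ^ 2 with hσ
  have hσ0 : 0 < σ := by linarith
  have hσU : σ ≤ U := by linarith
  have hp : 0 < σ ^ (((n : ℝ) + 3) / 2) := Real.rpow_pos_of_pos hσ0 _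
  have b1 := h₁ (u + δ ^ 2) (by linarith)
  have b2 := h₂ (u + δ ^ 2) (by linarith)
  rw [show u + δ ^ 2 - 1 = σ by rw [hσ]; ring] at b1 b2
  have e2 : σ ^ (((n : ℝ) + 3) / 2) * σ ^ (-((n : ℝ) + 1) / 2 - (1 : ℕ)) = 1 := by
    rw [← Real.rpow_add hσ0, show ((n : ℝ) + 3) / 2 + (-((n : ℝ) + 1) / 2 - (1 : ℕ)) = 0 by
      push_cast; ring, Real.rpow_zero]
  have e1 : σ ^ (((n : ℝ) + 3) / 2) * σ ^ (-((n : ℝ) + 1) / 2 - (0 : ℕ)) = σ := by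
    rw [← Real.rpow_add hσ0, show ((n : ℝ) + 3) / 2 + (-((n : ℝ) + 1) / 2 - (0 : ℕ)) = 1 by
      push_cast; ring, Real.rpow_one]
  have h3 : ‖blowup n ν δ u‖ ≤ (2 * U + 1) * (C₂ * σ ^ (-((n : ℝ) + 1) / 2 - (1 : ℕ))) +
      (n + 1) * (C₁ * σ ^ (-((n : ℝ) + 1) / 2 - (0 : ℕ))) := by
    have c1 : ‖(2 * (u : ℂ) + (δ ^ 2 : ℝ))‖ ≤ 2 * U + 1 := by
      rw [show (2 * (u : ℂ) + (δ ^ 2 : ℝ)) = ((2 * u + δ ^ 2 : ℝ) : ℂ) by push_cast; ring,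
        Complex.norm_real, Real.norm_of_nonneg (by linarith)]
      linarith
    have c2 : ‖((n : ℂ) + 1)‖ = n + 1 := by
      rw [show ((n : ℂ) + 1) = ((n + 1 : ℝ) : ℂ) by push_cast; ring,
        Complex.norm_real, Real.norm_of_nonneg (by positivity)]
    refine (norm_add_le _ _).trans ?_
    rw [norm_mul, norm_mul, c2]
    gcongr
  rw [← pow_mul_rpow_div hδ hσ0 n]
  have hq : 0 ≤ (σ / δ ^ 2) ^ (-(((n : ℝ) + 3) / 2)) := Real.rpow_nonneg (by positivity) _
  calc _ ≤ (σ / δ ^ 2) ^ (-(((n : ℝ) + 3) / 2)) * σ ^ (((n : ℝ) + 3) / 2) *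
        ((2 * U + 1) * (C₂ * σ ^ (-((n : ℝ) + 1) / 2 - (1 : ℕ))) +
      (n + 1) * (C₁ * σ ^ (-((n : ℝ) + 1) / 2 - (0 : ℕ)))) := by gcongr
    _ = (σ / δ ^ 2) ^ (-(((n : ℝ) + 3) / 2)) *
        ((2 * U + 1) * C₂ * (σ ^ (((n : ℝ) + 3) / 2) * σ ^ (-((n : ℝ) + 1) / 2 - (1 : ℕ))) +
        (n + 1) * C₁ * (σ ^ (((n : ℝ) + 3) / 2) * σ ^ (-((n : ℝ) + 1) / 2 - (0 : ℕ)))) := by ring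
    _ = (σ / δ ^ 2) ^ (-(((n : ℝ) + 3) / 2)) * ((2 * U + 1) * C₂ + (n + 1) * C₁ * σ) := by
        rw [e1, e2, mul_one]
    _ ≤ (σ / δ ^ 2) ^ (-(((n : ℝ) + 3) / 2)) * ((2 * U + 1) * C₂ + (n + 1) * C₁ * U) := by gcongr
    _ = _ := by ring

theorem tendsto_blowup {ν : ℂ} (hν : ν.re ≤ 0) (hn : 1 ≤ n) {c : ℂ}
    (hc : Tendsto (fun σ : ℝ => ((σ ^ (((n : ℝ) + 3) / 2) : ℝ) : ℂ) * profile n ν 2 (1 + σ))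
      (𝓝[>] 0) (𝓝 c)) (g : AxB n) :
    Tendsto (fun δ : ℝ => ((δ ^ (n + 3) : ℝ) : ℂ) * blowup n ν δ (level (δ • g))) (𝓝[>] 0)
      (𝓝 ((((1 + (g.1 ^ 2 + ‖g.2‖ ^ 2) / 2) ^ (-(((n : ℝ) + 3) / 2)) : ℝ) : ℂ) * (2 * c))) := by
  have hσ := tendsto_level_smul_nhdsGT g
  have h1 := hc.comp hσ
  have h2 := (tendsto_profile_one hν hn).comp hσ
  have hpos : 1 + (g.1 ^ 2 + ‖g.2‖ ^ 2) / 2 ≠ 0 := by positivity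
  have h3 : Tendsto (fun δ : ℝ => ((((level (δ • g) - 1 + δ ^ 2) / δ ^ 2)
      ^ (-(((n : ℝ) + 3) / 2)) : ℝ) : ℂ)) (𝓝[>] 0)
      (𝓝 (((1 + (g.1 ^ 2 + ‖g.2‖ ^ 2) / 2) ^ (-(((n : ℝ) + 3) / 2)) : ℝ) : ℂ)) :=
    (Complex.continuous_ofReal.tendsto _).comp
      ((tendsto_level_smul g).rpow_const (Or.inl hpos))
  have h4 : Tendsto (fun δ : ℝ => (2 * (level (δ • g) : ℂ) + (δ ^ 2 : ℝ))) (𝓝[>] 0) (𝓝 2) := by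
    have : Continuous fun δ : ℝ => (2 * (level (δ • g) : ℂ) + (δ ^ 2 : ℝ)) :=
      (continuous_const.mul (Complex.continuous_ofReal.comp
        (continuous_level.comp (by fun_prop : Continuous fun δ : ℝ => δ • g)))).add (by fun_prop)
    have h := this.tendsto 0
    rw [zero_smul, ← Prod.mk_zero_zero, ← one_def, level_one] at h
    simp only [Complex.ofReal_one, mul_one, ne_eq, OfNat.ofNat_ne_zero, not_false_eq_true, zero_pow,
      Complex.ofReal_zero, add_zero] at h
    exact h.mono_left nhdsWithin_le_nhds
  have h5 := h3.mul ((h4.mul h1).add (h2.const_mul ((n : ℂ) + 1)))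
  rw [mul_zero, add_zero] at h5
  refine h5.congr' ?_
  filter_upwards [self_mem_nhdsWithin] with δ hδ
  have hδ0 : (0 : ℝ) < δ := hδ
  have hσ0 : 0 < level (δ • g) - 1 + δ ^ 2 := by
    have := one_le_level (δ • g)
    have h2 : 0 < δ ^ 2 := by positivity
    linarith
  rw [← pow_mul_rpow_div hδ0 hσ0 n]
  simp only [Function.comp_apply, blowup]
  rw [show 1 + (level (δ • g) - 1 + δ ^ 2) = level (δ • g) + δ ^ 2 by ring]
  push_cast
  ring

theorem integrable_one_add_norm_sq_rpow :
    Integrable fun g : AxB n => ((1 : ℝ) + ‖g‖ ^ 2) ^ (-(((n : ℝ) + 3) / 2)) := by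
  have h := integrable_rpow_neg_one_add_norm_sq (E := AxB n) (μ := volume) (r := (n : ℝ) + 3)
    (by simp; linarith)
  rw [show -((n : ℝ) + 3) / 2 = -(((n : ℝ) + 3) / 2) by ring] at h
  exact h

/-- Dilation by `δ` contributes the Jacobian `δ^{n+1}`, which together with `ε = δ²` gives
`δ^{n+3}`, the scaling order of `blowup`. The rescaled integrands converge to `ψ(1)` times a
multiple of `(1 + (x² + ‖y‖²)/2)^{-(n+3)/2}`, whose total mass is `1` by
`kernelConst_normalization`; they are dominated by a multiple of `(1 + ‖g‖²)^{-(n+3)/2}`, integrable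
in dimension `n + 1`. -/
theorem tendsto_integral_blowup {ν : ℂ} (hν : ν.re < 0) (hn : 1 ≤ n)
    {ψ : AxB n → ℂ} (hψ : Continuous ψ) (hc : HasCompactSupport ψ) :
    Tendsto (fun δ : ℝ => ((δ ^ 2 : ℝ) : ℂ) * ∫ g, ψ g * (Real.exp (-(n * g.1 / 2)) : ℂ) *
      blowup n ν δ (level g)) (𝓝[>] 0) (𝓝 (ψ 1)) := by
  set F : AxB n → ℂ := fun g => ψ g * (Real.exp (-(n * g.1 / 2)) : ℂ) with hF
  have hFc : Continuous F := hψ.mul (by fun_prop)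
  have hFs : HasCompactSupport F := hc.mul_right
  obtain ⟨B, hB⟩ := hFc.bounded_above_of_compact_support hFs
  have hB0 : 0 ≤ B := (norm_nonneg _).trans (hB 1)
  obtain ⟨M, hM⟩ := hFs.isCompact.isBounded.exists_norm_le
  obtain ⟨U, hU⟩ := hFs.isCompact.exists_bound_of_continuousOn
    (continuous_level (n := n)).continuousOn
  obtain ⟨C, hC, hb⟩ := norm_blowup_le (n := n) hν.le hn (le_max_left 1 U)
  set p : ℝ := ((n : ℝ) + 3) / 2 with hp
  have hp0 : 0 < p := by positivity
  set c : ℝ := Real.exp (-(max 0 M)) / 2 with hcdef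
  have hc0 : 0 < c := by positivity
  have hc1 : c ≤ 1 := by
    have : Real.exp (-(max 0 M)) ≤ 1 := Real.exp_le_one_iff.2 (by simp)
    rw [hcdef]; linarith
  have hchange : ∀ δ : ℝ, 0 < δ → ((δ ^ 2 : ℝ) : ℂ) * ∫ g, F g * blowup n ν δ (level g) =
      ∫ g : AxB n, F (δ • g) * (((δ ^ (n + 3) : ℝ) : ℂ) * blowup n ν δ (level (δ • g))) := by
    intro δ hδ
    have h1 := Measure.integral_comp_smul (volume : Measure (AxB n))
      (fun g => F g * blowup n ν δ (level g)) δ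
    have h2 : ∀ g : AxB n, F (δ • g) * (((δ ^ (n + 3) : ℝ) : ℂ) * blowup n ν δ (level (δ • g))) =
        ((δ ^ (n + 3) : ℝ) : ℂ) * (F (δ • g) * blowup n ν δ (level (δ • g))) := fun g => by ring
    have h3 : Module.finrank ℝ (AxB n) = n + 1 := by simp [add_comm]
    simp only [h2]
    rw [integral_const_mul, h1, h3, abs_of_pos (by positivity), Complex.real_smul, ← mul_assoc,
      ← Complex.ofReal_mul]
    congr 2
    field_simp
    ring
  have hlim := tendsto_profile_two (n := n) hν.le hn
  set c₂ : ℝ := _ with hc₂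
  change Tendsto _ _ (𝓝 (c₂ : ℂ)) at hlim
  have hnorm : ∫ g : AxB n, F 1 *
      ((((1 + (g.1 ^ 2 + ‖g.2‖ ^ 2) / 2) ^ (-p) : ℝ) : ℂ) * (2 * c₂)) = ψ 1 := by
    have h1 : 2 * c₂ * ∫ g : AxB n, (1 + (g.1 ^ 2 + ‖g.2‖ ^ 2) / 2) ^ (-p) = 1 :=
      kernelConst_normalization hn (neg_half_add_div_two n).1
    rw [integral_const_mul, integral_mul_const, integral_complex_ofReal]
    have h2 : F 1 = ψ 1 := by simp [hF, one_def]
    rw [h2]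
    have h3 : (((∫ g : AxB n, (1 + (g.1 ^ 2 + ‖g.2‖ ^ 2) / 2) ^ (-p) : ℝ) : ℂ) * (2 * c₂)) = 1 := by
      refine Eq.trans ?_ (congrArg Complex.ofReal h1)
      push_cast
      ring
    rw [h3, mul_one]
  have key : Tendsto (fun δ : ℝ => ∫ g : AxB n, F (δ • g) *
      (((δ ^ (n + 3) : ℝ) : ℂ) * blowup n ν δ (level (δ • g)))) (𝓝[>] 0) (𝓝 (ψ 1)) := by
    rw [← hnorm]
    refine tendsto_integral_filter_of_dominated_convergence
      (fun g => B * C * c ^ (-p) * ((1 : ℝ) + ‖g‖ ^ 2) ^ (-p)) ?_ ?_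
      (integrable_one_add_norm_sq_rpow.const_mul _) ?_
    · filter_upwards [self_mem_nhdsWithin] with δ hδ
      have hδ2 : 0 < δ ^ 2 := pow_pos hδ 2
      have c1 := fun m => (contDiff_profile_level (n := n) hν.le hn 0 m hδ2).continuous
      have c2 : Continuous fun g : AxB n => blowup n ν δ (level g) :=
        ((continuous_const.mul (Complex.continuous_ofReal.comp continuous_level)).add
          continuous_const).mul (c1 2) |>.add (continuous_const.mul (c1 1))
      have c3 : Continuous fun g : AxB n => δ • g := by fun_prop
      exact ((hFc.comp c3).mul (continuous_const.mul (c2.comp c3))).aestronglyMeasurable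
    · filter_upwards [Ioo_mem_nhdsGT one_pos] with δ hδ
      refine .of_forall fun g => ?_
      have hδ2 : 0 < δ ^ 2 := pow_pos hδ.1 2
      by_cases hg : F (δ • g) = 0
      · rw [hg, zero_mul, norm_zero]
        positivity
      · have hmem : δ • g ∈ tsupport F := subset_tsupport _ hg
        have hlow : c * ‖δ • g‖ ^ 2 ≤ level (δ • g) - 1 := le_level_sub_one (le_max_left 0 M) ((hM _ hmem).trans (le_max_right 0 M))
        have hup : level (δ • g) ≤ max 1 U :=
          ((le_abs_self _).trans (hU _ hmem)).trans (le_max_right 1 U)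
        have h1 := hb δ hδ.1 hδ.2 _ (one_le_level (δ • g)) hup
        have h2 : c * (1 + ‖g‖ ^ 2) ≤ (level (δ • g) - 1 + δ ^ 2) / δ ^ 2 := by
          rw [le_div_iff₀ hδ2]
          rw [norm_smul, mul_pow, Real.norm_eq_abs, sq_abs] at hlow
          nlinarith [mul_le_mul_of_nonneg_right hc1 hδ2.le]
        have h3 : ((level (δ • g) - 1 + δ ^ 2) / δ ^ 2) ^ (-p) ≤
            c ^ (-p) * ((1 : ℝ) + ‖g‖ ^ 2) ^ (-p) := by
          rw [← Real.mul_rpow hc0.le (by positivity)]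
          exact Real.rpow_le_rpow_of_nonpos (by positivity) h2 (by linarith)
        rw [norm_mul (F (δ • g)), norm_mul ((δ ^ (n + 3) : ℝ) : ℂ), Complex.norm_real,
          Real.norm_of_nonneg (pow_nonneg hδ.1.le _)]
        calc _ ≤ B * (C * (c ^ (-p) * ((1 : ℝ) + ‖g‖ ^ 2) ^ (-p))) :=
              mul_le_mul (hB _) (h1.trans (mul_le_mul_of_nonneg_left h3 hC))
                (mul_nonneg (pow_nonneg hδ.1.le _) (norm_nonneg _)) hB0
          _ = _ := by ring
    · refine .of_forall fun g => ?_
      have h1 : Tendsto (fun δ : ℝ => F (δ • g)) (𝓝[>] 0) (𝓝 (F 1)) := by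
        have : Continuous fun δ : ℝ => F (δ • g) := by fun_prop
        have h := this.tendsto 0
        rw [zero_smul, ← Prod.mk_zero_zero, ← one_def] at h
        exact h.mono_left nhdsWithin_le_nhds
      exact h1.mul (tendsto_blowup hν.le hn hlim g)
  refine key.congr' ?_
  filter_upwards [self_mem_nhdsWithin] with δ hδ
  exact (hchange δ hδ).symm

/-- The kernel is a fundamental solution of `lap - lam`, `lam = -ν²`, with pole at the identity. -/
theorem integral_lap_add_mul_kernel {ν : ℂ} (hν : ν.re < 0) (hn : 1 ≤ n) {l : ℕ}
    (hl : -1 < -(n : ℝ) / 2 + l) {ψ : AxB n → ℂ} (hψ : ContDiff ℝ ∞ ψ) (hc : HasCompactSupport ψ) :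
    ∫ g, (lap ψ g + ν ^ 2 * ψ g) * kernel ν l g = ψ 1 := by
  have e : ∫ g, (lap ψ g + ν ^ 2 * ψ g) * kernel ν l g =
      ∫ g, (lap ψ g + ν ^ 2 * ψ g) * kernel ν (n / 2) g := by
    refine integral_congr_ae ?_
    filter_upwards [ae_ne_one] with g hg
    rw [kernel_eq_kernel_div_two hν.le hn hl hg]
  have hφc : Continuous fun g => lap ψ g + ν ^ 2 * ψ g :=
    (contDiff_lap hψ).continuous.add (continuous_const.mul hψ.continuous)
  have hφs : HasCompactSupport fun g => lap ψ g + ν ^ 2 * ψ g :=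
    (hasCompactSupport_lap hc).add hc.mul_left
  have hsq : Tendsto (fun δ : ℝ => δ ^ 2) (𝓝[>] 0) (𝓝[>] 0) := by
    refine tendsto_nhdsWithin_iff.2 ⟨?_, ?_⟩
    · have h := (continuous_pow 2 : Continuous fun δ : ℝ => δ ^ 2).tendsto 0
      rw [zero_pow two_ne_zero] at h
      exact h.mono_left nhdsWithin_le_nhds
    · filter_upwards [self_mem_nhdsWithin] with δ hδ using pow_pos (show (0 : ℝ) < δ from hδ) 2
  have h1 := (tendsto_integral_mul_regularized_kernel hν hn hφc hφs).comp hsq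
  have h2 := tendsto_integral_blowup hν hn hψ.continuous hc
  rw [e]
  -- Green's formula equates the two integrals for each `ε = δ²`; one tends to the pairing with the
  -- kernel, the other to `ψ 1`.
  refine tendsto_nhds_unique h1 (h2.congr' ?_)
  filter_upwards [self_mem_nhdsWithin] with δ hδ
  exact (integral_lap_add_mul_regularized_kernel hν.le hn (pow_pos (show (0 : ℝ) < δ from hδ) 2) hψ hc).symm

end FundamentalSolution

/-! ### Caccioppoli's inequality and uniqueness in `L²(G)` -/

section Caccioppoli

variable {n : ℕ}

theorem fderiv_level_fst (g : AxB n) : fderiv ℝ level g (1, 0) = levelX g := by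
  have h1 : HasDerivAt (fun x : ℝ => ((x, g.2) : AxB n)) (1, 0) g.1 :=
    (hasDerivAt_id g.1).prodMk (hasDerivAt_const _ _)
  have h2 : HasDerivAt (fun x : ℝ => level ((x, g.2) : AxB n)) (fderiv ℝ level g (1, 0)) g.1 := by
    have h := HasFDerivAt.comp_hasDerivAt (l := level) g.1 (differentiableAt_level g).hasFDerivAt h1
    exact h
  exact h2.unique (hasDerivAt_level_fst g.1 g.2)

theorem fderiv_level_snd (g : AxB n) (j : Fin n) :
    fderiv ℝ level g (0, EuclideanSpace.single j 1) = Real.exp (-g.1) * g.2 j := by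
  have h1 : HasDerivAt (fun t : ℝ => ((g.1, g.2 + t • EuclideanSpace.single j (1 : ℝ)) : AxB n))
      (0, EuclideanSpace.single j (1 : ℝ)) 0 := by
    refine (hasDerivAt_const _ _).prodMk ?_
    simpa using ((hasDerivAt_id (0 : ℝ)).smul_const (EuclideanSpace.single j (1 : ℝ))).const_add g.2
  have h0 : (g.1, g.2 + (0 : ℝ) • EuclideanSpace.single j (1 : ℝ)) = g := by simp
  have h2 := (h0.symm ▸ (differentiableAt_level g).hasFDerivAt :
    HasFDerivAt level (fderiv ℝ level g) (g.1, g.2 + (0 : ℝ) • EuclideanSpace.single j (1 : ℝ)))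
  have h3 : HasDerivAt
      (fun t : ℝ => level ((g.1, g.2 + t • EuclideanSpace.single j (1 : ℝ)) : AxB n))
      (fderiv ℝ level g (0, EuclideanSpace.single j 1)) 0 := by
    have h := h2.comp_hasDerivAt 0 h1
    exact h
  exact h3.unique (hasDerivAt_level_snd g.1 g.2 j)

/-- The squared length of the gradient of a real function. -/
def gradSq (χ : AxB n → ℝ) (g : AxB n) : ℝ :=
  fderiv ℝ χ g (1, 0) ^ 2 + ∑ j, (Real.exp g.1 * fderiv ℝ χ g (0, EuclideanSpace.single j 1)) ^ 2

theorem gradSq_level (g : AxB n) : gradSq level g = level g ^ 2 - 1 := by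
  rw [gradSq, fderiv_level_fst, ← levelX_sq_add, EuclideanSpace.norm_sq_eq]
  congr 1
  refine Finset.sum_congr rfl fun j _ => ?_
  rw [fderiv_level_snd, ← mul_assoc, ← Real.exp_add]
  simp

theorem gradSq_comp {χ : AxB n → ℝ} {g : AxB n} (hχ : DifferentiableAt ℝ χ g) {θ : ℝ → ℝ} {θ' : ℝ}
    (hθ : HasDerivAt θ θ' (χ g)) : gradSq (fun g => θ (χ g)) g = θ' ^ 2 * gradSq χ g := by
  have h : fderiv ℝ (fun g => θ (χ g)) g = θ' • fderiv ℝ χ g :=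
    (hθ.comp_hasFDerivAt g hχ.hasFDerivAt).fderiv
  simp only [gradSq, h, smul_apply, smul_eq_mul, mul_add, Finset.mul_sum]
  congr 1
  · ring
  · exact Finset.sum_congr rfl fun j _ => by ring

variable (n) in
/-- A sequence of cutoff functions whose gradients tend uniformly to zero. -/
theorem exists_cutoff : ∃ B : ℝ, ∃ χ : ℕ → AxB n → ℝ, ∀ m, ContDiff ℝ ∞ (χ m) ∧
    HasCompactSupport (χ m) ∧ (∀ g, 0 ≤ χ m g) ∧ (∀ g, χ m g ≤ 1) ∧
    (∀ g, Real.log (level g) ≤ m + 1 → χ m g = 1) ∧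
    ∀ g, gradSq (χ m) g ≤ B / ((m : ℝ) + 1) ^ 2 := by
  let θ : ContDiffBump (0 : ℝ) := ⟨1, 2, one_pos, one_lt_two⟩
  have hθd : ContDiff ℝ ∞ θ := θ.contDiff
  have hθ1 : ContDiff ℝ 1 θ := θ.contDiff
  obtain ⟨D, hD⟩ := (hθ1.continuous_deriv le_rfl).bounded_above_of_compact_support
    (θ.hasCompactSupport.deriv)
  -- The function `log (ch R)` is proper and its squared gradient is `(ch² R - 1) / ch² R ≤ 1`, so
  -- dividing by `m + 1` inside a fixed bump makes the gradient of order `1 / (m + 1)`.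
  refine ⟨D ^ 2, fun m g => θ (Real.log (level g) / ((m : ℝ) + 1)), fun m => ?_⟩
  have hm : (0 : ℝ) < (m : ℝ) + 1 := by positivity
  have hpos : ∀ g : AxB n, 0 < level g := fun g => by linarith [one_le_level g]
  refine ⟨?_, ?_, fun g => θ.nonneg, fun g => θ.le_one, fun g hg => ?_, fun g => ?_⟩
  · exact hθd.comp ((contDiff_level.log fun g => (hpos g).ne').div_const _)
  · set K : ℝ := Real.exp (2 * (m + 1)) with hK
    have hK1 : 1 ≤ K := Real.one_le_exp (by positivity)
    refine HasCompactSupport.of_support_subset_isCompact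
      (isCompact_closedBall (0 : AxB n) (max (2 * K) (√(2 * K * Real.exp (2 * K))))) fun g hg => ?_
    have h1 : Real.log (level g) / ((m : ℝ) + 1) < 2 := by
      have h2 : Real.log (level g) / ((m : ℝ) + 1) ∈ Function.support θ := hg
      rw [θ.support_eq, Metric.mem_ball, Real.dist_eq, sub_zero] at h2
      exact (le_abs_self _).trans_lt h2
    rw [div_lt_iff₀ hm, Real.log_lt_iff_lt_exp (hpos g)] at h1
    have h2 : level g < K := h1
    have h3 : |g.1| ≤ 2 * K := by
      have := Real.self_le_sinh_iff.2 (abs_nonneg g.1)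
      have h4 := Real.cosh_sub_sinh |g.1|
      have h5 : 0 < Real.exp (-|g.1|) := Real.exp_pos _
      have h6 : Real.cosh g.1 ≤ level g := by rw [level]; linarith [show 0 ≤ 1 / 2 * ‖g.2‖ ^ 2 * Real.exp (-g.1) by positivity]
      rw [Real.cosh_abs] at h4
      linarith
    have h4 : ‖g.2‖ ^ 2 ≤ 2 * K * Real.exp (2 * K) := by
      have h5 : 1 / 2 * ‖g.2‖ ^ 2 * Real.exp (-g.1) ≤ K := by
        have := Real.cosh_pos g.1
        rw [level] at h2
        linarith
      have h6 : Real.exp (-g.1) * Real.exp g.1 = 1 := by rw [← Real.exp_add]; simp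
      have h7 : Real.exp g.1 ≤ Real.exp (2 * K) :=
        Real.exp_le_exp.2 ((le_abs_self _).trans h3)
      calc ‖g.2‖ ^ 2 = 2 * (1 / 2 * ‖g.2‖ ^ 2 * Real.exp (-g.1)) * Real.exp g.1 := by
            linear_combination -‖g.2‖ ^ 2 * h6
        _ ≤ 2 * K * Real.exp (2 * K) := by gcongr
    rw [mem_closedBall_zero_iff, Prod.norm_def]
    exact max_le_max (by rwa [Real.norm_eq_abs]) (Real.le_sqrt_of_sq_le h4)
  · refine θ.one_of_mem_closedBall ?_
    rw [Metric.mem_closedBall, Real.dist_eq, sub_zero, abs_of_nonneg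
      (div_nonneg (Real.log_nonneg (one_le_level g)) hm.le), div_le_iff₀ hm]
    change _ ≤ 1 * ((m : ℝ) + 1)
    rwa [one_mul]
  · have hl := (Real.hasDerivAt_log (hpos g).ne').div_const ((m : ℝ) + 1)
    have hθ' := (hθd.differentiable (by simp) (Real.log (level g) / ((m : ℝ) + 1))).hasDerivAt
    have h := gradSq_comp (differentiableAt_level g) (HasDerivAt.comp (level g) hθ' hl)
    simp only [Function.comp_apply] at h
    rw [h, gradSq_level]
    have h1 : deriv θ (Real.log (level g) / ((m : ℝ) + 1)) ^ 2 ≤ D ^ 2 := by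
      rw [← sq_abs]
      exact pow_le_pow_left₀ (abs_nonneg _) (hD _) 2
    have h2 : (level g)⁻¹ ^ 2 * (level g ^ 2 - 1) ≤ 1 := by
      have := hpos g
      rw [inv_pow, inv_mul_le_iff₀ (by positivity)]
      linarith
    have h3 : 0 ≤ (level g)⁻¹ ^ 2 * (level g ^ 2 - 1) := by
      have := one_le_level g
      exact mul_nonneg (by positivity) (by nlinarith)
    calc _ = deriv θ (Real.log (level g) / ((m : ℝ) + 1)) ^ 2 *
          ((level g)⁻¹ ^ 2 * (level g ^ 2 - 1)) / ((m : ℝ) + 1) ^ 2 := by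
          rw [mul_pow, div_pow]; ring
      _ ≤ D ^ 2 * 1 / ((m : ℝ) + 1) ^ 2 := by gcongr
      _ = _ := by rw [mul_one]

/-- Completing the square: along `v` the real part equals `|χ W' + χ' W|² - χ'² |W|²`. -/
theorem neg_le_re_fderiv_mul_fderiv {χ : AxB n → ℝ} {W : AxB n → ℂ} {g : AxB n}
    (hχ : DifferentiableAt ℝ χ g) (hW : DifferentiableAt ℝ W g) (v : AxB n) :
    -(fderiv ℝ χ g v ^ 2 * ‖W g‖ ^ 2) ≤ (fderiv ℝ W g v *
      fderiv ℝ (fun g => ((χ g : ℂ)) ^ 2 * (starRingEnd ℂ) (W g)) g v).re := by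
  have h1 : HasFDerivAt (fun g => (χ g : ℂ)) (Complex.ofRealCLM.comp (fderiv ℝ χ g)) g :=
    Complex.ofRealCLM.hasFDerivAt.comp g hχ.hasFDerivAt
  have h2 : HasFDerivAt (fun g => (starRingEnd ℂ) (W g))
      ((Complex.conjCLE : ℂ →L[ℝ] ℂ).comp (fderiv ℝ W g)) g :=
    (Complex.conjCLE : ℂ →L[ℝ] ℂ).hasFDerivAt.comp g hW.hasFDerivAt
  have h3 := ((h1.mul h1).mul h2).fderiv
  have e : (fun g => ((χ g : ℂ)) ^ 2 * (starRingEnd ℂ) (W g)) =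
      (fun g => ((χ g : ℂ)) * (χ g : ℂ) * (starRingEnd ℂ) (W g)) := by
    funext g; ring
  have h4 : fderiv ℝ (fun g => ((χ g : ℂ)) ^ 2 * (starRingEnd ℂ) (W g)) g v =
      (χ g : ℂ) * χ g * (starRingEnd ℂ) (fderiv ℝ W g v) +
        2 * (χ g * (fderiv ℝ χ g v : ℂ)) * (starRingEnd ℂ) (W g) := by
    rw [e]
    refine (congrArg (fun L : AxB n →L[ℝ] ℂ => L v) h3).trans ?_
    simp
    ring
  rw [h4, ← Complex.normSq_eq_norm_sq, Complex.normSq_apply]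
  generalize fderiv ℝ W g v = z
  generalize fderiv ℝ χ g v = t
  simp
  nlinarith [sq_nonneg (χ g * z.re + t * (W g).re), sq_nonneg (χ g * z.im + t * (W g).im)]

theorem cutoff_sub_gradSq_le {χ : AxB n → ℝ} {W : AxB n → ℂ} (hχ : Differentiable ℝ χ)
    (hW : Differentiable ℝ W) (g : AxB n) :
    χ g ^ 2 * ‖W g‖ ^ 2 - gradSq χ g * ‖W g‖ ^ 2 ≤
      ((X W g * X (fun g => (χ g : ℂ) ^ 2 * (starRingEnd ℂ) (W g)) g + ∑ j, Y j W g *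
        Y j (fun g => (χ g : ℂ) ^ 2 * (starRingEnd ℂ) (W g)) g)
        + W g * ((χ g : ℂ) ^ 2 * (starRingEnd ℂ) (W g))).re := by
  obtain ⟨φ, hφdef⟩ : ∃ φ, φ = fun g : AxB n => (χ g : ℂ) ^ 2 * (starRingEnd ℂ) (W g) := ⟨_, rfl⟩
  have hφg : (χ g : ℂ) ^ 2 * (starRingEnd ℂ) (W g) = φ g := by rw [hφdef]
  rw [← hφdef, hφg]
  have d1 := hχ g
  have d2 := hW g
  have a1 := neg_le_re_fderiv_mul_fderiv d1 d2 (1, 0)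
  rw [← hφdef] at a1
  have a2 : ∀ j, -((Real.exp g.1 * fderiv ℝ χ g (0, EuclideanSpace.single j 1)) ^ 2 * ‖W g‖ ^ 2) ≤
      (Y j W g * Y j φ g).re := fun j => by
    have a3 := neg_le_re_fderiv_mul_fderiv d1 d2 (0, EuclideanSpace.single j 1)
    rw [← hφdef] at a3
    have e : Y j W g * Y j φ g = ((Real.exp g.1 ^ 2 : ℝ) : ℂ) *
        (fderiv ℝ W g (0, EuclideanSpace.single j 1) *
          fderiv ℝ φ g (0, EuclideanSpace.single j 1)) := by
      simp only [Y]; push_cast; ring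
    rw [e, Complex.re_ofReal_mul]
    have := mul_le_mul_of_nonneg_left a3 (sq_nonneg (Real.exp g.1))
    calc _ = _ := by ring
      _ ≤ _ := this
  have a4 : (W g * φ g).re = χ g ^ 2 * ‖W g‖ ^ 2 := by
    have : W g * φ g = ((χ g ^ 2 * ‖W g‖ ^ 2 : ℝ) : ℂ) := by
      simp only [hφdef]
      rw [mul_left_comm, Complex.mul_conj, Complex.normSq_eq_norm_sq]
      push_cast; ring
    rw [this, Complex.ofReal_re]
  have a5 := Finset.sum_le_sum fun j (_ : j ∈ Finset.univ) => a2 j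
  rw [Finset.sum_neg_distrib, ← Finset.sum_mul] at a5
  rw [Complex.add_re, Complex.add_re, Complex.re_sum, a4, gradSq]
  have a6 : (X W g * X φ g).re = (fderiv ℝ W g (1, 0) * fderiv ℝ φ g (1, 0)).re := rfl
  rw [a6]
  linarith

theorem continuous_gradSq {χ : AxB n → ℝ} (hχ : ContDiff ℝ ∞ χ) : Continuous (gradSq χ) := by
  have hd : Continuous (fderiv ℝ χ) := hχ.continuous_fderiv (by simp)
  have h : ∀ v, Continuous fun g => fderiv ℝ χ g v := fun v => hd.clm_apply continuous_const
  exact ((h _).pow 2).add (continuous_finsetSum _ fun j _ =>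
    ((Real.continuous_exp.comp continuous_fst).mul (h _)).pow 2)

theorem hasCompactSupport_gradSq {χ : AxB n → ℝ} (hc : HasCompactSupport χ) :
    HasCompactSupport (gradSq χ) := by
  refine HasCompactSupport.of_support_subset_isCompact hc.isCompact fun g hg => ?_
  by_contra h0
  have h1 : fderiv ℝ χ g = 0 := by
    by_contra h
    exact h0 (support_fderiv_subset ℝ h)
  exact hg (by simp [gradSq, h1])

theorem contDiff_cutoff_sq_mul {χ : AxB n → ℝ} {W : AxB n → ℂ} (hχ : ContDiff ℝ ∞ χ)
    (hW : ContDiff ℝ ∞ W) : ContDiff ℝ ∞ fun g => (χ g : ℂ) ^ 2 * (starRingEnd ℂ) (W g) :=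
  ((Complex.ofRealCLM.contDiff.comp hχ).pow 2).mul (Complex.conjCLE.contDiff.comp hW)

theorem integral_mul_lap_eq {φ W : AxB n → ℂ} (hW : ContDiff ℝ ∞ W) (hφ : ContDiff ℝ ∞ φ)
    (hφc : HasCompactSupport φ) :
    Integrable (fun g => X W g * X φ g + ∑ j, Y j W g * Y j φ g) ∧
    ∫ g, W g * (lap φ g + φ g) =
      ∫ g, ((X W g * X φ g + ∑ j, Y j W g * Y j φ g) + W g * φ g) := by
  have c2 : ∀ {f : AxB n → ℂ}, ContDiff ℝ ∞ f → ContDiff ℝ 2 f := fun hf => by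
    exact_mod_cast contDiff_infty.1 hf 2
  have c1 : ∀ {f : AxB n → ℂ}, ContDiff ℝ ∞ f → ContDiff ℝ 1 f := fun hf => by
    exact_mod_cast contDiff_infty.1 hf 1
  have g1 := integral_lap_mul_comm (c2 hW) (c2 hφ) hφc
  have g2 := integral_lap_mul_eq (c2 hW) (c1 hφ) hφc
  have hGc : Continuous fun g => X W g * X φ g + ∑ j, Y j W g * Y j φ g :=
    ((contDiff_X hW).continuous.mul (contDiff_X hφ).continuous).add
      (continuous_finsetSum _ fun j _ =>
        (contDiff_Y j hW).continuous.mul (contDiff_Y j hφ).continuous)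
  have hGs : HasCompactSupport fun g => X W g * X φ g + ∑ j, Y j W g * Y j φ g := by
    refine HasCompactSupport.of_support_subset_isCompact hφc.isCompact fun g hg => ?_
    by_contra h0
    have h1 : fderiv ℝ φ g = 0 := by
      by_contra h
      exact h0 (support_fderiv_subset ℝ h)
    exact hg (by simp [X, Y, h1])
  have i1 : Integrable fun g => X W g * X φ g + ∑ j, Y j W g * Y j φ g :=
    hGc.integrable_of_hasCompactSupport hGs
  have i2 : Integrable fun g => W g * φ g :=
    (hW.continuous.mul hφ.continuous).integrable_of_hasCompactSupport hφc.mul_left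
  have i3 : Integrable fun g => W g * lap φ g :=
    (hW.continuous.mul (contDiff_lap hφ).continuous).integrable_of_hasCompactSupport
      (hasCompactSupport_lap hφc).mul_left
  refine ⟨i1, ?_⟩
  rw [integral_add i1 i2, ← g2, g1, ← integral_add i3 i2]
  simp only [mul_add]

/-- Caccioppoli's inequality: a smooth weak solution of `lap W + W = 0` is controlled by cutoffs. -/
theorem integral_cutoff_le {W : AxB n → ℂ} (hW : ContDiff ℝ ∞ W)
    (hweak : ∀ φ : AxB n → ℂ, ContDiff ℝ ∞ φ → HasCompactSupport φ →
      ∫ g, W g * (lap φ g + φ g) = 0) {χ : AxB n → ℝ} (hχ : ContDiff ℝ ∞ χ)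
    (hc : HasCompactSupport χ) :
    ∫ g, χ g ^ 2 * ‖W g‖ ^ 2 ≤ ∫ g, gradSq χ g * ‖W g‖ ^ 2 := by
  have hpt := cutoff_sub_gradSq_le (hχ.differentiable (by simp)) (hW.differentiable (by simp))
  have hφ := contDiff_cutoff_sq_mul hχ hW
  have hφc : HasCompactSupport fun g => (χ g : ℂ) ^ 2 * (starRingEnd ℂ) (W g) := by
    refine hc.mono fun g hg h0 => hg ?_
    simp only at h0 ⊢
    rw [h0, Complex.ofReal_zero, zero_pow two_ne_zero, zero_mul]
  have h0 := hweak _ hφ hφc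
  obtain ⟨i1, h1⟩ := integral_mul_lap_eq hW hφ hφc
  have i2 : Integrable fun g => W g * ((χ g : ℂ) ^ 2 * (starRingEnd ℂ) (W g)) :=
    (hW.continuous.mul hφ.continuous).integrable_of_hasCompactSupport hφc.mul_left
  rw [h1] at h0
  have i4 : Integrable fun g => χ g ^ 2 * ‖W g‖ ^ 2 := by
    refine ((hχ.continuous.pow 2).mul (hW.continuous.norm.pow 2)).integrable_of_hasCompactSupport ?_
    refine hc.mono fun g hg h0 => hg ?_
    change χ g ^ 2 * ‖W g‖ ^ 2 = 0
    rw [h0, zero_pow two_ne_zero, zero_mul]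
  have i5 : Integrable fun g => gradSq χ g * ‖W g‖ ^ 2 :=
    ((continuous_gradSq hχ).mul (hW.continuous.norm.pow 2)).integrable_of_hasCompactSupport
      (hasCompactSupport_gradSq hc).mul_right
  have i6 := i1.add i2
  have h2 := integral_mono (i4.sub i5) i6.re hpt
  have h3 := integral_re i6
  simp only [Pi.add_apply, Pi.sub_apply] at h2 h3
  rw [integral_sub i4 i5, h3, h0] at h2
  simp only [map_zero] at h2
  linarith

/-- There is no nonzero smooth weak solution of `lap W + W = 0` in `L²(G)`. -/
theorem eq_zero_of_weak_solution {W : AxB n → ℂ} (hW : ContDiff ℝ ∞ W) (hW2 : MemLp W 2)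
    (hweak : ∀ φ : AxB n → ℂ, ContDiff ℝ ∞ φ → HasCompactSupport φ →
      ∫ g, W g * (lap φ g + φ g) = 0) : W = 0 := by
  obtain ⟨B, χ, hχ⟩ := exists_cutoff n
  have hi : Integrable fun g => ‖W g‖ ^ 2 := by
    have := hW2.integrable_norm_pow two_ne_zero
    simpa using this
  have h1 : Tendsto (fun m : ℕ => ∫ g, χ m g ^ 2 * ‖W g‖ ^ 2) atTop (𝓝 (∫ g, ‖W g‖ ^ 2)) := by
    refine tendsto_integral_of_dominated_convergence (fun g => ‖W g‖ ^ 2)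
      (fun m => (((hχ m).1.continuous.pow 2).mul (hW.continuous.norm.pow 2)).aestronglyMeasurable)
      hi (fun m => .of_forall fun g => ?_) (.of_forall fun g => ?_)
    · have h0 := (hχ m).2.2.1 g
      have h2 := (hχ m).2.2.2.1 g
      rw [Real.norm_of_nonneg (by positivity)]
      have : χ m g ^ 2 ≤ 1 := pow_le_one₀ h0 h2
      exact mul_le_of_le_one_left (by positivity) this
    · obtain ⟨N, hN⟩ := exists_nat_ge (Real.log (level g))
      refine tendsto_const_nhds.congr' ?_
      filter_upwards [eventually_ge_atTop N] with m hm
      have : (N : ℝ) ≤ m := by exact_mod_cast hm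
      rw [(hχ m).2.2.2.2.1 g (by linarith), one_pow, one_mul]
  have h2 : Tendsto (fun m : ℕ => B / ((m : ℝ) + 1) ^ 2 * ∫ g, ‖W g‖ ^ 2) atTop (𝓝 0) := by
    have h3 : Tendsto (fun m : ℕ => ((m : ℝ) + 1) ^ 2) atTop atTop :=
      (tendsto_pow_atTop two_ne_zero).comp
        (tendsto_atTop_add_const_right _ _ tendsto_natCast_atTop_atTop)
    have h4 := (h3.const_div_atTop B).mul_const (∫ g, ‖W g‖ ^ 2)
    rwa [zero_mul] at h4
  -- As `m → ∞` the left side of Caccioppoli's inequality tends to `∫ ‖W‖²`, while the right side is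
  -- at most `B / (m + 1)²` times that integral.
  have h3 : ∫ g, ‖W g‖ ^ 2 ≤ 0 := by
    refine le_of_tendsto_of_tendsto' h1 h2 fun m => ?_
    refine (integral_cutoff_le hW hweak (hχ m).1 (hχ m).2.1).trans ?_
    rw [← integral_const_mul]
    refine integral_mono_of_nonneg (.of_forall fun g => ?_) (hi.const_mul _)
      (.of_forall fun g => mul_le_mul_of_nonneg_right ((hχ m).2.2.2.2.2 g) (by positivity))
    have : 0 ≤ gradSq (χ m) g := by
      unfold gradSq
      positivity
    simp only [Pi.zero_apply]
    positivity
  have h4 : ∫ g, ‖W g‖ ^ 2 = 0 := le_antisymm h3 (integral_nonneg fun g => by positivity)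
  rw [integral_eq_zero_iff_of_nonneg (fun g => by positivity) hi] at h4
  refine (Continuous.ae_eq_iff_eq volume hW.continuous continuous_const).1 ?_
  filter_upwards [h4] with g hg
  exact norm_eq_zero.1 ((pow_eq_zero_iff two_ne_zero).1 hg)

end Caccioppoli

/-! ### Mollification by left translations -/

section Mollifier

variable {n : ℕ}

theorem contDiff_mul_inv : ContDiff ℝ ∞ fun q : AxB n × AxB n => q.1 * q.2⁻¹ := by
  have : (fun q : AxB n × AxB n => q.1 * q.2⁻¹) = fun q => (q.1.1 + -q.2.1,
      q.1.2 + Real.exp q.1.1 • -(Real.exp (-q.2.1) • q.2.2)) := by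
    funext q; rfl
  rw [this]
  fun_prop

theorem integral_average_eq (w ψ : AxB n → ℂ) (g : AxB n) :
    ∫ h, w (h * g) * ψ h = ∫ p, w p * ψ (p * g⁻¹) := by
  have := (measurePreserving_mul_right g).integral_comp
    (MeasurableEquiv.mulRight g).measurableEmbedding fun p => w p * ψ (p * g⁻¹)
  simpa using this

/-- Averages of left translates against a test function are smooth. -/
theorem contDiff_average {w : AxB n → ℂ} (hw : LocallyIntegrable w) {ψ : AxB n → ℂ}
    (hψ : ContDiff ℝ ∞ ψ) (hc : HasCompactSupport ψ) :
    ContDiff ℝ ∞ fun g => ∫ h, w (h * g) * ψ h := by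
  simp only [integral_average_eq]
  refine contDiff_iff_contDiffAt.2 fun g₀ => ?_
  have hs : IsOpen (Metric.ball g₀ 1) := Metric.isOpen_ball
  have hk : IsCompact ((fun q : AxB n × AxB n => -(q.1 * q.2)) ''
      (tsupport ψ ×ˢ Metric.closedBall g₀ 1)) :=
    (hc.isCompact.prod (isCompact_closedBall _ _)).image continuous_mul.neg
  -- After moving the translation to the test function, the average is an additive convolution
  -- evaluated at `0`, whose second factor depends smoothly on the parameter `g` and has support in
  -- a fixed compact set for `g` near `g₀`.
  have h := contDiffOn_convolution_right_with_param_comp (n := ⊤) (μ := volume) (𝕜 := ℝ)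
    (ContinuousLinearMap.mul ℝ ℂ) (s := Metric.ball g₀ 1) (v := fun _ => (0 : AxB n))
    contDiffOn_const (f := w) (g := fun p z => ψ (-z * p⁻¹)) hs hk (fun p x hp hx => ?_) hw
    (ContDiff.contDiffOn ?_)
  · have h2 := h.contDiffAt (hs.mem_nhds (Metric.mem_ball_self one_pos))
    refine h2.congr_of_eventuallyEq (.of_forall fun g => ?_)
    simp [convolution]
  · by_contra h0
    refine hx ⟨(-x * p⁻¹, p), ⟨subset_tsupport _ h0, Metric.ball_subset_closedBall hp⟩, ?_⟩
    simp
  · exact hψ.comp (contDiff_mul_inv.comp (contDiff_snd.neg.prodMk contDiff_fst))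

theorem hasCompactSupport_comp_mul_left {φ : AxB n → ℂ} (hc : HasCompactSupport φ) (h : AxB n) :
    HasCompactSupport fun g => φ (h * g) :=
  hc.comp_homeomorph (Homeomorph.mulLeft h)

theorem contDiff_comp_mul_left {φ : AxB n → ℂ} (hφ : ContDiff ℝ ∞ φ) (h : AxB n) :
    ContDiff ℝ ∞ fun g => φ (h * g) := by
  have : (fun g => φ (h * g)) = fun g : AxB n => φ (h.1 + g.1, h.2 + Real.exp h.1 • g.2) := rfl
  rw [this]
  exact hφ.comp (by fun_prop)

theorem lintegral_mul_left_le (h : AxB n) (F : AxB n → ENNReal) (hF : Measurable F) :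
    ∫⁻ g, F (h * g) ≤ ENNReal.ofReal (Real.exp (-(n * h.1))) * ∫⁻ g, F g :=
  (lintegral_mul_left h F hF).le

theorem measurable_mul_uncurry : Measurable (Function.uncurry fun h g : AxB n => h * g) :=
  (continuous_fst.mul continuous_snd).measurable

theorem lintegral_enorm_mul_exp_ne_top {ψ : AxB n → ℂ} (hψ : Continuous ψ)
    (hc : HasCompactSupport ψ) :
    ∫⁻ h, ‖ψ h‖ₑ * ENNReal.ofReal (Real.exp (-(n * h.1))) ≠ ⊤ := by
  have h1 : Integrable fun h : AxB n => ψ h * (Real.exp (-(n * h.1)) : ℂ) :=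
    (hψ.mul (by fun_prop)).integrable_of_hasCompactSupport hc.mul_right
  have h2 := h1.2.ne
  refine ne_of_eq_of_ne (lintegral_congr fun h => ?_) h2
  rw [enorm_mul]
  congr 1
  rw [← ofReal_norm, Complex.norm_real, Real.norm_of_nonneg (Real.exp_nonneg _)]

theorem memLp_mollify {w : AxB n → ℂ} (hw : StronglyMeasurable w) (hw2 : MemLp w 2) {ψ : AxB n → ℂ}
    (hψ : Continuous ψ) (hc : HasCompactSupport ψ) : MemLp (fun g => ∫ h, w (h * g) * ψ h) 2 :=
  (memLp_average measurable_mul_uncurry lintegral_mul_left_le hw hw2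
    (hψ.integrable_of_hasCompactSupport hc) (lintegral_enorm_mul_exp_ne_top hψ hc)).1

theorem mul_le_sq_add_sq (a b : ENNReal) : a * b ≤ a ^ 2 + b ^ 2 := by
  rcases le_total a b with h | h
  · calc a * b ≤ b * b := by gcongr
      _ ≤ _ := by rw [sq b]; exact le_add_self
  · calc a * b ≤ a * a := by gcongr
      _ ≤ _ := by rw [sq a]; exact le_self_add

/-- This justifies Fubini: the averaged norms are square integrable by Schur's test, as is `Φ`, and
a product is at most the sum of squares. -/
theorem integrable_mollify_mul {w : AxB n → ℂ} (hw : StronglyMeasurable w) (hw2 : MemLp w 2)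
    {ψ Φ : AxB n → ℂ} (hψ : Continuous ψ) (hc : HasCompactSupport ψ) (hΦ : Continuous Φ)
    (hΦc : HasCompactSupport Φ) :
    Integrable (fun q : AxB n × AxB n => w (q.2 * q.1) * ψ q.2 * Φ q.1) (volume.prod volume) := by
  obtain ⟨h1, h2⟩ := lintegral_average_enorm_sq_le measurable_mul_uncurry lintegral_mul_left_le hw
    hw2 (hψ.aestronglyMeasurable (μ := volume))
  have hm : Measurable fun q : AxB n × AxB n => w (q.2 * q.1) * ψ q.2 * Φ q.1 :=
    ((hw.measurable.comp (continuous_snd.mul continuous_fst).measurable).mul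
      (hψ.measurable.comp measurable_snd)).mul (hΦ.measurable.comp measurable_fst)
  have hm2 : Measurable fun q : AxB n × AxB n => w (q.2 * q.1) * ψ q.2 :=
    (hw.measurable.comp (continuous_snd.mul continuous_fst).measurable).mul
      (hψ.measurable.comp measurable_snd)
  refine ⟨hm.aestronglyMeasurable, ?_⟩
  rw [HasFiniteIntegral, lintegral_prod _ hm.enorm.aemeasurable]
  have h3 : ∫⁻ g, ‖Φ g‖ₑ ^ 2 ≠ ⊤ :=
    lintegral_enorm_sq_ne_top (hΦ.memLp_of_hasCompactSupport hΦc)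
  have h4 : ∫⁻ g, (∫⁻ h, ‖w (h * g) * ψ h‖ₑ) ^ 2 ≠ ⊤ :=
    ne_top_of_le_ne_top (ENNReal.mul_ne_top (hψ.integrable_of_hasCompactSupport hc).2.ne
      (ENNReal.mul_ne_top (lintegral_enorm_mul_exp_ne_top hψ hc)
      (lintegral_enorm_sq_ne_top hw2))) h2
  calc ∫⁻ g, ∫⁻ h, ‖w (h * g) * ψ h * Φ g‖ₑ = ∫⁻ g, (∫⁻ h, ‖w (h * g) * ψ h‖ₑ) * ‖Φ g‖ₑ := by
        refine lintegral_congr fun g => ?_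
        have hm3 : Measurable fun h => ‖w (h * g) * ψ h‖ₑ := (hm2.comp measurable_prodMk_left).enorm
        rw [← lintegral_mul_const _ hm3]
        exact lintegral_congr fun h => enorm_mul _ _
    _ ≤ ∫⁻ g, ((∫⁻ h, ‖w (h * g) * ψ h‖ₑ) ^ 2 + ‖Φ g‖ₑ ^ 2) :=
        lintegral_mono fun g => mul_le_sq_add_sq _ _
    _ = (∫⁻ g, (∫⁻ h, ‖w (h * g) * ψ h‖ₑ) ^ 2) + ∫⁻ g, ‖Φ g‖ₑ ^ 2 :=
        lintegral_add_left (h1.pow_const 2) _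
    _ < ⊤ := (ENNReal.add_ne_top.2 ⟨h4, h3⟩).lt_top

/-- Averages of left translates of a weak solution are weak solutions. -/
theorem integral_mollify_mul_lap_add {w : AxB n → ℂ} (hw : StronglyMeasurable w) (hw2 : MemLp w 2)
    (hweak : ∀ φ : AxB n → ℂ, ContDiff ℝ ∞ φ → HasCompactSupport φ →
      ∫ g, w g * (lap φ g + φ g) = 0) {ψ : AxB n → ℂ}
    (hψ : Continuous ψ) (hc : HasCompactSupport ψ) {φ : AxB n → ℂ} (hφ : ContDiff ℝ ∞ φ)
    (hφc : HasCompactSupport φ) : ∫ g, (∫ h, w (h * g) * ψ h) * (lap φ g + φ g) = 0 := by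
  set Φ : AxB n → ℂ := fun g => lap φ g + φ g with hΦdef
  have hΦ : Continuous Φ := (contDiff_lap hφ).continuous.add hφ.continuous
  have hΦc : HasCompactSupport Φ := (hasCompactSupport_lap hφc).add hφc
  have hi := integrable_mollify_mul hw hw2 hψ hc hΦ hΦc
  calc ∫ g, (∫ h, w (h * g) * ψ h) * Φ g = ∫ g, ∫ h, w (h * g) * ψ h * Φ g := by
        simp only [integral_mul_const]
    _ = ∫ h, ∫ g, w (h * g) * ψ h * Φ g := integral_integral_swap hi
    _ = ∫ _ : AxB n, (0 : ℂ) := by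
        refine integral_congr_ae (.of_forall fun h => ?_)
        -- The translation passes to the test function. By left invariance of `lap` the translated
        -- function may be used in the weak equation of `w`, and the modular factor multiplies zero.
        have h1 := integral_comp_mul_left h fun p => w p * (lap (fun g => φ (h⁻¹ * g)) p +
          φ (h⁻¹ * p))
        rw [hweak _ (contDiff_comp_mul_left hφ h⁻¹) (hasCompactSupport_comp_mul_left hφc h⁻¹),
          mul_zero, lap_comp_mul_left hφ] at h1
        simp only [inv_mul_cancel_left] at h1
        have h2 : ∀ g, w (h * g) * ψ h * Φ g = ψ h * (w (h * g) * (lap φ g + φ g)) := fun g => by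
          rw [hΦdef]; ring
        simp only [h2]
        rw [integral_const_mul, h1, mul_zero]
    _ = 0 := by simp

/-- The range of `lap + 1` on test functions has trivial orthogonal complement. -/
theorem ae_eq_zero_of_weak_solution {w : AxB n → ℂ} (hw : StronglyMeasurable w) (hw2 : MemLp w 2)
    (hweak : ∀ φ : AxB n → ℂ, ContDiff ℝ ∞ φ → HasCompactSupport φ →
      ∫ g, w g * (lap φ g + φ g) = 0) : ∀ᵐ g, w g = 0 := by
  have hloc : LocallyIntegrable w := hw2.locallyIntegrable (by norm_num)
  refine ae_eq_zero_of_integral_contDiff_smul_eq_zero hloc fun ψ hψ hc => ?_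
  have hψC : ContDiff ℝ ∞ fun g => (ψ g : ℂ) := Complex.ofRealCLM.contDiff.comp hψ
  have hcC : HasCompactSupport fun g => (ψ g : ℂ) := by
    refine hc.mono fun g hg h0 => hg ?_
    change ((ψ g : ℝ) : ℂ) = 0
    rw [h0, Complex.ofReal_zero]
  have h := eq_zero_of_weak_solution (contDiff_average hloc hψC hcC)
    (memLp_mollify hw hw2 hψC.continuous hcC) fun φ hφ hφc =>
      integral_mollify_mul_lap_add hw hw2 hweak hψC.continuous hcC hφ hφc
  -- The mollified function vanishes identically; its value at the identity is the integral of `w`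
  -- against `ψ`.
  have h1 := congrFun h 1
  simp only [mul_one, Pi.zero_apply] at h1
  rw [← h1]
  refine integral_congr_ae (.of_forall fun g => ?_)
  simp only [Complex.real_smul]
  ring

end Mollifier

/-! ### Resolvents from left inverses -/

section Abstract

variable {H : Type*} [NormedAddCommGroup H] [InnerProductSpace ℂ H] [CompleteSpace H]

/-- The vectors `f` with `(T f, f + λ T f)` in the graph of `A` form a closed subspace, since `A` is
closed. It contains the range of `A - λ` because `T` is a left inverse, and that range is dense by
`horth`. -/
theorem exists_resolvent_domain {A : H →ₗ.[ℂ] H} (hA : A.IsClosed) {lam : ℂ} {T : H →L[ℂ] H}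
    (hT : ∀ u : A.domain, T (A u - lam • (u : H)) = u)
    (horth : ∀ f : H, (∀ u : A.domain, inner ℂ f (A u - lam • (u : H)) = 0) → f = 0) (f : H) :
    ∃ h : T f ∈ A.domain, A ⟨T f, h⟩ - lam • T f = f := by
  let R : Submodule ℂ H := LinearMap.range (A.toFun - lam • A.domain.subtype)
  let J : H →L[ℂ] H × H := T.prod (ContinuousLinearMap.id ℂ H + lam • T)
  have hJ : ∀ f, J f = (T f, f + lam • T f) := fun f => rfl
  let S : Submodule ℂ H := A.graph.comap J.toLinearMap
  have hS : IsClosed (S : Set H) := IsClosed.preimage J.continuous hA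
  have hRS : R ≤ S := by
    rintro _ ⟨u, rfl⟩
    have h1 : J ((A.toFun - lam • A.domain.subtype) u) ∈ A.graph := by
      have h2 : (A.toFun - lam • A.domain.subtype) u = A u - lam • (u : H) := rfl
      rw [h2, hJ, hT u, sub_add_cancel]
      exact A.mem_graph u
    exact h1
  have hR : Rᗮ = ⊥ := by
    rw [Submodule.eq_bot_iff]
    intro f hf
    refine horth f fun u => ?_
    have := (Submodule.mem_orthogonal' R f).1 hf _ ⟨u, rfl⟩
    exact this
  have htop : S = ⊤ := by
    rw [eq_top_iff, ← (Submodule.topologicalClosure_eq_top_iff).2 hR]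
    exact Submodule.topologicalClosure_minimal R hRS hS
  have hf : J f ∈ A.graph := by
    have : f ∈ S := by rw [htop]; trivial
    exact this
  rw [hJ, LinearPMap.mem_graph_iff] at hf
  obtain ⟨u, hu1, hu2⟩ := hf
  simp only at hu1 hu2
  have hd : T f ∈ A.domain := hu1 ▸ u.2
  refine ⟨hd, ?_⟩
  have : (⟨T f, hd⟩ : A.domain) = u := Subtype.ext hu1.symm
  rw [this, hu2, add_sub_cancel_right]

/-- For `y` in the domain of `A*`, solve `(A + 1) x = (A* + 1) y` with `x` in the domain of `A`.
Then `y - x` is orthogonal to the range of `A + 1`, hence zero, and `y` lies in the domain of `A`.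
-/
theorem isSelfAdjoint_of_resolvent {A : H →ₗ.[ℂ] H} (hA : A.IsClosed)
    (hd : Dense (A.domain : Set H)) (hsymm : A.IsFormalAdjoint A) {T : H →L[ℂ] H}
    (hT : ∀ u : A.domain, T (A u - (-1 : ℂ) • (u : H)) = u)
    (horth : ∀ f : H, (∀ u : A.domain, inner ℂ f (A u - (-1 : ℂ) • (u : H)) = 0) → f = 0) :
    IsSelfAdjoint A := by
  rw [LinearPMap.isSelfAdjoint_def]
  refine (LinearPMap.eq_of_le_of_domain_eq (hsymm.le_adjoint hd) ?_).symm
  refine le_antisymm (hsymm.le_adjoint hd).1 fun y hy => ?_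
  obtain ⟨h, hx⟩ := exists_resolvent_domain hA hT horth (A.adjoint ⟨y, hy⟩ - (-1 : ℂ) • y)
  set x := T (A.adjoint ⟨y, hy⟩ - (-1 : ℂ) • y)
  have h0 : y - x = 0 := by
    refine horth _ fun u => ?_
    have h1 := LinearPMap.adjoint_isFormalAdjoint hd ⟨y, hy⟩ u
    have h2 := hsymm ⟨x, h⟩ u
    have h3 := congrArg (fun z => inner ℂ z (u : H)) hx
    simp only [inner_sub_left, inner_sub_right, inner_smul_left, inner_smul_right] at h1 h2 h3 ⊢
    simp only [map_neg, map_one] at h3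
    rw [h1, h2] at h3
    linear_combination -h3
  rw [sub_eq_zero.1 h0]
  exact h

/-- A vector orthogonal to the range of `A - λ` lies in the kernel of `A* - λ̄ = A - λ̄`, and this
kernel is trivial because `A - λ̄` has the left inverse `T'`. -/
theorem isResolvent_of_isSelfAdjoint {A : H →ₗ.[ℂ] H} (hA : IsSelfAdjoint A) {lam : ℂ}
    {T T' : H →L[ℂ] H} (hT : ∀ u : A.domain, T (A u - lam • (u : H)) = u)
    (hT' : ∀ u : A.domain, T' (A u - (starRingEnd ℂ) lam • (u : H)) = u) :
    IsResolvent A lam T := by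
  refine ⟨exists_resolvent_domain hA.isClosed hT fun f hf => ?_, hT⟩
  have hd := hA.dense_domain
  have h1 : ∀ u : A.domain, inner ℂ ((starRingEnd ℂ) lam • f) (u : H) = inner ℂ f (A u) := by
    intro u
    have h2 := hf u
    rw [inner_sub_right, inner_smul_right] at h2
    rw [inner_smul_left, Complex.conj_conj]
    exact (sub_eq_zero.1 h2).symm
  have hf1 : f ∈ A.adjoint.domain := LinearPMap.mem_adjoint_domain_of_exists f ⟨_, h1⟩
  have hf2 : A.adjoint ⟨f, hf1⟩ = (starRingEnd ℂ) lam • f := LinearPMap.adjoint_apply_eq hd _ h1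
  have hAA : A.adjoint = A := hA
  have hle : A.adjoint ≤ A := hAA.le
  have hf3 : f ∈ A.domain := hle.1 hf1
  have hf4 : A ⟨f, hf3⟩ = (starRingEnd ℂ) lam • f := by
    rw [← hf2]
    exact (hle.2 rfl).symm
  have h5 := hT' ⟨f, hf3⟩
  rw [hf4, sub_self, map_zero] at h5
  exact h5.symm

end Abstract

/-! ### The closed Laplacian, its self-adjointness and its resolvent -/

section Laplacian

variable {n : ℕ}

theorem X_conj {φ : AxB n → ℂ} (hφ : ContDiff ℝ ∞ φ) :
    X (fun g => (starRingEnd ℂ) (φ g)) = fun g => (starRingEnd ℂ) (X φ g) := by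
  funext g
  have h := (Complex.conjCLE : ℂ →L[ℝ] ℂ).hasFDerivAt.comp g
    (hφ.differentiable (by simp) g).hasFDerivAt
  simp only [X]
  exact congrArg (fun L : AxB n →L[ℝ] ℂ => L (1, 0)) h.fderiv

theorem Y_conj (j : Fin n) {φ : AxB n → ℂ} (hφ : ContDiff ℝ ∞ φ) :
    Y j (fun g => (starRingEnd ℂ) (φ g)) = fun g => (starRingEnd ℂ) (Y j φ g) := by
  funext g
  have h := (Complex.conjCLE : ℂ →L[ℝ] ℂ).hasFDerivAt.comp g
    (hφ.differentiable (by simp) g).hasFDerivAt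
  have h1 : fderiv ℝ (fun g => (starRingEnd ℂ) (φ g)) g (0, EuclideanSpace.single j 1) =
      (starRingEnd ℂ) (fderiv ℝ φ g (0, EuclideanSpace.single j 1)) :=
    congrArg (fun L : AxB n →L[ℝ] ℂ => L (0, EuclideanSpace.single j 1)) h.fderiv
  simp only [Y, map_mul, Complex.conj_ofReal, h1]

theorem contDiff_conj {φ : AxB n → ℂ} (hφ : ContDiff ℝ ∞ φ) :
    ContDiff ℝ ∞ fun g => (starRingEnd ℂ) (φ g) :=
  Complex.conjCLE.contDiff.comp hφ

theorem lap_conj {φ : AxB n → ℂ} (hφ : ContDiff ℝ ∞ φ) :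
    lap (fun g => (starRingEnd ℂ) (φ g)) = fun g => (starRingEnd ℂ) (lap φ g) := by
  funext g
  simp only [lap]
  rw [X_conj hφ, X_conj (contDiff_X hφ)]
  simp_rw [Y_conj _ hφ, Y_conj _ (contDiff_Y _ hφ)]
  simp

theorem inner_lapGraph {p q : L2 n × L2 n} (hp : p ∈ lapGraph n) (hq : q ∈ lapGraph n) :
    inner ℂ p.2 q.1 = inner ℂ p.1 q.2 := by
  obtain ⟨φ, a1, a2, a3, a4⟩ := hp
  obtain ⟨ψ, b1, b2, b3, b4⟩ := hq
  rw [L2.inner_def, L2.inner_def]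
  have e1 : ∫ g, inner ℂ (p.2 g) (q.1 g) = ∫ g, lap (fun g => (starRingEnd ℂ) (φ g)) g * ψ g := by
    refine integral_congr_ae ?_
    filter_upwards [a4, b3] with g h1 h2
    rw [h1, h2, RCLike.inner_apply, lap_conj a1, mul_comm]
  have e2 : ∫ g, inner ℂ (p.1 g) (q.2 g) = ∫ g, (starRingEnd ℂ) (φ g) * lap ψ g := by
    refine integral_congr_ae ?_
    filter_upwards [a3, b4] with g h1 h2
    rw [h1, h2, RCLike.inner_apply, mul_comm]
  rw [e1, e2]
  exact integral_lap_mul_comm (by exact_mod_cast contDiff_infty.1 (contDiff_conj a1) 2)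
    (by exact_mod_cast contDiff_infty.1 b1 2) b2

theorem mem_closure_lapGraph_of_forall {P : L2 n × L2 n → Prop} (hP : IsClosed {p | P p})
    (h : ∀ p ∈ lapGraph n, P p) {p : L2 n × L2 n} (hp : p ∈ (lapGraph n).topologicalClosure) :
    P p :=
  closure_minimal (s := (lapGraph n : Set (L2 n × L2 n))) h hP hp

theorem inner_closure_lapGraph {p q : L2 n × L2 n} (hp : p ∈ (lapGraph n).topologicalClosure)
    (hq : q ∈ (lapGraph n).topologicalClosure) : inner ℂ p.2 q.1 = inner ℂ p.1 q.2 := by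
  refine mem_closure_lapGraph_of_forall (P := fun p => inner ℂ p.2 q.1 = inner ℂ p.1 q.2)
    (isClosed_eq (by fun_prop) (by fun_prop)) (fun p hp => ?_) hp
  exact mem_closure_lapGraph_of_forall (P := fun q => inner ℂ p.2 q.1 = inner ℂ p.1 q.2)
    (isClosed_eq (by fun_prop) (by fun_prop)) (fun q hq => inner_lapGraph hp hq) hq

theorem exists_mem_lapGraph {φ : AxB n → ℂ} (hφ : ContDiff ℝ ∞ φ) (hc : HasCompactSupport φ) :
    ∃ p ∈ lapGraph n, p.1 =ᵐ[volume] φ ∧ p.2 =ᵐ[volume] lap φ := by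
  have h1 : MemLp φ 2 (volume : Measure (AxB n)) :=
    hφ.continuous.memLp_of_hasCompactSupport hc
  have h2 : MemLp (lap φ) 2 (volume : Measure (AxB n)) :=
    (contDiff_lap hφ).continuous.memLp_of_hasCompactSupport (hasCompactSupport_lap hc)
  exact ⟨(h1.toLp, h2.toLp), ⟨φ, hφ, hc, h1.coeFn_toLp, h2.coeFn_toLp⟩, h1.coeFn_toLp,
    h2.coeFn_toLp⟩

theorem dense_domain_lapGraph : Dense ((lapGraph n).toLinearPMap.domain : Set (L2 n)) := by
  refine (Lp.dense_hasCompactSupport_contDiff (F := ℂ) (E := AxB n) (μ := volume) (p := 2)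
    (by norm_num)).mono ?_
  rintro f ⟨φ, h1, h2, h3⟩
  obtain ⟨p, hp, hp1, -⟩ := exists_mem_lapGraph h3 h2
  exact ⟨p, hp, Lp.ext (hp1.trans h1.symm)⟩

/-- The closure of the graph is again a graph: symmetry passes to the closure, so a limit `(0, v)`
has `v` orthogonal to the dense domain of test functions. -/
theorem graph_L : (L n).graph = (lapGraph n).topologicalClosure := by
  have hg := Submodule.toLinearPMap_graph_eq (lapGraph n) lapGraph_functional
  have hcl : (lapGraph n).toLinearPMap.IsClosable := by
    refine ⟨(lapGraph n).topologicalClosure.toLinearPMap, ?_⟩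
    rw [hg, Submodule.toLinearPMap_graph_eq]
    intro p hp h0
    refine dense_domain_lapGraph.eq_zero_of_inner_left ℂ ?_
    rintro _ ⟨q, hq, rfl⟩
    have := inner_closure_lapGraph hp ((lapGraph n).le_topologicalClosure hq)
    rw [h0, inner_zero_left] at this
    exact this
  rw [L, ← hcl.graph_closure_eq_closure_graph, hg]

theorem L_isClosed : (L n).IsClosed := by
  rw [LinearPMap.IsClosed, graph_L]
  exact (lapGraph n).isClosed_topologicalClosure

theorem mem_closure_lapGraph (u : (L n).domain) :
    ((u : L2 n), L n u) ∈ (lapGraph n).topologicalClosure := by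
  rw [← graph_L]
  exact (L n).mem_graph u

theorem dense_domain_L : Dense ((L n).domain : Set (L2 n)) :=
  dense_domain_lapGraph.mono (LinearPMap.le_closure _).1

theorem L_isFormalAdjoint : (L n).IsFormalAdjoint (L n) := fun u v =>
  inner_closure_lapGraph (mem_closure_lapGraph u) (mem_closure_lapGraph v)

/-- Convolution with the kernel is a left inverse of `lap - lam`, `lam = -ν²`, on test functions. -/
theorem averaging_lap_sub {ν lam : ℂ} (hν : ν.re < 0) (hlam : ν ^ 2 = -lam) (hn : 1 ≤ n) {l : ℕ}
    (hl : -1 < -(n : ℝ) / 2 + l) {T : L2 n →L[ℂ] L2 n}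
    (hT : ∀ f : L2 n, T f =ᵐ[volume] fun g => ∫ h, f (g * h) * kernel ν l h)
    {p : L2 n × L2 n} (hp : p ∈ lapGraph n) : T (p.2 - lam • p.1) = p.1 := by
  obtain ⟨φ, h1, h2, h3, h4⟩ := hp
  have h5 : (p.2 - lam • p.1 : L2 n) =ᵐ[volume] fun g => lap φ g + ν ^ 2 * φ g := by
    filter_upwards [h3, h4, Lp.coeFn_sub p.2 (lam • p.1), Lp.coeFn_smul lam p.1] with g a1 a2 a3 a4
    rw [a3, Pi.sub_apply, a4, Pi.smul_apply, a1, a2, hlam, smul_eq_mul]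
    ring
  refine Lp.ext ((hT _).trans ?_)
  filter_upwards [h3] with g hg
  rw [hg]
  -- The fundamental solution is tested against the left translate `h ↦ φ(g h)`, whose value at the
  -- identity is `φ(g)`.
  have h6 := integral_lap_add_mul_kernel hν hn hl (contDiff_comp_mul_left h1 g)
    (hasCompactSupport_comp_mul_left h2 g)
  rw [lap_comp_mul_left h1, mul_one] at h6
  rw [← h6]
  refine integral_congr_ae ?_
  filter_upwards [(quasiMeasurePreserving_mul_left g).ae h5] with h hh
  rw [hh]

/-- Convolution with the kernel is a left inverse of `L - lam`, `lam = -ν²`. -/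
theorem exists_left_inverse {ν lam : ℂ} (hν : ν.re < 0) (hlam : ν ^ 2 = -lam) (hn : 1 ≤ n) {l : ℕ}
    (hl : -1 < -(n : ℝ) / 2 + l) : ∃ T : L2 n →L[ℂ] L2 n,
    (∀ u : (L n).domain, T (L n u - lam • (u : L2 n)) = u) ∧
    ∀ f : L2 n, (∀ᵐ g, Integrable fun h => f (g * h) * kernel ν l h) ∧
      T f =ᵐ[volume] fun g => ∫ h, f (g * h) * kernel ν l h := by
  obtain ⟨T, hT⟩ := exists_averaging_operator (integrable_kernel (n := n) hν hn hl)
  refine ⟨T, fun u => ?_, hT⟩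
  exact mem_closure_lapGraph_of_forall (P := fun p => T (p.2 - lam • p.1) = p.1)
    (isClosed_eq (by fun_prop) (by fun_prop))
    (fun p hp => averaging_lap_sub hν hlam hn hl (fun f => (hT f).2) hp) (mem_closure_lapGraph u)

/-- Orthogonality to the range of `L + 1` on test functions says that the conjugate of `f` is a weak
solution of `lap W + W = 0`, which `ae_eq_zero_of_weak_solution` excludes unless it vanishes. -/
theorem eq_zero_of_orthogonal {f : L2 n}
    (hf : ∀ u : (L n).domain, inner ℂ f (L n u - (-1 : ℂ) • (u : L2 n)) = 0) : f = 0 := by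
  have hfm := Lp.stronglyMeasurable f
  have hw : StronglyMeasurable fun g => (starRingEnd ℂ) (f g) :=
    Complex.continuous_conj.comp_stronglyMeasurable hfm
  have hw2 : MemLp (fun g => (starRingEnd ℂ) (f g)) 2 :=
    (Lp.memLp f).congr_norm hw.aestronglyMeasurable (.of_forall fun g => (RCLike.norm_conj _).symm)
  have h := ae_eq_zero_of_weak_solution hw hw2 fun φ hφ hc => ?_
  · refine Lp.eq_zero_iff_ae_eq_zero.2 ?_
    filter_upwards [h] with g hg
    exact (map_eq_zero _).1 hg
  · obtain ⟨p, hp, hp1, hp2⟩ := exists_mem_lapGraph hφ hc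
    have hpL : p ∈ (L n).graph := by
      rw [graph_L]
      exact (lapGraph n).le_topologicalClosure hp
    obtain ⟨u, hu1, hu2⟩ := (LinearPMap.mem_graph_iff _).1 hpL
    have h1 := hf u
    rw [hu1, hu2, L2.inner_def] at h1
    rw [← h1]
    refine integral_congr_ae ?_
    filter_upwards [hp1, hp2, Lp.coeFn_sub p.2 ((-1 : ℂ) • p.1), Lp.coeFn_smul (-1 : ℂ) p.1]
      with g a1 a2 a3 a4
    rw [a3, Pi.sub_apply, a4, Pi.smul_apply, a1, a2, RCLike.inner_apply, smul_eq_mul]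
    ring

theorem isSelfAdjoint_L (hn : 1 ≤ n) : IsSelfAdjoint (L n) := by
  -- At `λ = -1` one takes `ν = i · i = -1`, with the least admissible `l`.
  obtain ⟨T, hT, -⟩ := exists_left_inverse (n := n) (ν := -1) (lam := -1) (by simp) (by norm_num) hn
    (neg_half_add_div_two n).1
  exact isSelfAdjoint_of_resolvent L_isClosed dense_domain_L L_isFormalAdjoint hT
    fun f hf => eq_zero_of_orthogonal hf

theorem exists_isResolvent {ν lam : ℂ} (hν : ν.re < 0) (hlam : ν ^ 2 = -lam) (hn : 1 ≤ n) {l : ℕ}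
    (hl : -1 < -(n : ℝ) / 2 + l) : ∃ T : L2 n →L[ℂ] L2 n, IsResolvent (L n) lam T ∧
    ∀ f : L2 n, ∀ᵐ g' : AxB n, Integrable (fun g : AxB n => f g⁻¹ * kernel ν l (g * g')) ∧
      T f g' = ∫ g : AxB n, f g⁻¹ * kernel ν l (g * g') := by
  obtain ⟨T, hT, hT2⟩ := exists_left_inverse hν hlam hn hl
  -- Conjugating `ν` keeps its real part and conjugates `ν² = -λ`, so the same construction gives a
  -- left inverse at `λ̄`.
  obtain ⟨T', hT', -⟩ := exists_left_inverse (n := n) (ν := (starRingEnd ℂ) ν)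
    (lam := (starRingEnd ℂ) lam) (by simpa using hν) (by rw [← map_pow, hlam, map_neg]) hn hl
  refine ⟨T, isResolvent_of_isSelfAdjoint (isSelfAdjoint_L hn) hT hT', fun f => ?_⟩
  filter_upwards [(hT2 f).1, (hT2 f).2] with g' h1 h2
  obtain ⟨c1, c2⟩ := convolution_kernel_inv (kernel_inv ν l) f g'
  exact ⟨c1.2 h1, by rw [h2, c2]⟩

end Laplacian

end AxB

end

theorem mainTheorem8 (n : ℕ) (hn : 1 ≤ n) :
    IsSelfAdjoint (AxB.L n) ∧
    ∃ C : ℝ, ∀ lam ν : ℂ, (¬ ∃ t : ℝ, 0 ≤ t ∧ lam = (t : ℂ)) →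
      (∃ s : ℂ, s ^ 2 = lam ∧ ν = Complex.I * s) → ν.re < 0 →
      ∀ l : ℕ, -1 < -(n : ℝ) / 2 + l →
        (∀ g : AxB n, g ≠ 1 →
          IntegrableOn (AxB.integrand n ν l (AxB.radius g)) (Ioi (AxB.radius g))) ∧
        Integrable (AxB.kernel (n := n) ν l) ∧
        (∀ R : ℝ, 0 < R →
          ∫ g in AxB.ball n R, ‖AxB.kernel ν l g‖ ≤
            C * (1 + ‖ν‖) ^ ((n : ℝ) / 2) * (1 + ∫ r in (0 : ℝ)..R, Real.exp (ν.re * r) * r)) ∧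
        ∃ T : AxB.L2 n →L[ℂ] AxB.L2 n, AxB.IsResolvent (AxB.L n) lam T ∧
          ∀ f : AxB.L2 n, ∀ᵐ g' : AxB n,
            Integrable (fun g : AxB n => f g⁻¹ * AxB.kernel ν l (g * g')) ∧
            T f g' = ∫ g : AxB n, f g⁻¹ * AxB.kernel ν l (g * g') := by
  obtain ⟨C, hC⟩ := AxB.integral_ball_norm_kernel_le n hn
  refine ⟨AxB.isSelfAdjoint_L hn, C, ?_⟩
  rintro lam ν - ⟨s, rfl, hs⟩ hν l hl
  have hlam : ν ^ 2 = -s ^ 2 := by rw [hs, mul_pow, Complex.I_sq, neg_one_mul]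
  exact ⟨fun g hg => AxB.integrableOn_integrand hν.le hn hl (AxB.radius_pos hg),
    AxB.integrable_kernel hν hn hl, fun R hR => hC ν hν l hl R hR,
    AxB.exists_isResolvent hν hlam hn hl⟩
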